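/- Let $\kappa=\mathbb F_q$ be a finite field, $\bar\kappa$ an algebraic closure of $\kappa$, $m\ge 1$ an integer, and $V$ a $2m$-dimensional $\kappa$-vector space with a non-degenerate alternating bilinear form $\langle\,,\,\rangle$, extended bilinearly to $V_{\bar\kappa}=V\otimes_\kappa\bar\kappa$. For a $\bar\kappa$-subspace $U\subseteq V_{\bar\kappa}$ let $\Phi(U)$ be the $\bar\kappa$-span of its image under the Frobenius $v\otimes a\mapsto v\otimes a^q$; call $U$ Lagrangian if $\dim U=m$ and $\langle\,,\,\rangle$ vanishes on $U$. A variety here is a reduced scheme of finite type over $\bar\kappa$ (not necessarily irreducible). Let $\mathrm{Gr}(i,V)$ be the Grassmannian variety over $\bar\kappa$ of $i$-dimensional subspaces of $V_{\bar\kappa}$, let $L_V\subseteq\mathrm{Gr}(m,V)$ be the closed subvariety of Lagrangian subspaces, and let $S_V\subseteq L_V$ and $Y_V\subseteq L_V\times\mathrm{Gr}(m-1,V)$ be the (reduced) closed subvarieties with $\bar\kappa$-points $$S_V(\bar\kappa)=\{U \text{ Lagrangian}\mid \dim(U\cap\Phi(U))\ge m-1\},$$ $$Y_V(\bar\kappa)=\{(U,U')\mid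 U \text{ Lagrangian},\ \dim U'=m-1,\ U'\subseteq U\cap\Phi(U)\}.$$ (The closures of these sets of points have no further $\bar\kappa$-points.) Then: 1. $Y_V$ is projective over $\bar\kappa$ and smooth over $\bar\kappa$ of dimension $m$. 2. The projection $(U,U')\mapsto U$ defines a morphism $\pi_m:Y_V\to S_V$ over $\bar\kappa$ which is an isomorphism over the open complement of the set of $\kappa$-points of $S_V$, that is, of the points $U=U_0\otimes_\kappa\bar\kappa$ with $U_0\subseteq V$ a $\kappa$-subspace. 3. For every $\kappa$-point $z$ of $S_V$, the scheme-theoretic fibre $\pi_m^{-1}(z)$ is isomorphic to $\mathbb P^{m-1}_{\bar\kappa}$ over $\bar\kappa$. -/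

import Mathlib

open AlgebraicGeometry CategoryTheory CategoryTheory.Limits
open scoped TensorProduct

universe u

namespace DeligneLusztig

noncomputable section

attribute [local instance] MvPolynomial.gradedAlgebra

/-! ### Schemes and varieties over a field -/

/-- Schemes over the field `K`. -/
abbrev SchOver (K : Type u) [Field K] := Over (Spec (CommRingCat.of K))

/-- The set `X(K)` of `K`-points of a `K`-scheme `X`. -/
abbrev KPoint {K : Type u} [Field K] (X : SchOver K) := Over.mk (𝟙 (Spec (CommRingCat.of K))) ⟶ X

/-- The topological point of `X` underlying a `K`-point. -/
def KPoint.pt {K : Type u} [Field K] {X : SchOver K} (x : KPoint X) : X.left :=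
  x.left (IsLocalRing.closedPoint K)

/-- The closed subvariety of `X` determined by a set `T` of `K`-points: the reduced closed
subscheme of `X` whose underlying space is the closure of `T`. -/
def subvariety {K : Type u} [Field K] (X : SchOver K) (T : Set (KPoint X)) : SchOver K :=
  Over.mk ((Scheme.IdealSheafData.vanishingIdeal
    ⟨closure (KPoint.pt '' T), isClosed_closure⟩).subschemeι ≫ X.hom)

/-- The closed immersion of a closed subvariety in the ambient scheme. -/
def subvarietyι {K : Type u} [Field K] (X : SchOver K) (T : Set (KPoint X)) :
    subvariety X T ⟶ X :=
  Over.homMk (Scheme.IdealSheafData.vanishingIdeal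
    ⟨closure (KPoint.pt '' T), isClosed_closure⟩).subschemeι rfl

/-- The fibre product `X ×_K Y` of two `K`-schemes. -/
def prodOver {K : Type u} [Field K] (X Y : SchOver K) : SchOver K :=
  Over.mk (pullback.fst X.hom Y.hom ≫ X.hom)

/-- The first projection `X ×_K Y ⟶ X`. -/
def prodFst {K : Type u} [Field K] (X Y : SchOver K) : prodOver X Y ⟶ X :=
  Over.homMk (pullback.fst X.hom Y.hom) rfl

/-- The second projection `X ×_K Y ⟶ Y`. -/
def prodSnd {K : Type u} [Field K] (X Y : SchOver K) : prodOver X Y ⟶ Y :=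
  Over.homMk (pullback.snd X.hom Y.hom) pullback.condition.symm

/-- The scheme-theoretic fibre of `f : X ⟶ Y` over a `K`-point `y` of `Y`, as a `K`-scheme. -/
def fibreOver {K : Type u} [Field K] {X Y : SchOver K} (f : X ⟶ Y) (y : KPoint Y) : SchOver K :=
  Over.mk (pullback.snd f.left y.left)

/-- The projective space over `K` with homogeneous coordinates indexed by `σ`;
`projSpace K (Fin (d + 1))` is `ℙᵈ`. -/
def projSpace (K : Type u) [Field K] (σ : Type) : SchOver K :=
  Over.mk (Proj.toSpecZero (MvPolynomial.homogeneousSubmodule σ K) ≫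
    Spec.map (CommRingCat.ofHom (algebraMap K (MvPolynomial.homogeneousSubmodule σ K 0))))

/-- A `K`-scheme is projective if it admits a closed immersion over `K` in some `ℙᵈ`. -/
def IsProjectiveOver {K : Type u} [Field K] (X : SchOver K) : Prop :=
  ∃ (d : ℕ) (j : X ⟶ projSpace K (Fin (d + 1))), IsClosedImmersion j.left

/-- Evaluation at `v`, as a map to the global sections of `Spec K`. -/
def evalHom {K : Type u} [Field K] {σ : Type} (v : σ → K) :
    MvPolynomial σ K →+* Γ(Spec (CommRingCat.of K), ⊤) :=
  (Scheme.ΓSpecIso (CommRingCat.of K)).inv.hom.comp (MvPolynomial.aeval v).toRingHom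

theorem evalHom_irrelevant {K : Type u} [Field K] {σ : Type} (v : σ → K) (hv : v ≠ 0) :
    (HomogeneousIdeal.irrelevant (MvPolynomial.homogeneousSubmodule σ K)).toIdeal.map
      (evalHom v) = ⊤ := by
  obtain ⟨j, hj⟩ := Function.ne_iff.mp hv
  have hX : (MvPolynomial.X j : MvPolynomial σ K) ∈
      (HomogeneousIdeal.irrelevant (MvPolynomial.homogeneousSubmodule σ K)).toIdeal := by
    have h1 : (MvPolynomial.X j : MvPolynomial σ K) ∈ MvPolynomial.homogeneousSubmodule σ K 1 :=
      MvPolynomial.isHomogeneous_X K j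
    change _ ∈ HomogeneousIdeal.irrelevant _
    rw [HomogeneousIdeal.mem_irrelevant_iff]
    exact DirectSum.decompose_of_mem_ne _ h1 one_ne_zero
  refine Ideal.eq_top_of_isUnit_mem _ (Ideal.mem_map_of_mem (evalHom v) hX) ?_
  have : evalHom v (MvPolynomial.X j) =
      (Scheme.ΓSpecIso (CommRingCat.of K)).inv.hom (v j) := by
    simp [evalHom]
  rw [this]
  exact (IsUnit.mk0 (v j) hj).map _

/-- The `K`-point of projective space with homogeneous coordinates `v ≠ 0`. -/
def projPoint {K : Type u} [Field K] {σ : Type} (v : σ → K) (hv : v ≠ 0) :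
    KPoint (projSpace K σ) :=
  Over.homMk (Proj.fromOfGlobalSections (MvPolynomial.homogeneousSubmodule σ K)
    (evalHom v) (evalHom_irrelevant v hv)) (by
      simp only [projSpace, Over.mk_hom]
      rw [Proj.fromOfGlobalSections_toSpecZero_assoc, ← Spec.map_comp, ← CommRingCat.ofHom_comp]
      have : ((evalHom v).comp (algebraMap (MvPolynomial.homogeneousSubmodule σ K 0)
          (MvPolynomial σ K))).comp (algebraMap K (MvPolynomial.homogeneousSubmodule σ K 0)) =
          (Scheme.ΓSpecIso (CommRingCat.of K)).inv.hom := by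
        ext a
        have h : ((algebraMap K (MvPolynomial.homogeneousSubmodule σ K 0) a :
            MvPolynomial.homogeneousSubmodule σ K 0) : MvPolynomial σ K) =
            MvPolynomial.C a := rfl
        simp [evalHom, h]
      rw [this]
      simp)

/-! ### Symplectic linear algebra over a finite field -/

section LinearAlgebra

variable (κ : Type*) [Field κ] [Fintype κ] (K : Type u) [Field K] [Algebra κ K]
  {V : Type*} [AddCommGroup V] [Module κ V]

/-- For a `K`-subspace `U` of `V_K = K ⊗ V`, the subspace `Φ(U)` of `V_K`, where
`Φ(a ⊗ v) = a ^ q ⊗ v` and `q = #κ`. -/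
def frob (U : Submodule K (K ⊗[κ] V)) : Submodule K (K ⊗[κ] V) :=
  Submodule.span K
    (LinearMap.rTensor V (FiniteField.frobeniusAlgHom κ K).toLinearMap '' (U : Set (K ⊗[κ] V)))

variable {κ}

/-- `U ⊆ V_K` is Lagrangian: it has dimension `m` (where `dim V = 2m`) and is totally isotropic
for the bilinear extension of `ω`. -/
def IsLagrangian (ω : LinearMap.BilinForm κ V) (m : ℕ) (U : Submodule K (K ⊗[κ] V)) : Prop :=
  Module.finrank K U = m ∧ ∀ x ∈ U, ∀ y ∈ U, LinearMap.BilinForm.baseChange K ω x y = 0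

end LinearAlgebra

/-- The maximal minors of a family of `i` vectors `w a` in `K ^ n`, indexed by `i`-tuples of
coordinates. -/
def minors {K : Type u} [Field K] {n i : ℕ} (w : Fin i → Fin n → K) :
    (Fin i → Fin n) → K :=
  fun J => Matrix.det (Matrix.of fun a b => w a (J b))

theorem minors_ne_zero {K : Type u} [Field K] {n i : ℕ} (w : Fin i → Fin n → K)
    (hw : LinearIndependent K w) : minors w ≠ 0 := by
  classical
  let A : Matrix (Fin i) (Fin n) K := Matrix.of w
  have hrank : A.rank = i := by
    have h := LinearIndependent.rank_matrix (M := A) hw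
    simpa using h
  obtain ⟨ι, a, ha, hsp, hli⟩ := exists_linearIndependent' K A.col
  have hfin : Finite ι := Finite.of_injective a ha
  have : Fintype ι := Fintype.ofFinite ι
  have hcard : Fintype.card ι = i := by
    have h1 := finrank_span_eq_card hli
    rw [hsp, ← Matrix.rank_eq_finrank_span_cols, hrank] at h1
    exact h1.symm
  let f : Fin i ≃ ι := (Fintype.equivFinOfCardEq hcard).symm
  have hli' : LinearIndependent K (A.submatrix id (a ∘ f)).col := hli.comp f f.injective
  rw [Matrix.linearIndependent_cols_iff_isUnit, Matrix.isUnit_iff_isUnit_det] at hli'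
  intro h0
  have h1 : minors w (a ∘ f) = 0 := by rw [h0]; rfl
  exact hli'.ne_zero h1

section Plucker

variable {K : Type u} [Field K] {W : Type*} [AddCommGroup W] [Module K W] {n i : ℕ}
  (b : Module.Basis (Fin n) K W) (U : Submodule K W) (hU : Module.finrank K U = i)

/-- The coordinates in the basis `b` of a chosen basis of an `i`-dimensional subspace `U`. -/
def coordMatrix : Fin i → Fin n → K :=
  haveI : Module.Finite K W := Module.Finite.of_basis b
  fun a => b.equivFun (Module.finBasisOfFinrankEq K U hU a : W)

theorem coordMatrix_linearIndependent : LinearIndependent K (coordMatrix b U hU) :=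
  haveI : Module.Finite K W := Module.Finite.of_basis b
  (((Module.finBasisOfFinrankEq K U hU).linearIndependent.map' U.subtype
    (Submodule.ker_subtype U)).map' b.equivFun.toLinearMap (LinearEquiv.ker _))

/-- The Plücker point of an `i`-dimensional subspace `U`: its homogeneous coordinates are the
maximal minors of a basis of `U`, written in the basis `b`. Since all `i`-tuples of coordinates
rather than the increasing ones are used, this is the usual Plücker embedding followed by the
linear embedding which repeats each coordinate up to sign and inserts zeros. -/
def pluckerPoint : KPoint (projSpace K (Fin i → Fin n)) :=
  projPoint (minors (coordMatrix b U hU)) (minors_ne_zero _ (coordMatrix_linearIndependent b U hU))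

end Plucker

/-! ### Grassmannians and the varieties `L_V`, `S_V`, `Y_V` -/

section Varieties

variable {κ : Type*} [Field κ] (K : Type u) [Field K] [Algebra κ K]
  {V : Type*} [AddCommGroup V] [Module κ V] {n : ℕ} (e : Module.Basis (Fin n) κ V)

/-- The Grassmannian variety `Gr(i, V)` over `K`, in its Plücker embedding. -/
def Gr (i : ℕ) : SchOver K :=
  subvariety (projSpace K (Fin i → Fin n))
    {x | ∃ (U : Submodule K (K ⊗[κ] V)) (hU : Module.finrank K U = i),
      x = pluckerPoint (e.baseChange K) U hU}

/-- The Plücker embedding. -/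
def Gr.ι (i : ℕ) : Gr K e i ⟶ projSpace K (Fin i → Fin n) := subvarietyι _ _

/-- The `K`-point `x` of `Gr(i, V)` is the subspace `U`. -/
def Gr.IsPoint {i : ℕ} (x : KPoint (Gr K e i)) (U : Submodule K (K ⊗[κ] V)) : Prop :=
  ∃ hU : Module.finrank K U = i, x ≫ Gr.ι K e i = pluckerPoint (e.baseChange K) U hU

/-- The Lagrangian Grassmannian `L_V`, as a closed subvariety of `Gr(m, V)`. -/
def LV (ω : LinearMap.BilinForm κ V) (m : ℕ) : SchOver K :=
  subvariety (Gr K e m)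
    {x | ∃ U : Submodule K (K ⊗[κ] V), IsLagrangian K ω m U ∧ Gr.IsPoint K e x U}

/-- The inclusion of `L_V` in `Gr(m, V)`. -/
def LV.ι (ω : LinearMap.BilinForm κ V) (m : ℕ) : LV K e ω m ⟶ Gr K e m := subvarietyι _ _

/-- The `K`-point `x` of `L_V` is the subspace `U`. -/
def LV.IsPoint {ω : LinearMap.BilinForm κ V} {m : ℕ} (x : KPoint (LV K e ω m))
    (U : Submodule K (K ⊗[κ] V)) : Prop :=
  Gr.IsPoint K e (x ≫ LV.ι K e ω m) U

variable [Fintype κ]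

/-- The closed subvariety `S_V` of `L_V` of all `U` with `dim (U ∩ Φ(U)) ≥ m - 1`. -/
def SV (ω : LinearMap.BilinForm κ V) (m : ℕ) : SchOver K :=
  subvariety (LV K e ω m)
    {x | ∃ U : Submodule K (K ⊗[κ] V), IsLagrangian K ω m U ∧
      m - 1 ≤ Module.finrank K ↥(U ⊓ frob κ K U) ∧ LV.IsPoint K e x U}

/-- The inclusion of `S_V` in `L_V`. -/
def SV.ι (ω : LinearMap.BilinForm κ V) (m : ℕ) : SV K e ω m ⟶ LV K e ω m := subvarietyι _ _

/-- The `K`-point `x` of `S_V` is the subspace `U`. -/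
def SV.IsPoint {ω : LinearMap.BilinForm κ V} {m : ℕ} (x : KPoint (SV K e ω m))
    (U : Submodule K (K ⊗[κ] V)) : Prop :=
  LV.IsPoint K e (x ≫ SV.ι K e ω m) U

/-- The `K`-point `x` of `S_V` is a `κ`-point: it is the scalar extension `U₀ ⊗ K` of a
`κ`-subspace `U₀` of `V`. -/
def SV.IsRational {ω : LinearMap.BilinForm κ V} {m : ℕ} (x : KPoint (SV K e ω m)) : Prop :=
  ∃ U₀ : Submodule κ V, SV.IsPoint K e x (U₀.baseChange K)

/-- The closed subvariety `Y_V` of `L_V × Gr(m - 1, V)` of all `(U, U')` with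
`U' ⊆ U ∩ Φ(U)`. -/
def YV (ω : LinearMap.BilinForm κ V) (m : ℕ) : SchOver K :=
  subvariety (prodOver (LV K e ω m) (Gr K e (m - 1)))
    {y | ∃ U U' : Submodule K (K ⊗[κ] V), IsLagrangian K ω m U ∧
      Module.finrank K U' = m - 1 ∧ U' ≤ U ⊓ frob κ K U ∧
      LV.IsPoint K e (y ≫ prodFst _ _) U ∧ Gr.IsPoint K e (y ≫ prodSnd _ _) U'}

/-- The inclusion of `Y_V` in `L_V × Gr(m - 1, V)`. -/
def YV.ι (ω : LinearMap.BilinForm κ V) (m : ℕ) :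
    YV K e ω m ⟶ prodOver (LV K e ω m) (Gr K e (m - 1)) := subvarietyι _ _

/-- The `K`-point `y` of `Y_V` is the pair `(U, U')`. -/
def YV.IsPoint {ω : LinearMap.BilinForm κ V} {m : ℕ} (y : KPoint (YV K e ω m))
    (U U' : Submodule K (K ⊗[κ] V)) : Prop :=
  LV.IsPoint K e (y ≫ YV.ι K e ω m ≫ prodFst _ _) U ∧
    Gr.IsPoint K e (y ≫ YV.ι K e ω m ≫ prodSnd _ _) U'

end Varieties

end

end DeligneLusztig

/-! Locally the theorem is a statement about symmetric matrices. A Lagrangian `U` has a Lagrangian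
complement defined over `κ` (`exists_rational_lagrangian_complement`), so for some symplectic basis
of `V` (`exists_symplecticBasis`) it is the graph of a symmetric matrix `S` over `K`. The basis is
rational, hence `Φ(U)` is the graph of `S^(q)`, the matrix of `q`-th powers of the entries
(`frob_graph`). A hyperplane `U'` of `U` is the kernel of a linear form `l`, normalized by `l i = 1`
for some `i`. That `U'` lies in `Φ(U)` means that `S^(q) - S` vanishes on the kernel of `l`; by
symmetry this says `S^(q) - S = c l lᵗ` for a scalar `c` (`hyper_le_graph_iff_of_isSymm`).

So `Y_V` is covered by charts with coordinates `c`, the `l k` for `k ≠ i`, and the entries of `S`,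
subject to the Artin–Schreier equations `S k j ^ q - S k j = c l k l j` (`exists_chart`). The
Jacobian matrix of these equations is `-1`, so the chart is étale over an affine space of dimension
`m`; this gives smoothness and the dimension.

Put `T = S^(q) - S`. At a point of `S_V` which is not rational, `T` is a nonzero matrix `c l lᵗ`,
some diagonal entry `T i i` is invertible, and `l k = T k i / T i i` recovers `U'` by regular
functions (`exists_section_of_projection`). This is a section of the projection, and the projection
is injective on points there. At a rational point `T = 0`, so `c = 0`, `S` is fixed and `l` is an
arbitrary nonzero form up to scalars: the fibre is a projective space (`nonempty_fibreOver_iso`).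
Projectivity comes from the Plücker and Segre embeddings (`isProjectiveOver_YV`).

Since the varieties are reduced and `K` is algebraically closed, equalities and constructions of
morphisms are checked on `K`-points, with `regularFun` as the dictionary between functions on points
and global sections. The scheme-theoretic fibre is not known to be reduced beforehand; there the
argument uses that the entries of `S` and `l` generate the coordinate ring of a chart. -/

namespace DeligneLusztig

noncomputable section

attribute [local instance] MvPolynomial.gradedAlgebra

/-! ### Rational points and values of functions -/

section Points

variable {K : Type u} [Field K] {X Y Z : SchOver K}

/-- The value of a global function at a `K`-point. -/
def val (x : KPoint X) : Γ(X.left, ⊤) →+* K :=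
  (Scheme.ΓSpecIso (CommRingCat.of K)).hom.hom.comp x.left.appTop.hom

theorem val_comp (x : KPoint X) (f : X ⟶ Y) (s : Γ(Y.left, ⊤)) :
    val (x ≫ f) s = val x (f.left.appTop s) := by
  simp only [val, RingHom.comp_apply, Over.comp_left, Scheme.Hom.comp_appTop]
  rfl

theorem KPoint.pt_comp (x : KPoint X) (f : X ⟶ Y) : KPoint.pt (x ≫ f : KPoint Y) = f.left x.pt := by
  rfl

/-- Pulled back to `Spec K`, the basic open set is that of an element of a field, whose only prime
ideal is zero. -/
theorem pt_mem_basicOpen_iff (x : KPoint X) (s : Γ(X.left, ⊤)) :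
    x.pt ∈ X.left.basicOpen s ↔ val x s ≠ 0 := by
  have h : x.pt ∈ X.left.basicOpen s ↔
      IsLocalRing.closedPoint K ∈ x.left ⁻¹ᵁ X.left.basicOpen s := Iff.rfl
  rw [h, Scheme.preimage_basicOpen_top]
  have h2 : (Spec (CommRingCat.of K)).basicOpen (x.left.appTop s) =
      PrimeSpectrum.basicOpen (val x s) := by
    rw [basicOpen_eq_of_affine']
    rfl
  change _ ∈ (Spec (CommRingCat.of K)).basicOpen (x.left.appTop s) ↔ _
  rw [h2]
  change val x s ∉ (IsLocalRing.closedPoint K).asIdeal ↔ _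
  have : (IsLocalRing.closedPoint K).asIdeal = ⊥ := IsLocalRing.maximalIdeal_eq_bot
  rw [this, Ideal.mem_bot]

theorem val_base (x : KPoint X) (a : K) :
    val x (X.hom.appTop ((Scheme.ΓSpecIso (CommRingCat.of K)).inv a)) = a := by
  have h := Over.w x
  have h2 : X.hom.appTop ≫ x.left.appTop = 𝟙 _ := by
    rw [← Scheme.Hom.comp_appTop, h]
    simp
  simp only [val, RingHom.comp_apply]
  change (Scheme.ΓSpecIso (CommRingCat.of K)).hom ((X.hom.appTop ≫ x.left.appTop) _) = _
  rw [h2]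
  simp

/-- An open subscheme, as a scheme over the base field. -/
def openSub (X : SchOver K) (U : X.left.Opens) : SchOver K := Over.mk (U.ι ≫ X.hom)

/-- The inclusion of an open subscheme. -/
def openSubι (X : SchOver K) (U : X.left.Opens) : openSub X U ⟶ X := Over.homMk U.ι rfl

instance (U : X.left.Opens) : IsOpenImmersion (openSubι X U).left :=
  inferInstanceAs (IsOpenImmersion U.ι)

theorem range_openSubι (U : X.left.Opens) : Set.range (openSubι X U).left = U :=
  U.range_ι

instance (U : X.left.Opens) [LocallyOfFiniteType X.hom] :
    LocallyOfFiniteType (openSub X U).hom :=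
  inferInstanceAs (LocallyOfFiniteType (U.ι ≫ X.hom))

instance (U : X.left.Opens) [IsSeparated X.hom] : IsSeparated (openSub X U).hom :=
  inferInstanceAs (IsSeparated (U.ι ≫ X.hom))

instance (U : X.left.Opens) [IsReduced X.left] : IsReduced (openSub X U).left :=
  isReduced_of_isOpenImmersion (openSubι X U).left

/-- A morphism whose image lies in the range of an open immersion factors through it. -/
theorem exists_lift_of_isOpenImmersion {D : SchOver K} (j : D ⟶ X) [IsOpenImmersion j.left]
    (f : Y ⟶ X) (h : Set.range f.left ⊆ Set.range j.left) : ∃ g : Y ⟶ D, g ≫ j = f := by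
  refine ⟨Over.homMk (IsOpenImmersion.lift j.left f.left h) ?_, ?_⟩
  · rw [← Over.w j, ← Category.assoc, IsOpenImmersion.lift_fac, Over.w f]
  · apply Over.OverMorphism.ext
    exact IsOpenImmersion.lift_fac _ _ _

theorem exists_kPoint_lift {D : SchOver K} (j : D ⟶ X) [IsOpenImmersion j.left]
    (x : KPoint X) (h : x.pt ∈ Set.range j.left) : ∃ d : KPoint D, d ≫ j = x := by
  refine exists_lift_of_isOpenImmersion j x ?_
  rintro _ ⟨p, rfl⟩
  have : p = IsLocalRing.closedPoint K := Subsingleton.elim (α := PrimeSpectrum K) _ _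
  rw [this]
  exact h

theorem mono_of_isOpenImmersion {D : SchOver K} (j : D ⟶ X) [IsOpenImmersion j.left] : Mono j :=
  ⟨fun f g h ↦ Over.OverMorphism.ext <| by
    rw [← cancel_mono j.left]; exact congr_arg CommaMorphism.left h⟩

variable [IsAlgClosed K]

instance [LocallyOfFiniteType X.hom] : JacobsonSpace X.left :=
  LocallyOfFiniteType.jacobsonSpace X.hom

theorem KPoint.ext_of_pt [LocallyOfFiniteType X.hom] {x y : KPoint X} (h : x.pt = y.pt) :
    x = y := by
  apply Over.OverMorphism.ext
  exact ext_of_apply_closedPoint_eq X.hom (Over.w x) (Over.w y) h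

theorem KPoint.isClosed_pt [LocallyOfFiniteType X.hom] (x : KPoint X) : IsClosed {x.pt} :=
  (pointEquivClosedPoint X.hom ⟨x.left, Over.w x⟩).2

theorem exists_kPoint_of_isClosed [LocallyOfFiniteType X.hom] {p : X.left} (hp : IsClosed {p}) :
    ∃ x : KPoint X, x.pt = p :=
  ⟨Over.homMk (pointOfClosedPoint X.hom p hp) (pointOfClosedPoint_comp X.hom p hp),
    pointOfClosedPoint_apply X.hom p hp _⟩

/-- The scheme is Jacobson, so closed points are dense in every locally closed subset, and over an
algebraically closed field closed points come from `K`-points. All later checks on `K`-points rest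
on this. -/
theorem exists_kPoint_of_isLocallyClosed [LocallyOfFiniteType X.hom] {S : Set X.left}
    (hS : IsLocallyClosed S) (hne : S.Nonempty) : ∃ x : KPoint X, x.pt ∈ S := by
  have h := JacobsonSpace.closure_inter_closedPoints_eq_closure hS
  have h2 : (S ∩ closedPoints X.left).Nonempty := by
    rw [← closure_nonempty_iff, h, closure_nonempty_iff]
    exact hne
  obtain ⟨p, hp, hp'⟩ := h2
  obtain ⟨x, rfl⟩ := exists_kPoint_of_isClosed hp'
  exact ⟨x, hp⟩

theorem opens_le_of_kPoint [LocallyOfFiniteType X.hom] {U V : X.left.Opens}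
    (h : ∀ x : KPoint X, x.pt ∈ U → x.pt ∈ V) : U ≤ V := by
  by_contra hUV
  obtain ⟨p, hp, hp'⟩ := Set.not_subset.mp hUV
  obtain ⟨x, hx, hx'⟩ := exists_kPoint_of_isLocallyClosed (X := X) (S := (U : Set X.left) \ V)
    (U.2.isLocallyClosed.inter V.2.isClosed_compl.isLocallyClosed) ⟨p, hp, hp'⟩
  exact hx' (h x hx)

theorem opens_eq_top_of_kPoint [LocallyOfFiniteType X.hom] {U : X.left.Opens}
    (h : ∀ x : KPoint X, x.pt ∈ U) : U = ⊤ :=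
  top_le_iff.mp (opens_le_of_kPoint fun x _ ↦ h x)

/-- The source is reduced and the target separated, so agreement on the dense set of closed points
is enough. -/
theorem hom_ext_of_kPoint [LocallyOfFiniteType X.hom] [IsReduced X.left]
    [LocallyOfFiniteType Y.hom] [IsSeparated Y.hom] {f g : X ⟶ Y}
    (h : ∀ x : KPoint X, x ≫ f = x ≫ g) : f = g := by
  apply Over.OverMorphism.ext
  have : LocallyOfFiniteType (f.left ≫ Y.hom) := by rw [Over.w f]; infer_instance
  refine ext_of_apply_eq Y.hom Set.univ isClosed_univ.isLocallyClosed dense_univ ?_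
    ((Over.w f).trans (Over.w g).symm)
  intro p _ hp
  obtain ⟨x, rfl⟩ := exists_kPoint_of_isClosed hp
  rw [← KPoint.pt_comp, ← KPoint.pt_comp, h]

/-- The difference has an empty basic open set, which forces it to vanish on a reduced scheme. -/
theorem section_ext_of_val [LocallyOfFiniteType X.hom] [IsReduced X.left] {s t : Γ(X.left, ⊤)}
    (h : ∀ x : KPoint X, val x s = val x t) : s = t := by
  rw [← sub_eq_zero, ← basicOpen_eq_bot_iff, ← le_bot_iff]
  refine opens_le_of_kPoint fun x hx ↦ ?_
  rw [pt_mem_basicOpen_iff, map_sub, h, sub_self] at hx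
  exact absurd rfl hx

theorem exists_lift_of_kPoint [LocallyOfFiniteType Y.hom] {D : SchOver K} (j : D ⟶ X)
    [IsOpenImmersion j.left] (f : Y ⟶ X)
    (h : ∀ y : KPoint Y, f.left y.pt ∈ Set.range j.left) : ∃ g : Y ⟶ D, g ≫ j = f := by
  refine exists_lift_of_isOpenImmersion j f ?_
  have h1 : f.left ⁻¹ᵁ j.left.opensRange = ⊤ := opens_eq_top_of_kPoint fun y ↦ h y
  rintro _ ⟨p, rfl⟩
  exact h1.ge (Set.mem_univ p)

end Points

/-! ### Closed subvarieties, gluing and charts -/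

section Subvarieties

variable {K : Type u} [Field K] {X Y Z : SchOver K}

theorem isReduced_subscheme_vanishingIdeal {X : Scheme.{u}} (Z : TopologicalSpace.Closeds X) :
    IsReduced (Scheme.IdealSheafData.vanishingIdeal Z).subscheme := by
  have (U : X.affineOpens) :
      IsReduced ((Scheme.IdealSheafData.vanishingIdeal Z).subschemeCover.openCover.X U) := by
    have : _root_.IsReduced (Γ(X, U) ⧸ (Scheme.IdealSheafData.vanishingIdeal Z).ideal U) := by
      rw [← Ideal.isRadical_iff_quotient_reduced, Scheme.IdealSheafData.vanishingIdeal_ideal]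
      exact PrimeSpectrum.isRadical_vanishingIdeal _
    exact inferInstanceAs
      (IsReduced (Spec (.of (Γ(X, U) ⧸ (Scheme.IdealSheafData.vanishingIdeal Z).ideal U))))
  exact @IsReduced.of_openCover _ (Scheme.IdealSheafData.vanishingIdeal Z).subschemeCover.openCover this

instance (T : Set (KPoint X)) : IsReduced (subvariety X T).left :=
  isReduced_subscheme_vanishingIdeal _

instance (T : Set (KPoint X)) : IsClosedImmersion (subvarietyι X T).left :=
  inferInstanceAs (IsClosedImmersion (Scheme.IdealSheafData.subschemeι _))

instance (T : Set (KPoint X)) [LocallyOfFiniteType X.hom] :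
    LocallyOfFiniteType (subvariety X T).hom :=
  inferInstanceAs (LocallyOfFiniteType (Scheme.IdealSheafData.subschemeι _ ≫ X.hom))

instance (T : Set (KPoint X)) [IsSeparated X.hom] : IsSeparated (subvariety X T).hom :=
  inferInstanceAs (IsSeparated (Scheme.IdealSheafData.subschemeι _ ≫ X.hom))

theorem range_subvarietyι (T : Set (KPoint X)) :
    Set.range (subvarietyι X T).left = closure (KPoint.pt '' T) := by
  change Set.range (Scheme.IdealSheafData.subschemeι _) = _
  rw [Scheme.IdealSheafData.range_subschemeι, Scheme.IdealSheafData.coe_support_vanishingIdeal]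
  rfl

instance [LocallyOfFiniteType X.hom] [LocallyOfFiniteType Y.hom] :
    LocallyOfFiniteType (prodOver X Y).hom :=
  inferInstanceAs (LocallyOfFiniteType (pullback.fst X.hom Y.hom ≫ X.hom))

instance [IsSeparated X.hom] [IsSeparated Y.hom] : IsSeparated (prodOver X Y).hom :=
  inferInstanceAs (IsSeparated (pullback.fst X.hom Y.hom ≫ X.hom))

/-- The morphism to a product with given components. -/
def prodLift (f : Z ⟶ X) (g : Z ⟶ Y) : Z ⟶ prodOver X Y :=
  Over.homMk (pullback.lift f.left g.left ((Over.w f).trans (Over.w g).symm)) (by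
    change pullback.lift _ _ _ ≫ pullback.fst _ _ ≫ X.hom = Z.hom
    rw [pullback.lift_fst_assoc]
    exact Over.w f)

theorem prodLift_fst (f : Z ⟶ X) (g : Z ⟶ Y) : prodLift f g ≫ prodFst X Y = f :=
  Over.OverMorphism.ext (pullback.lift_fst _ _ _)

theorem prodLift_snd (f : Z ⟶ X) (g : Z ⟶ Y) : prodLift f g ≫ prodSnd X Y = g :=
  Over.OverMorphism.ext (pullback.lift_snd _ _ _)

theorem prod_hom_ext {f g : Z ⟶ prodOver X Y} (h₁ : f ≫ prodFst X Y = g ≫ prodFst X Y)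
    (h₂ : f ≫ prodSnd X Y = g ≫ prodSnd X Y) : f = g :=
  Over.OverMorphism.ext (pullback.hom_ext (congr_arg CommaMorphism.left h₁)
    (congr_arg CommaMorphism.left h₂))

/-- A morphism from a reduced scheme whose image lies in the image of a closed immersion factors
through it. -/
theorem exists_lift_of_isClosedImmersion {C : SchOver K} (i : C ⟶ X) [IsClosedImmersion i.left]
    [IsReduced Y.left] (f : Y ⟶ X) (h : Set.range f.left ⊆ Set.range i.left) :
    ∃ g : Y ⟶ C, g ≫ i = f := by
  have : Surjective (pullback.fst f.left i.left) := ⟨by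
    rw [← Set.range_eq_univ, Scheme.Pullback.range_fst]
    exact Set.eq_univ_of_forall fun p ↦ h ⟨p, rfl⟩⟩
  -- A surjective closed immersion into a reduced scheme is an isomorphism.
  have : IsIso (pullback.fst f.left i.left) := isIso_of_isClosedImmersion_of_surjective _
  have hg : (inv (pullback.fst f.left i.left) ≫ pullback.snd f.left i.left) ≫ i.left = f.left := by
    rw [Category.assoc, ← pullback.condition, IsIso.inv_hom_id_assoc]
  refine ⟨Over.homMk (inv (pullback.fst f.left i.left) ≫ pullback.snd f.left i.left) ?_, ?_⟩
  · rw [← Over.w i, ← Category.assoc, hg, Over.w f]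
  · exact Over.OverMorphism.ext hg

theorem mono_of_isClosedImmersion {C : SchOver K} (i : C ⟶ X) [IsClosedImmersion i.left] :
    Mono i :=
  ⟨fun f g h ↦ Over.OverMorphism.ext <| by
    rw [← cancel_mono i.left]; exact congr_arg CommaMorphism.left h⟩

instance (T : Set (KPoint X)) : Mono (subvarietyι X T) := mono_of_isClosedImmersion _

/-- The set `T` of `K`-points is closed: its closure has no further `K`-points. -/
def IsClosedKPoints (T : Set (KPoint X)) : Prop :=
  ∀ x : KPoint X, x.pt ∈ closure (KPoint.pt '' T) → x ∈ T

theorem IsClosedKPoints.mem {T : Set (KPoint X)} (hT : IsClosedKPoints T)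
    (x : KPoint (subvariety X T)) : (x ≫ subvarietyι X T : KPoint X) ∈ T := by
  apply hT
  rw [← range_subvarietyι, KPoint.pt_comp]
  exact ⟨_, rfl⟩

/-- A set of `K`-points is closed if each point outside it has a neighbourhood on which
some function vanishes on the set but not at the point. -/
theorem isClosedKPoints_of_local {T : Set (KPoint X)}
    (h : ∀ x : KPoint X, x ∉ T → ∃ (D : SchOver K) (j : D ⟶ X) (_ : IsOpenImmersion j.left)
      (d : KPoint D) (s : Γ(D.left, ⊤)), d ≫ j = x ∧ val d s ≠ 0 ∧
        ∀ d' : KPoint D, (d' ≫ j : KPoint X) ∈ T → val d' s = 0) : IsClosedKPoints T := by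
  intro x hx
  by_contra hxT
  obtain ⟨D, j, hj, d, s, rfl, hs, hT⟩ := h x hxT
  have hopen : IsOpen (j.left '' (D.left.basicOpen s : Set D.left)) :=
    j.left.isOpenEmbedding.isOpenMap _ (D.left.basicOpen s).2
  obtain ⟨_, ⟨p, hp, hpy⟩, y, hyT, rfl⟩ := mem_closure_iff.mp hx _ hopen
    ⟨d.pt, (pt_mem_basicOpen_iff d s).mpr hs, (KPoint.pt_comp d j).symm⟩
  obtain ⟨d', rfl⟩ := exists_kPoint_lift j y ⟨p, hpy⟩
  have : d'.pt = p := j.left.isOpenEmbedding.injective ((KPoint.pt_comp d' j).symm.trans hpy.symm)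
  exact (pt_mem_basicOpen_iff d' s).mp (this ▸ hp) (hT d' hyT)

variable [IsAlgClosed K]

theorem exists_lift_of_kPoint_of_isClosedImmersion [LocallyOfFiniteType Y.hom] [IsReduced Y.left]
    {C : SchOver K} (i : C ⟶ X) [IsClosedImmersion i.left] (f : Y ⟶ X)
    (h : ∀ y : KPoint Y, f.left y.pt ∈ Set.range i.left) : ∃ g : Y ⟶ C, g ≫ i = f := by
  refine exists_lift_of_isClosedImmersion i f ?_
  let U : Y.left.Opens :=
    ⟨(f.left ⁻¹' Set.range i.left)ᶜ,
      (i.left.isClosedEmbedding.isClosed_range.preimage f.left.continuous).isOpen_compl⟩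
  have hU : U ≤ ⊥ := opens_le_of_kPoint fun y hy ↦ absurd (h y) hy
  rintro _ ⟨p, rfl⟩
  by_contra hp
  exact hU (show p ∈ U from hp)

/-- Points of `T` lie in its closure, so `T` need not be closed here; the reducedness of `Y` does
the rest. -/
theorem exists_lift_subvariety [LocallyOfFiniteType Y.hom] [IsReduced Y.left]
    (T : Set (KPoint X)) (f : Y ⟶ X) (h : ∀ y : KPoint Y, (y ≫ f : KPoint X) ∈ T) :
    ∃ g : Y ⟶ subvariety X T, g ≫ subvarietyι X T = f := by
  refine exists_lift_of_kPoint_of_isClosedImmersion _ f fun y ↦ ?_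
  rw [range_subvarietyι, ← KPoint.pt_comp]
  exact subset_closure ⟨_, h y, rfl⟩

instance : LocallyOfFiniteType (Over.mk (𝟙 (Spec (CommRingCat.of K)))).hom :=
  inferInstanceAs (LocallyOfFiniteType (𝟙 (Spec (CommRingCat.of K))))

instance : IsReduced (Over.mk (𝟙 (Spec (CommRingCat.of K)))).left :=
  inferInstanceAs (IsReduced (Spec (CommRingCat.of K)))

theorem exists_kPoint_subvariety {T : Set (KPoint X)} {x : KPoint X} (hx : x ∈ T) :
    ∃ y : KPoint (subvariety X T), y ≫ subvarietyι X T = x := by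
  refine exists_lift_subvariety (Y := Over.mk (𝟙 (Spec (CommRingCat.of K)))) T x fun y ↦ ?_
  have : y = 𝟙 _ := by
    have h := Over.w y
    apply Over.OverMorphism.ext
    simpa using h
  rw [this]
  simpa using hx

/-- A family of open immersions hitting all `K`-points is an open cover. -/
def kPointCover [LocallyOfFiniteType X.hom] {ι : Type u} (D : ι → SchOver K) (j : ∀ i, D i ⟶ X)
    [∀ i, IsOpenImmersion (j i).left] (h : ∀ x : KPoint X, ∃ i, x.pt ∈ Set.range (j i).left) :
    X.left.OpenCover :=
  Scheme.Cover.mkOfCovers ι (fun i ↦ (D i).left) (fun i ↦ (j i).left) (fun p ↦ by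
    have : (⨆ i, (j i).left.opensRange) = ⊤ := opens_eq_top_of_kPoint fun x ↦ by
      obtain ⟨i, hi⟩ := h x
      exact TopologicalSpace.Opens.mem_iSup.mpr ⟨i, hi⟩
    obtain ⟨i, y, hy⟩ := TopologicalSpace.Opens.mem_iSup.mp (this.ge (Set.mem_univ p))
    exact ⟨i, y, hy⟩)

/-- A map on `K`-points which is locally induced by morphisms is induced by a morphism. -/
theorem exists_hom_of_local [LocallyOfFiniteType X.hom] [IsReduced X.left]
    [LocallyOfFiniteType Z.hom] [IsSeparated Z.hom] (F : KPoint X → KPoint Z)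
    (h : ∀ x : KPoint X, ∃ (D : SchOver K) (j : D ⟶ X) (_ : IsOpenImmersion j.left) (f : D ⟶ Z),
      x.pt ∈ Set.range j.left ∧ ∀ d : KPoint D, d ≫ f = F (d ≫ j)) :
    ∃ f : X ⟶ Z, ∀ x, x ≫ f = F x := by
  choose D j hj f hx hf using h
  let 𝒰 := kPointCover D j fun x ↦ ⟨x, hx x⟩
  -- The overlaps are open in the reduced `X`, so the local morphisms agree there as soon as they
  -- agree on `K`-points, where both are given by `F`.
  have hcomp : ∀ x y : KPoint X, pullback.fst (j x).left (j y).left ≫ (f x).left =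
      pullback.snd (j x).left (j y).left ≫ (f y).left := by
    intro x y
    let P : SchOver K := Over.mk (pullback.fst (j x).left (j y).left ≫ (D x).hom)
    let p₁ : P ⟶ D x := Over.homMk (pullback.fst (j x).left (j y).left) rfl
    let p₂ : P ⟶ D y := Over.homMk (pullback.snd (j x).left (j y).left) (by
      change _ = pullback.fst (j x).left (j y).left ≫ (D x).hom
      rw [← Over.w (j x), ← Over.w (j y), pullback.condition_assoc])
    have hp : p₁ ≫ j x = p₂ ≫ j y := Over.OverMorphism.ext pullback.condition
    have : IsOpenImmersion (p₁ ≫ j x).left :=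
      inferInstanceAs (IsOpenImmersion (pullback.fst (j x).left (j y).left ≫ (j x).left))
    have : IsReduced P.left := isReduced_of_isOpenImmersion (p₁ ≫ j x).left
    have : LocallyOfFiniteType P.hom := by
      rw [← Over.w (p₁ ≫ j x)]; infer_instance
    have := hom_ext_of_kPoint (f := p₁ ≫ f x) (g := p₂ ≫ f y) fun z ↦ by
      have h1 := hf x (z ≫ p₁)
      have h2 := hf y (z ≫ p₂)
      simp only [Category.assoc] at h1 h2
      rw [h1, h2, hp]
    exact congr_arg CommaMorphism.left this
  let g := 𝒰.glueMorphisms (fun x ↦ (f x).left) hcomp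
  have hg : ∀ x, (j x).left ≫ g = (f x).left := fun x ↦ 𝒰.ι_glueMorphisms _ hcomp x
  have hgw : g ≫ Z.hom = X.hom := by
    have hx (x : KPoint X) : (j x).left ≫ g ≫ Z.hom = (j x).left ≫ X.hom := by
      rw [reassoc_of% hg, Over.w (f x), Over.w (j x)]
    exact 𝒰.hom_ext _ _ hx
  refine ⟨Over.homMk g hgw, fun x ↦ ?_⟩
  obtain ⟨d, hd⟩ := exists_kPoint_lift (j x) x (hx x)
  have h1 := hf x d
  rw [hd] at h1
  rw [← h1]
  conv_lhs => rw [← hd]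
  rw [Category.assoc]
  congr 1
  exact Over.OverMorphism.ext (hg x)

/-- For affine `X`, composing `f` with `Y.toSpecΓ` gives, up to an isomorphism, the spectrum of a
surjective ring map. The second factor of this closed immersion can be cancelled because it is
separated. -/
theorem isClosedImmersion_of_appTop_surjective {X Y : Scheme.{u}} [IsAffine X] [Y.IsSeparated]
    (f : X ⟶ Y) (hf : Function.Surjective f.appTop) : IsClosedImmersion f := by
  have h : f ≫ Y.toSpecΓ = X.toSpecΓ ≫ Spec.map f.appTop := Scheme.toSpecΓ_naturality f
  have : IsClosedImmersion (Spec.map f.appTop) := IsClosedImmersion.spec_of_surjective _ hf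
  have : IsClosedImmersion (f ≫ Y.toSpecΓ) := by rw [h]; infer_instance
  exact IsClosedImmersion.of_comp f Y.toSpecΓ

theorem surjective_of_kPoint [LocallyOfFiniteType Y.hom] (f : X ⟶ Y) [IsClosedImmersion f.left]
    (h : ∀ y : KPoint Y, ∃ x : KPoint X, x ≫ f = y) : Surjective f.left := by
  constructor
  let U : Y.left.Opens :=
    ⟨(Set.range f.left)ᶜ, f.left.isClosedEmbedding.isClosed_range.isOpen_compl⟩
  have hU : U ≤ ⊥ := opens_le_of_kPoint fun y hy ↦ absurd (by
    obtain ⟨x, rfl⟩ := h y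
    exact ⟨x.pt, (KPoint.pt_comp x f).symm⟩) hy
  intro p
  by_contra hp
  exact hU (show p ∈ U from hp)

/-- A morphism from an affine scheme to a reduced scheme which is surjective on `K`-points
and on global functions is an isomorphism. -/
theorem isIso_of_kPoint_of_appTop [LocallyOfFiniteType Y.hom] [IsSeparated Y.hom]
    [IsReduced Y.left] [IsAffine X.left] (f : X ⟶ Y)
    (h : ∀ y : KPoint Y, ∃ x : KPoint X, x ≫ f = y)
    (hf : Function.Surjective f.left.appTop) : IsIso f.left := by
  have : Y.left.IsSeparated := by
    rw [Scheme.isSeparated_iff, ← terminal.comp_from Y.hom]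
    infer_instance
  have := isClosedImmersion_of_appTop_surjective f.left hf
  have := surjective_of_kPoint f h
  exact isIso_of_isClosedImmersion_of_surjective f.left

end Subvarieties

/-! ### Maps to projective spectra -/

section ProjMaps

variable {σ : Type*} {A : Type u} [CommRing A] [SetLike σ A] [AddSubgroupClass σ A]
  (𝒜 : ℕ → σ) [GradedRing 𝒜]

/-- The map `h / tⁿ ↦ φ(h) / φ(t)ⁿ` on a homogeneous localization. -/
def awayLift {S : Type*} [CommRing S] (φ : A →+* S) (t : A) (ht : IsUnit (φ t)) :
    HomogeneousLocalization.Away 𝒜 t →+* S :=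
  (IsLocalization.Away.lift t ht).comp
    (algebraMap (HomogeneousLocalization.Away 𝒜 t) (Localization.Away t))

theorem awayLift_mk {S : Type*} [CommRing S] (φ : A →+* S) (t : A) (ht : IsUnit (φ t)) {d : ℕ}
    (hd : t ∈ 𝒜 d) (n : ℕ) (h : A) (hh : h ∈ 𝒜 (n • d)) :
    awayLift 𝒜 φ t ht (HomogeneousLocalization.Away.mk 𝒜 hd n h hh) * φ t ^ n = φ h := by
  simp only [awayLift, RingHom.comp_apply, HomogeneousLocalization.algebraMap_apply,
    HomogeneousLocalization.Away.val_mk]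
  have h1 : Localization.mk h (⟨t ^ n, n, rfl⟩ : Submonoid.powers t) *
      algebraMap A (Localization.Away t) (t ^ n) = algebraMap A (Localization.Away t) h := by
    rw [Localization.mk_eq_mk']
    exact IsLocalization.mk'_spec _ _ _
  have h2 := congr_arg (IsLocalization.Away.lift t ht) h1
  rw [map_mul, IsLocalization.Away.lift_eq, IsLocalization.Away.lift_eq, map_pow] at h2
  exact h2

/-- A morphism to `Proj` given by sections is glued from the charts `D₊(t)`. If `t` becomes a unit
after pullback, the image lies in one chart and the morphism is a single ring map; this turns
computations with points into computations with `awayLift`. -/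
theorem comp_fromOfGlobalSections {X X' : Scheme.{u}} (g : X' ⟶ X) (f : A →+* Γ(X, ⊤))
    (hf : (HomogeneousIdeal.irrelevant 𝒜).toIdeal.map f = ⊤) {t : A} {d : ℕ} (hd : t ∈ 𝒜 d)
    (h0 : 0 < d) (ht : IsUnit ((g.appTop.hom.comp f) t)) :
    g ≫ Proj.fromOfGlobalSections 𝒜 f hf =
      X'.toSpecΓ ≫ Spec.map (CommRingCat.ofHom (awayLift 𝒜 (g.appTop.hom.comp f) t ht)) ≫
        Proj.awayι 𝒜 t hd h0 := by
  have hg : Set.range g ⊆ Set.range (X.basicOpen (f t)).ι := by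
    rw [Scheme.Opens.range_ι]
    rintro _ ⟨p, rfl⟩
    have h1 : p ∈ g ⁻¹ᵁ X.basicOpen (f t) := by
      rw [Scheme.preimage_basicOpen_top]
      have : X'.basicOpen (g.appTop (f t)) = ⊤ := Scheme.basicOpen_of_isUnit _ ht
      rw [this]
      trivial
    exact h1
  let g' := IsOpenImmersion.lift (X.basicOpen (f t)).ι g hg
  have hg' : g' ≫ (X.basicOpen (f t)).ι = g := IsOpenImmersion.lift_fac _ _ _
  have h1 : (X.basicOpen (f t)).ι ≫ Proj.fromOfGlobalSections 𝒜 f hf =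
      Proj.toBasicOpenOfGlobalSections 𝒜 f rfl h0 hd ≫ (Proj.basicOpen 𝒜 t).ι := by
    rw [← Proj.fromOfGlobalSections_resLE 𝒜 f hf h0 hd, Scheme.Hom.resLE_comp_ι]
  conv_lhs => rw [← hg', Category.assoc, h1]
  -- Both sides are compared after the monomorphism `Spec A_{f t} ⟶ Spec A` with `A = Γ(X, ⊤)`,
  -- where each becomes the canonical map induced by `g`.
  have key : g' ≫ (X.isoOfEq (X.toSpecΓ_preimage_basicOpen (f t))).inv ≫
      X.toSpecΓ ∣_ PrimeSpectrum.basicOpen (f t) ≫ (basicOpenIsoSpecAway (f t)).hom =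
      X'.toSpecΓ ≫ Spec.map (CommRingCat.ofHom
        (IsLocalization.Away.lift (S := Localization.Away (f t)) (g := g.appTop.hom) (f t) ht)) := by
    rw [← cancel_mono (Spec.map (CommRingCat.ofHom
      (algebraMap Γ(X, ⊤) (Localization.Away (f t)))))]
    simp only [Category.assoc]
    rw [← Spec.map_comp, ← CommRingCat.ofHom_comp]
    have h2 : (IsLocalization.Away.lift (S := Localization.Away (f t)) (g := g.appTop.hom) (f t) ht).comp
        (algebraMap Γ(X, ⊤) (Localization.Away (f t))) = g.appTop.hom :=
      RingHom.ext fun a ↦ IsLocalization.Away.lift_eq (g := g.appTop.hom) (f t) ht a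
    rw [h2, basicOpenIsoSpecAway, IsOpenImmersion.isoOfRangeEq_hom_fac]
    refine (congr_arg (fun z ↦ g' ≫ (X.isoOfEq (X.toSpecΓ_preimage_basicOpen (f t))).inv ≫ z)
      (morphismRestrict_ι X.toSpecΓ (PrimeSpectrum.basicOpen (f t)))).trans ?_
    refine (congr_arg (g' ≫ ·) (Scheme.isoOfEq_inv_ι_assoc _
      (X.toSpecΓ_preimage_basicOpen (f t)) X.toSpecΓ)).trans ?_
    rw [reassoc_of% hg', Scheme.toSpecΓ_naturality]
    rfl
  have h3 : (IsLocalization.Away.lift (S := Localization.Away (f t)) (g := g.appTop.hom) (f t) ht).comp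
      ((IsLocalization.map (M := .powers t) (T := .powers (f t)) (Localization.Away (f t)) f (by
        rw [← Submonoid.map_le_iff_le_comap, Submonoid.map_powers])).comp
        (algebraMap (HomogeneousLocalization.Away 𝒜 t) (Localization.Away t))) =
      awayLift 𝒜 (g.appTop.hom.comp f) t ht := by
    rw [awayLift, ← RingHom.comp_assoc]
    congr 1
    apply IsLocalization.ringHom_ext (M := .powers t)
    ext a
    simp [IsLocalization.map_eq, IsLocalization.Away.lift_eq]
  rw [← h3, CommRingCat.ofHom_comp, Spec.map_comp]
  simp only [← Category.assoc] at key ⊢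
  rw [← key]
  simp only [Proj.toBasicOpenOfGlobalSections, Category.assoc, Proj.basicOpenIsoSpec_inv_ι]

end ProjMaps

/-! ### Projective space -/

section ProjSpace

variable {K : Type u} [Field K] {σ : Type}

theorem X_mem (j : σ) :
    (MvPolynomial.X j : MvPolynomial σ K) ∈ MvPolynomial.homogeneousSubmodule σ K 1 :=
  MvPolynomial.isHomogeneous_X K j

theorem X_mem' (j : σ) :
    (MvPolynomial.X j : MvPolynomial σ K) ∈ MvPolynomial.homogeneousSubmodule σ K (1 • 1) :=
  MvPolynomial.isHomogeneous_X K j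

theorem awayLift_comp {A : Type u} [CommRing A] {τ : Type*} [SetLike τ A] [AddSubgroupClass τ A]
    (𝒜 : ℕ → τ) [GradedRing 𝒜] {S S' : Type*} [CommRing S] [CommRing S'] (φ : A →+* S) (t : A)
    (ht : IsUnit (φ t)) (θ : S →+* S') :
    θ.comp (awayLift 𝒜 φ t ht) = awayLift 𝒜 (θ.comp φ) t (ht.map θ) := by
  rw [awayLift, awayLift, ← RingHom.comp_assoc]
  congr 1
  apply IsLocalization.ringHom_ext (M := .powers t)
  ext a
  simp [IsLocalization.Away.lift_eq]

theorem kPoint_comp_fromOfGlobalSections {A : Type u} [CommRing A] {τ : Type*} [SetLike τ A]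
    [AddSubgroupClass τ A] (𝒜 : ℕ → τ) [GradedRing 𝒜] {X : SchOver K} (x : KPoint X)
    (f : A →+* Γ(X.left, ⊤)) (hf : (HomogeneousIdeal.irrelevant 𝒜).toIdeal.map f = ⊤) {t : A}
    {d : ℕ} (hd : t ∈ 𝒜 d) (h0 : 0 < d) {φ : A →+* K} (hφ : (val x).comp f = φ)
    (ht : IsUnit (φ t)) :
    x.left ≫ Proj.fromOfGlobalSections 𝒜 f hf =
      Spec.map (CommRingCat.ofHom (awayLift 𝒜 φ t ht)) ≫ Proj.awayι 𝒜 t hd h0 := by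
  subst hφ
  have h1 : ((Scheme.ΓSpecIso (CommRingCat.of K)).inv.hom.comp ((val x).comp f)) =
      x.left.appTop.hom.comp f := by
    ext a
    simp only [val, RingHom.comp_apply]
    change ((Scheme.ΓSpecIso (CommRingCat.of K)).hom ≫ (Scheme.ΓSpecIso (CommRingCat.of K)).inv) _
      = _
    rw [Iso.hom_inv_id]
    rfl
  have ht' : IsUnit ((x.left.appTop.hom.comp f) t) := by
    rw [← h1]; exact ht.map (Scheme.ΓSpecIso (CommRingCat.of K)).inv.hom
  rw [comp_fromOfGlobalSections 𝒜 x.left f hf hd h0 ht']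
  change (Spec (CommRingCat.of K)).toSpecΓ ≫ _ = _
  rw [← Category.assoc]
  congr 1
  rw [← SpecMap_ΓSpecIso_hom, ← Spec.map_comp]
  congr 1
  have h2 : (Scheme.ΓSpecIso (CommRingCat.of K)).hom.hom.comp (x.left.appTop.hom.comp f) =
    (val x).comp f := rfl
  ext a
  have h3 := awayLift_comp 𝒜 (x.left.appTop.hom.comp f) t ht'
    (Scheme.ΓSpecIso (CommRingCat.of K)).hom.hom
  exact congr($h3 a)

theorem val_id_comp_evalHom (v : σ → K) :
    (val (X := Over.mk (𝟙 (Spec (CommRingCat.of K)))) (𝟙 _)).comp (evalHom v) =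
      MvPolynomial.eval v := by
  refine RingHom.ext fun a ↦ ?_
  simp [val, evalHom, MvPolynomial.coe_aeval_eq_eval]

/-- Reduces equality of points of projective space to equality of ring homomorphisms out of one
homogeneous localization. -/
theorem projPoint_left (v : σ → K) (hv : v ≠ 0) {t : MvPolynomial σ K} {d : ℕ}
    (hd : t ∈ MvPolynomial.homogeneousSubmodule σ K d) (h0 : 0 < d)
    (ht : IsUnit (MvPolynomial.eval v t)) :
    (projPoint v hv).left =
      Spec.map (CommRingCat.ofHom (awayLift (MvPolynomial.homogeneousSubmodule σ K)
        (MvPolynomial.eval v) t ht)) ≫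
        Proj.awayι (MvPolynomial.homogeneousSubmodule σ K) t hd h0 := by
  have h := kPoint_comp_fromOfGlobalSections (MvPolynomial.homogeneousSubmodule σ K)
    (X := Over.mk (𝟙 (Spec (CommRingCat.of K)))) (𝟙 _) (evalHom v) (evalHom_irrelevant v hv) hd h0
    (val_id_comp_evalHom v) ht
  rw [← h]
  exact (Category.id_comp _).symm

theorem projPoint_mem_basicOpen_iff (v : σ → K) (hv : v ≠ 0) {t : MvPolynomial σ K} {d : ℕ}
    (hd : t ∈ MvPolynomial.homogeneousSubmodule σ K d) (h0 : 0 < d) :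
    (projPoint v hv).pt ∈ Proj.basicOpen (MvPolynomial.homogeneousSubmodule σ K) t ↔
      MvPolynomial.eval v t ≠ 0 := by
  have h1 : (projPoint v hv).pt ∈ Proj.basicOpen (MvPolynomial.homogeneousSubmodule σ K) t ↔
      KPoint.pt (X := Over.mk (𝟙 (Spec (CommRingCat.of K)))) (𝟙 _) ∈
      Proj.fromOfGlobalSections (MvPolynomial.homogeneousSubmodule σ K)
        (evalHom v) (evalHom_irrelevant v hv) ⁻¹ᵁ
        Proj.basicOpen (MvPolynomial.homogeneousSubmodule σ K) t := Iff.rfl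
  rw [h1, Proj.fromOfGlobalSections_preimage_basicOpen _ _ _ h0 hd]
  refine (pt_mem_basicOpen_iff (X := Over.mk (𝟙 (Spec (CommRingCat.of K)))) (𝟙 _)
    (evalHom v t)).trans ?_
  rw [← val_id_comp_evalHom]
  rfl

variable (K) in
/-- The coordinate `X_i / X_j` on the `j`-th affine chart of projective space. -/
def awayCoord (j i : σ) :
    HomogeneousLocalization.Away (MvPolynomial.homogeneousSubmodule σ K) (MvPolynomial.X j) :=
  HomogeneousLocalization.Away.mk (MvPolynomial.homogeneousSubmodule σ K)
    (X_mem j) 1 (MvPolynomial.X i) (X_mem' i)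

variable (K) in
/-- The scalars in a homogeneous localization of the polynomial ring. -/
def awayC (t : MvPolynomial σ K) :
    K →+* HomogeneousLocalization.Away (MvPolynomial.homogeneousSubmodule σ K) t :=
  (HomogeneousLocalization.fromZeroRingHom (MvPolynomial.homogeneousSubmodule σ K) _).comp
    (algebraMap K (MvPolynomial.homogeneousSubmodule σ K 0))

theorem eval₂_mul_of_isHomogeneous {R S : Type*} [CommRing R] [CommRing S]
    (f : R →+* S) (a : S) (y : σ → S) {n : ℕ} {h : MvPolynomial σ R} (hh : h.IsHomogeneous n) :
    MvPolynomial.eval₂ f (fun i ↦ a * y i) h = a ^ n * MvPolynomial.eval₂ f y h := by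
  rw [MvPolynomial.eval₂_eq, MvPolynomial.eval₂_eq, Finset.mul_sum]
  refine Finset.sum_congr rfl fun d hd ↦ ?_
  have hdeg : ∑ i ∈ d.support, d i = n := by
    have := hh (MvPolynomial.mem_support_iff.mp hd)
    rw [← this, Finsupp.weight_apply, Finsupp.sum]
    simp
  rw [← hdeg, ← Finset.prod_pow_eq_pow_sum]
  simp only [mul_pow, Finset.prod_mul_distrib]
  ring

/-- Dehomogenization: `h / X_j ^ n = h(X_i / X_j)`. It is checked in the full localization after
multiplying by `X_j ^ n`. Hence a map out of the chart is determined on scalars and on the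
coordinates `X_i / X_j`. -/
theorem away_mk_eq_eval₂ (j : σ) (n : ℕ) (h : MvPolynomial σ K)
    (hh : h ∈ MvPolynomial.homogeneousSubmodule σ K (n • 1)) :
    HomogeneousLocalization.Away.mk (MvPolynomial.homogeneousSubmodule σ K)
      (X_mem j) n h hh =
      MvPolynomial.eval₂ (awayC K (MvPolynomial.X j)) (awayCoord K j) h := by
  apply HomogeneousLocalization.val_injective
  rw [← HomogeneousLocalization.algebraMap_apply, ← HomogeneousLocalization.algebraMap_apply,
    MvPolynomial.eval₂_comp_left]
  have hu : IsUnit (algebraMap (MvPolynomial σ K)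
      (Localization.Away (MvPolynomial.X j : MvPolynomial σ K)) (MvPolynomial.X j) ^ n) :=
    (IsLocalization.Away.algebraMap_isUnit _).pow n
  rw [← hu.mul_right_inj, ← eval₂_mul_of_isHomogeneous _ _ _ (n := n) (by simpa using hh)]
  have h1 : ∀ (k : ℕ) (g : MvPolynomial σ K)
      (hg : g ∈ MvPolynomial.homogeneousSubmodule σ K (k • 1)),
      algebraMap (MvPolynomial σ K) (Localization.Away (MvPolynomial.X j : MvPolynomial σ K))
        (MvPolynomial.X j) ^ k * algebraMap _ (Localization.Away (MvPolynomial.X j))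
        (HomogeneousLocalization.Away.mk (MvPolynomial.homogeneousSubmodule σ K)
      (X_mem j) k g hg) = algebraMap _ _ g := by
    intro k g hg
    rw [HomogeneousLocalization.algebraMap_apply, HomogeneousLocalization.Away.val_mk, mul_comm,
      ← map_pow, Localization.mk_eq_mk']
    exact IsLocalization.mk'_spec _ _ _
  rw [h1 n h hh]
  have h2 : (fun i ↦ algebraMap (MvPolynomial σ K) (Localization.Away
      (MvPolynomial.X j : MvPolynomial σ K)) (MvPolynomial.X j) *
      (algebraMap _ (Localization.Away (MvPolynomial.X j)) ∘ awayCoord K j) i) =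
      fun i ↦ algebraMap (MvPolynomial σ K) _ (MvPolynomial.X i) := by
    funext i
    have := h1 1 (MvPolynomial.X i) (X_mem' i)
    rwa [pow_one] at this
  rw [h2]
  have h3 : (algebraMap (HomogeneousLocalization.Away (MvPolynomial.homogeneousSubmodule σ K)
      (MvPolynomial.X j)) (Localization.Away (MvPolynomial.X j : MvPolynomial σ K))).comp
      (awayC K (MvPolynomial.X j)) = (algebraMap (MvPolynomial σ K) _).comp MvPolynomial.C := by
    ext a
    simp only [awayC, RingHom.comp_apply, HomogeneousLocalization.algebraMap_apply]
    rfl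
  rw [h3]
  have h4 := MvPolynomial.eval₂_comp_left (algebraMap (MvPolynomial σ K) (Localization.Away
      (MvPolynomial.X j : MvPolynomial σ K))) MvPolynomial.C MvPolynomial.X h
  rw [MvPolynomial.eval₂_eta] at h4
  exact h4

theorem awayι_comp_hom (t : MvPolynomial σ K) {d : ℕ}
    (hd : t ∈ MvPolynomial.homogeneousSubmodule σ K d) (h0 : 0 < d) :
    Proj.awayι (MvPolynomial.homogeneousSubmodule σ K) t hd h0 ≫ (projSpace K σ).hom =
      Spec.map (CommRingCat.ofHom (awayC K t)) := by
  change _ ≫ Proj.toSpecZero _ ≫ _ = _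
  rw [← Category.assoc, Proj.awayι_toSpecZero, ← Spec.map_comp]
  rfl

theorem iSup_basicOpen_X :
    ⨆ j : σ, Proj.basicOpen (MvPolynomial.homogeneousSubmodule σ K) (MvPolynomial.X j) = ⊤ := by
  refine Proj.iSup_basicOpen_eq_top' _ _ (fun i ↦ ⟨1, X_mem i⟩) ?_
  rw [eq_top_iff]
  intro p _
  induction p using MvPolynomial.induction_on with
  | C a =>
    exact Subalgebra.algebraMap_mem
      (Algebra.adjoin (MvPolynomial.homogeneousSubmodule σ K 0)
        (Set.range (MvPolynomial.X : σ → MvPolynomial σ K)))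
      (algebraMap K (MvPolynomial.homogeneousSubmodule σ K 0) a)
  | add p q hp hq => exact add_mem (hp trivial) (hq trivial)
  | mul_X p i hp => exact mul_mem (hp trivial) (Algebra.subset_adjoin ⟨i, rfl⟩)

/-- The open subset `D₊(t)` of projective space, as a scheme over `K`. -/
def projChart (t : MvPolynomial σ K) : SchOver K :=
  Over.mk (Spec.map (CommRingCat.ofHom (awayC K t)))

/-- The inclusion of `D₊(t)`. -/
def projChartι {t : MvPolynomial σ K} {d : ℕ}
    (hd : t ∈ MvPolynomial.homogeneousSubmodule σ K d) (h0 : 0 < d) :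
    projChart t ⟶ projSpace K σ :=
  Over.homMk (Proj.awayι (MvPolynomial.homogeneousSubmodule σ K) t hd h0) (awayι_comp_hom t hd h0)

instance (t : MvPolynomial σ K) {d : ℕ} (hd : t ∈ MvPolynomial.homogeneousSubmodule σ K d)
    (h0 : 0 < d) : IsOpenImmersion (projChartι hd h0).left :=
  inferInstanceAs (IsOpenImmersion (Proj.awayι _ t hd h0))

theorem range_projChartι {t : MvPolynomial σ K} {d : ℕ}
    (hd : t ∈ MvPolynomial.homogeneousSubmodule σ K d) (h0 : 0 < d) :
    Set.range (projChartι hd h0).left =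
      (Proj.basicOpen (MvPolynomial.homogeneousSubmodule σ K) t :
        Set (Proj (MvPolynomial.homogeneousSubmodule σ K))) := by
  rw [← Proj.opensRange_awayι _ t hd h0]
  rfl

/-- The point lies in a chart `X_j ≠ 0`, where it is a `K`-algebra map to `K`; the images of the
functions `X_i / X_j` serve as homogeneous coordinates, with `v j = 1`. -/
theorem exists_eq_projPoint (x : KPoint (projSpace K σ)) : ∃ v hv, x = projPoint v hv := by
  obtain ⟨j, hj⟩ := TopologicalSpace.Opens.mem_iSup.mp
    ((iSup_basicOpen_X (K := K) (σ := σ)).ge (Set.mem_univ x.pt))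
  have hX := X_mem (K := K) j
  obtain ⟨y, hy⟩ := exists_kPoint_lift (projChartι hX one_pos) x
    ((range_projChartι hX one_pos).ge hj)
  obtain ⟨ψ, hψ⟩ := Spec.map_surjective y.left
  have hψC : ψ.hom.comp (awayC K (MvPolynomial.X j)) = RingHom.id K := by
    have h := Over.w y
    rw [← hψ] at h
    change Spec.map ψ ≫ Spec.map (CommRingCat.ofHom (awayC K (MvPolynomial.X j))) = 𝟙 _ at h
    rw [← Spec.map_comp, ← Spec.map_id, Spec.map_injective.eq_iff] at h
    exact congr_arg CommRingCat.Hom.hom h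
  let v : σ → K := fun i ↦ ψ.hom (awayCoord K j i)
  have hvj : v j = 1 := by
    have : awayCoord K j j = 1 := by
      apply HomogeneousLocalization.val_injective
      rw [awayCoord, HomogeneousLocalization.Away.val_mk, HomogeneousLocalization.val_one]
      simp
    simp only [v, this, map_one]
  have hv : v ≠ 0 := fun h ↦ by simp [h] at hvj
  have ht : IsUnit (MvPolynomial.eval v (MvPolynomial.X j)) := by simp [hvj]
  refine ⟨v, hv, ?_⟩
  rw [← hy]
  apply Over.OverMorphism.ext
  rw [projPoint_left v hv hX one_pos ht]
  change y.left ≫ Proj.awayι _ _ hX one_pos = _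
  rw [← hψ]
  congr 2
  ext e
  obtain ⟨n, h, hh, rfl⟩ := HomogeneousLocalization.Away.mk_surjective
    (MvPolynomial.homogeneousSubmodule σ K) (X_mem j) e
  have h1 := awayLift_mk (MvPolynomial.homogeneousSubmodule σ K) (MvPolynomial.eval v)
    (MvPolynomial.X j) ht hX n h hh
  rw [MvPolynomial.eval_X, hvj, one_pow, mul_one] at h1
  refine Eq.trans ?_ h1.symm
  rw [away_mk_eq_eval₂]
  refine (MvPolynomial.eval₂_comp_left ψ.hom _ _ h).trans ?_
  rw [hψC]
  rfl

theorem projPoint_eq_iff {v w : σ → K} (hv : v ≠ 0) (hw : w ≠ 0) :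
    projPoint v hv = projPoint w hw ↔ ∃ c : K, c ≠ 0 ∧ w = c • v := by
  constructor
  · intro h
    obtain ⟨j, hj⟩ := Function.ne_iff.mp hv
    have hX := X_mem (K := K) j
    have hj' : w j ≠ 0 := by
      have h1 := (projPoint_mem_basicOpen_iff v hv hX one_pos).mpr (by simpa using hj)
      rw [h, projPoint_mem_basicOpen_iff w hw hX one_pos] at h1
      simpa using h1
    -- Equality on the `j`-th chart says `v i / v j = w i / w j` for all `i`, which dictates the
    -- scalar.
    refine ⟨w j / v j, div_ne_zero hj' hj, ?_⟩
    have h1 : IsUnit (MvPolynomial.eval v (MvPolynomial.X j)) := by simpa using hj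
    have h2 : IsUnit (MvPolynomial.eval w (MvPolynomial.X j)) := by simpa using hj'
    have h3 := congr_arg Over.Hom.left h
    rw [projPoint_left v hv hX one_pos h1, projPoint_left w hw hX one_pos h2] at h3
    replace h3 := Spec.map_injective
      ((cancel_mono (Proj.awayι (MvPolynomial.homogeneousSubmodule σ K) _ hX one_pos)).mp h3)
    funext i
    have h4 := congr($h3 (awayCoord K j i))
    have h5 := awayLift_mk (MvPolynomial.homogeneousSubmodule σ K) (MvPolynomial.eval v)
      (MvPolynomial.X j) h1 hX 1 (MvPolynomial.X i) (X_mem' i)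
    have h6 := awayLift_mk (MvPolynomial.homogeneousSubmodule σ K) (MvPolynomial.eval w)
      (MvPolynomial.X j) h2 hX 1 (MvPolynomial.X i) (X_mem' i)
    simp only [MvPolynomial.eval_X, pow_one] at h5 h6
    change awayLift _ _ _ _ (awayCoord K j i) * _ = _ at h5
    change awayLift _ _ _ _ (awayCoord K j i) * _ = _ at h6
    change awayLift _ _ _ h1 (awayCoord K j i) = awayLift _ _ _ h2 (awayCoord K j i) at h4
    rw [← h4] at h6
    rw [Pi.smul_apply, smul_eq_mul, ← h6, ← h5]
    exact (mul_div_cancel_right₀ _ hj).symm.trans (by ring)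
  · rintro ⟨c, hc, rfl⟩
    obtain ⟨j, hj⟩ := Function.ne_iff.mp hv
    have hX := X_mem (K := K) j
    have h1 : IsUnit (MvPolynomial.eval v (MvPolynomial.X j)) := by simpa using hj
    have h2 : IsUnit (MvPolynomial.eval (c • v) (MvPolynomial.X j)) := by
      simpa using ⟨hc, hj⟩
    apply Over.OverMorphism.ext
    rw [projPoint_left v hv hX one_pos h1, projPoint_left _ hw hX one_pos h2]
    congr 2
    ext e
    obtain ⟨n, h, hh, rfl⟩ := HomogeneousLocalization.Away.mk_surjective
      (MvPolynomial.homogeneousSubmodule σ K) (X_mem j) e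
    have h5 := awayLift_mk (MvPolynomial.homogeneousSubmodule σ K) (MvPolynomial.eval v)
      (MvPolynomial.X j) h1 hX n h hh
    have h6 := awayLift_mk (MvPolynomial.homogeneousSubmodule σ K) (MvPolynomial.eval (c • v))
      (MvPolynomial.X j) h2 hX n h hh
    have h7 : MvPolynomial.eval (c • v) h = c ^ n * MvPolynomial.eval v h :=
      eval₂_mul_of_isHomogeneous (RingHom.id K) c v (by simpa using hh)
    rw [h7, ← h5] at h6
    simp only [MvPolynomial.eval_X, Pi.smul_apply, smul_eq_mul, mul_pow] at h6
    have h8 : c ^ n * v j ^ n ≠ 0 := mul_ne_zero (pow_ne_zero _ hc) (pow_ne_zero _ hj)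
    refine (mul_right_cancel₀ h8 (h6.trans ?_)).symm
    change _ = awayLift _ _ _ h1 _ * _
    ring

theorem val_left_spec {R : CommRingCat.{u}} (f : Spec R ⟶ Spec (CommRingCat.of K))
    (x : KPoint (Over.mk f)) (ψ : R ⟶ CommRingCat.of K) (hx : x.left = Spec.map ψ) (a : R) :
    val x ((Scheme.ΓSpecIso R).inv a) = ψ a := by
  simp only [val, RingHom.comp_apply, hx]
  have h := Scheme.ΓSpecIso_naturality ψ
  have h1 := congr($h ((Scheme.ΓSpecIso R).inv a))
  refine h1.trans ?_
  exact congr_arg ψ congr($((Scheme.ΓSpecIso R).inv_hom_id) a)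

instance [Finite σ] : LocallyOfFiniteType (projSpace K σ).hom := by
  have : IsScalarTower K (MvPolynomial.homogeneousSubmodule σ K 0) (MvPolynomial σ K) :=
    ⟨fun a b c ↦ smul_mul_assoc a (b : MvPolynomial σ K) c⟩
  have : Algebra.FiniteType (MvPolynomial.homogeneousSubmodule σ K 0) (MvPolynomial σ K) :=
    Algebra.FiniteType.of_restrictScalars_finiteType K _ _
  have : LocallyOfFiniteType (Spec.map (CommRingCat.ofHom
      (algebraMap K (MvPolynomial.homogeneousSubmodule σ K 0)))) := by
    rw [HasRingHomProperty.Spec_iff (P := @LocallyOfFiniteType)]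
    apply RingHom.FiniteType.of_surjective
    rintro ⟨p, hp⟩
    refine ⟨MvPolynomial.coeff 0 p, Subtype.ext ?_⟩
    exact ((MvPolynomial.totalDegree_eq_zero_iff_eq_C).mp
      (Nat.le_zero.mp (MvPolynomial.IsHomogeneous.totalDegree_le hp))).symm
  exact inferInstanceAs (LocallyOfFiniteType (Proj.toSpecZero _ ≫ Spec.map _))

instance : IsSeparated (projSpace K σ).hom :=
  inferInstanceAs (IsSeparated (Proj.toSpecZero _ ≫ Spec.map _))

instance (t : MvPolynomial σ K) : IsReduced (projChart t).left := by
  have : _root_.IsReduced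
      (HomogeneousLocalization.Away (MvPolynomial.homogeneousSubmodule σ K) t) :=
    isReduced_of_injective (algebraMap _ (Localization.Away t))
      (HomogeneousLocalization.val_injective _)
  exact inferInstanceAs (IsReduced (Spec (.of _)))

theorem locallyOfFiniteType_projChart [Finite σ] {t : MvPolynomial σ K} {d : ℕ}
    (hd : t ∈ MvPolynomial.homogeneousSubmodule σ K d) (h0 : 0 < d) :
    LocallyOfFiniteType (projChart t).hom := by
  rw [← Over.w (projChartι hd h0)]
  infer_instance

instance : IsReduced (projSpace K σ).left := by
  have : ∀ i, IsReduced ((Proj.affineOpenCover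
      (MvPolynomial.homogeneousSubmodule σ K)).openCover.X i) := fun i ↦
    inferInstanceAs (IsReduced (projChart _).left)
  exact @IsReduced.of_openCover _ (Proj.affineOpenCover
    (MvPolynomial.homogeneousSubmodule σ K)).openCover this

variable {X : SchOver K}

/-- The scalars among the functions on a scheme over `K`. -/
def scalarHom (X : SchOver K) : K →+* Γ(X.left, ⊤) :=
  X.hom.appTop.hom.comp (Scheme.ΓSpecIso (CommRingCat.of K)).inv.hom

theorem val_scalarHom (x : KPoint X) (a : K) : val x (scalarHom X a) = a := val_base x a

theorem appTop_scalarHom {Y : SchOver K} (f : X ⟶ Y) (a : K) :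
    f.left.appTop (scalarHom Y a) = scalarHom X a := by
  have h : X.hom.appTop = Y.hom.appTop ≫ f.left.appTop := by
    rw [← Scheme.Hom.comp_appTop, Over.w f]
  simp only [scalarHom, RingHom.comp_apply]
  exact congr($h.symm _)

theorem val_eval₂ (x : KPoint X) (s : σ → Γ(X.left, ⊤)) (p : MvPolynomial σ K) :
    val x (MvPolynomial.eval₂ (scalarHom X) s p) = MvPolynomial.eval (fun j ↦ val x (s j)) p := by
  refine (MvPolynomial.eval₂_comp_left (val x) _ _ p).trans ?_
  have : (val x).comp (scalarHom X) = RingHom.id K := RingHom.ext fun a ↦ val_scalarHom x a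
  rw [this]
  rfl

variable [IsAlgClosed K]

/-- Quotients of homogeneous forms of the same degree are functions where the denominator does
not vanish. -/
theorem exists_section_div [LocallyOfFiniteType X.hom] (f : X ⟶ projSpace K σ) {d : ℕ}
    (h0 : 0 < d) {g h : MvPolynomial σ K} (hg : g ∈ MvPolynomial.homogeneousSubmodule σ K d)
    (hh : h ∈ MvPolynomial.homogeneousSubmodule σ K d)
    (hne : ∀ (x : KPoint X) v hv, x ≫ f = projPoint v hv → MvPolynomial.eval v g ≠ 0) :
    ∃ s : Γ(X.left, ⊤), ∀ (x : KPoint X) v hv, x ≫ f = projPoint v hv →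
      val x s * MvPolynomial.eval v g = MvPolynomial.eval v h := by
  -- Nonvanishing of `g` on points means that `f` factors through the chart `D₊(g)`, on which `h /
  -- g` is a function.
  obtain ⟨f', rfl⟩ := exists_lift_of_kPoint (projChartι hg h0) f (fun y ↦ by
    rw [range_projChartι, ← KPoint.pt_comp]
    obtain ⟨v, hv, hy⟩ := exists_eq_projPoint (y ≫ f)
    rw [hy]
    exact (projPoint_mem_basicOpen_iff v hv hg h0).mpr (hne y v hv hy))
  refine ⟨f'.left.appTop ((Scheme.ΓSpecIso _).inv
    (HomogeneousLocalization.Away.mk (MvPolynomial.homogeneousSubmodule σ K) hg 1 h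
      (by simpa using hh))), fun x v hv hx ↦ ?_⟩
  have hu := IsUnit.mk0 _ (hne x v hv hx)
  have h1 := congr_arg Over.Hom.left hx
  rw [projPoint_left v hv hg h0 hu, ← Category.assoc] at h1
  change (x ≫ f').left ≫ Proj.awayι _ _ hg h0 = _ at h1
  replace h1 := (cancel_mono (Proj.awayι (MvPolynomial.homogeneousSubmodule σ K) g hg h0)).mp h1
  refine (congr_arg (· * _) ((val_comp x f' _).symm.trans (val_left_spec _ _ _ h1 _))).trans ?_
  have := awayLift_mk (MvPolynomial.homogeneousSubmodule σ K) (MvPolynomial.eval v) g hu hg 1 h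
    (by simpa using hh)
  rwa [pow_one] at this

/-- Functions on an affine scheme without common zeros define a morphism to projective space. -/
theorem exists_hom_projSpace [LocallyOfFiniteType X.hom] [IsAffine X.left]
    (s : σ → Γ(X.left, ⊤)) (hs : ∀ x : KPoint X, ∃ j, val x (s j) ≠ 0) :
    ∃ f : X ⟶ projSpace K σ, ∀ (x : KPoint X) hv, x ≫ f = projPoint (fun j ↦ val x (s j)) hv := by
  let φ : MvPolynomial σ K →+* Γ(X.left, ⊤) := MvPolynomial.eval₂Hom (scalarHom X) s
  have hφ : (HomogeneousIdeal.irrelevant (MvPolynomial.homogeneousSubmodule σ K)).toIdeal.map φ =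
      ⊤ := by
    -- On an affine scheme, functions without a common zero on `K`-points generate the unit ideal.
    have h1 : Ideal.span (Set.range s) = ⊤ := by
      rw [← (isAffineOpen_top X.left).iSup_basicOpen_eq_self_iff]
      refine opens_eq_top_of_kPoint fun x ↦ ?_
      obtain ⟨j, hj⟩ := hs x
      exact TopologicalSpace.Opens.mem_iSup.mpr ⟨⟨s j, j, rfl⟩, (pt_mem_basicOpen_iff x _).mpr hj⟩
    rw [eq_top_iff, ← h1, Ideal.span_le]
    rintro _ ⟨j, rfl⟩
    have : s j = φ (MvPolynomial.X j) := by simp [φ]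
    rw [this]
    refine Ideal.mem_map_of_mem φ ?_
    change _ ∈ HomogeneousIdeal.irrelevant _
    rw [HomogeneousIdeal.mem_irrelevant_iff]
    exact DirectSum.decompose_of_mem_ne (MvPolynomial.homogeneousSubmodule σ K) (X_mem j) one_ne_zero
  have hw : Proj.fromOfGlobalSections (MvPolynomial.homogeneousSubmodule σ K) φ hφ ≫
      (projSpace K σ).hom = X.hom := by
    change _ ≫ Proj.toSpecZero _ ≫ _ = _
    rw [Proj.fromOfGlobalSections_toSpecZero_assoc, ← Spec.map_comp, ← CommRingCat.ofHom_comp]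
    have : (φ.comp (algebraMap (MvPolynomial.homogeneousSubmodule σ K 0)
        (MvPolynomial σ K))).comp (algebraMap K (MvPolynomial.homogeneousSubmodule σ K 0)) =
        ((Scheme.ΓSpecIso (CommRingCat.of K)).inv ≫ X.hom.appTop).hom := by
      ext a
      have h : ((algebraMap K (MvPolynomial.homogeneousSubmodule σ K 0) a :
          MvPolynomial.homogeneousSubmodule σ K 0) : MvPolynomial σ K) = MvPolynomial.C a := rfl
      simp [φ, h, scalarHom]
    rw [this, CommRingCat.ofHom_hom, Spec.map_comp, ← Scheme.toSpecΓ_naturality_assoc]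
    change X.hom ≫ (Spec (CommRingCat.of K)).toSpecΓ ≫ _ = X.hom
    rw [← SpecMap_ΓSpecIso_hom, ← Spec.map_comp, Iso.inv_hom_id, Spec.map_id]
    exact Category.comp_id _
  refine ⟨Over.homMk _ hw, fun x hv ↦ ?_⟩
  obtain ⟨j, hj⟩ := hs x
  have hX := X_mem (K := K) j
  have hu : IsUnit (MvPolynomial.eval (fun j ↦ val x (s j)) (MvPolynomial.X j)) := by
    simpa using hj
  apply Over.OverMorphism.ext
  rw [projPoint_left _ hv hX one_pos hu]
  exact kPoint_comp_fromOfGlobalSections _ x φ hφ hX one_pos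
    (RingHom.ext fun p ↦ val_eval₂ x s p) hu

end ProjSpace

/-! ### Plücker coordinates -/

section PluckerCoordinates

variable {K : Type u} [Field K] {W : Type*} [AddCommGroup W] [Module K W] {n i : ℕ}
  (b : Module.Basis (Fin n) K W)

/-- The linear form in the Plücker coordinates whose value at a family of vectors is the
determinant of the values of the functionals `F`. -/
def pluckerForm (F : Fin i → Module.Dual K W) : MvPolynomial (Fin i → Fin n) K :=
  ∑ J, MvPolynomial.C (∏ k, F k (b (J k))) * MvPolynomial.X J

theorem pluckerForm_mem (F : Fin i → Module.Dual K W) :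
    pluckerForm b F ∈ MvPolynomial.homogeneousSubmodule (Fin i → Fin n) K 1 :=
  (MvPolynomial.mem_homogeneousSubmodule _ _).mpr (MvPolynomial.IsHomogeneous.sum _ _ _ fun J _ ↦
    (MvPolynomial.isHomogeneous_X K J).C_mul _)

theorem eval_pluckerForm (F : Fin i → Module.Dual K W) (v : (Fin i → Fin n) → K) :
    MvPolynomial.eval v (pluckerForm b F) = ∑ J, (∏ k, F k (b (J k))) * v J := by
  simp [pluckerForm]

theorem eval_pluckerForm_smul (F : Fin i → Module.Dual K W) (c : K) (v : (Fin i → Fin n) → K) :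
    MvPolynomial.eval (c • v) (pluckerForm b F) = c * MvPolynomial.eval v (pluckerForm b F) := by
  simp only [eval_pluckerForm, Finset.mul_sum, Pi.smul_apply, smul_eq_mul]
  exact Finset.sum_congr rfl fun J _ ↦ by ring

/-- Each functional is a combination of coordinate functionals, and the determinant is expanded
multilinearly in the functionals. The expansion runs over all tuples of indices, which is why the
Plücker coordinates indexed by all tuples are convenient. -/
theorem eval_pluckerForm_minors (F : Fin i → Module.Dual K W) (w : Fin i → W) :
    MvPolynomial.eval (minors fun a ↦ b.equivFun (w a)) (pluckerForm b F) =
      Matrix.det (Matrix.of fun a k ↦ F k (w a)) := by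
  rw [eval_pluckerForm, ← Matrix.det_transpose]
  have h : (Matrix.of fun a k ↦ F k (w a)).transpose =
      fun k ↦ ∑ j : Fin n, (F k (b j)) • fun a ↦ b.equivFun (w a) j := by
    ext k a
    conv_lhs => rw [Matrix.transpose_apply, Matrix.of_apply, ← b.sum_equivFun (w a), map_sum]
    simp only [map_smul, Finset.sum_apply, Pi.smul_apply, smul_eq_mul]
    exact Finset.sum_congr rfl fun j _ ↦ mul_comm _ _
  have h2 := (Matrix.detRowAlternating (R := K) (n := Fin i)).toMultilinearMap.map_sum
    (fun k (j : Fin n) ↦ (F k (b j)) • fun a ↦ b.equivFun (w a) j)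
  rw [h]
  refine Eq.trans ?_ h2.symm
  refine Finset.sum_congr rfl fun J _ ↦ ?_
  rw [MultilinearMap.map_smul_univ, smul_eq_mul, minors, ← Matrix.det_transpose]
  rfl

theorem eval_pluckerForm_coord (J : Fin i → Fin n) (v : (Fin i → Fin n) → K) :
    MvPolynomial.eval v (pluckerForm b fun k ↦ b.coord (J k)) = v J := by
  rw [eval_pluckerForm, Finset.sum_eq_single J]
  · simp
  · intro J' _ hJ
    obtain ⟨k, hk⟩ := Function.ne_iff.mp hJ
    rw [Finset.prod_eq_zero (Finset.mem_univ k), zero_mul]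
    simp [Finsupp.single_eq_of_ne' hk]
  · simp

theorem equivFun_linearIndependent {w : Fin i → W} (hw : LinearIndependent K w) :
    LinearIndependent K fun a ↦ b.equivFun (w a) :=
  hw.map' b.equivFun.toLinearMap (LinearEquiv.ker _)

/-- Two families in `U` differ by a square matrix `g`, which multiplies every maximal minor by `det
g`; this determinant is nonzero because the minors of `w` are not all zero. -/
theorem pluckerPoint_eq {U : Submodule K W} (hU : Module.finrank K U = i)
    {w : Fin i → W} (hw : Submodule.span K (Set.range w) = U)
    (hw' : minors (fun a ↦ b.equivFun (w a)) ≠ 0) :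
    pluckerPoint b U hU = projPoint (minors fun a ↦ b.equivFun (w a)) hw' := by
  have : Module.Finite K W := Module.Finite.of_basis b
  let u := Module.finBasisOfFinrankEq K U hU
  have hwU (a : Fin i) : w a ∈ U := hw ▸ Submodule.subset_span ⟨a, rfl⟩
  let g : Matrix (Fin i) (Fin i) K := Matrix.of fun a c ↦ u.repr ⟨w a, hwU a⟩ c
  have h1 (a : Fin i) : w a = ∑ c, g a c • (u c : W) := by
    have := congr_arg Subtype.val (u.sum_repr ⟨w a, hwU a⟩)
    rw [AddSubmonoidClass.coe_finsetSum] at this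
    exact this.symm
  have h2 : minors (fun a ↦ b.equivFun (w a)) = g.det • minors (coordMatrix b U hU) := by
    funext J
    rw [Pi.smul_apply, smul_eq_mul, minors, minors, ← Matrix.det_mul]
    congr 1
    ext a k
    rw [Matrix.mul_apply, Matrix.of_apply, h1 a, map_sum]
    simp [coordMatrix, u, Finset.sum_apply]
  refine (projPoint_eq_iff _ _).mpr ⟨g.det, fun h0 ↦ hw' ?_, h2⟩
  rw [h2, h0, zero_smul]

/-- If a form `pluckerForm b F` does not vanish at the Plücker point of `U`, then `U` has a basis
which is dual to `F`, and its coordinates are quotients of linear forms in the Plücker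
coordinates. -/
theorem exists_normalized_basis {U : Submodule K W} (hU : Module.finrank K U = i)
    {v : (Fin i → Fin n) → K} {hv : v ≠ 0} (h : pluckerPoint b U hU = projPoint v hv)
    {F : Fin i → Module.Dual K W} (hF : MvPolynomial.eval v (pluckerForm b F) ≠ 0) :
    ∃ w : Fin i → W, Submodule.span K (Set.range w) = U ∧
      (∀ a k, F k (w a) = (1 : Matrix (Fin i) (Fin i) K) a k) ∧
      v = MvPolynomial.eval v (pluckerForm b F) • minors (fun a ↦ b.equivFun (w a)) ∧
      ∀ a q, q (w a) * MvPolynomial.eval v (pluckerForm b F) =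
        MvPolynomial.eval v (pluckerForm b (Function.update F a q)) := by
  have : Module.Finite K W := Module.Finite.of_basis b
  let u : Fin i → W := fun a ↦ (Module.finBasisOfFinrankEq K U hU a : W)
  have hu : minors (fun a ↦ b.equivFun (u a)) ≠ 0 :=
    minors_ne_zero _ (coordMatrix_linearIndependent b U hU)
  obtain ⟨c, hc, rfl⟩ := (projPoint_eq_iff hu hv).mp h
  let A : Matrix (Fin i) (Fin i) K := Matrix.of fun a k ↦ F k (u a)
  have hA : IsUnit A.det := by
    rw [eval_pluckerForm_smul, eval_pluckerForm_minors] at hF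
    exact IsUnit.mk0 _ (right_ne_zero_of_mul hF)
  -- The values of `F` on the chosen basis form an invertible matrix `A`; multiplying by its inverse
  -- makes the basis dual to `F`.
  let w : Fin i → W := fun a ↦ ∑ d, A⁻¹ a d • u d
  have hFw (a k : Fin i) : F k (w a) = (1 : Matrix (Fin i) (Fin i) K) a k := by
    rw [← Matrix.nonsing_inv_mul A hA, Matrix.mul_apply]
    simp [w, A]
  have hli : LinearIndependent K w := by
    rw [Fintype.linearIndependent_iff]
    intro g hg k
    have := congr_arg (F k) hg
    simpa [hFw, Matrix.one_apply] using this
  have hspan : Submodule.span K (Set.range w) = U := by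
    refine Submodule.eq_of_le_of_finrank_eq ?_ ?_
    · rw [Submodule.span_le]
      rintro _ ⟨a, rfl⟩
      exact Submodule.sum_mem _ fun d _ ↦ Submodule.smul_mem _ _ (Subtype.property _)
    · rw [finrank_span_eq_card hli, Fintype.card_fin, hU]
  have hw' := minors_ne_zero _ (equivFun_linearIndependent b hli)
  have h' := pluckerPoint_eq b hU hspan hw'
  rw [h] at h'
  obtain ⟨c', hc', h''⟩ := (projPoint_eq_iff hw' hv).mp h'.symm
  have hdet : Matrix.det (Matrix.of fun a k ↦ F k (w a)) = 1 := by
    have : (Matrix.of fun a k ↦ F k (w a)) = 1 := by ext a k; exact hFw a k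
    rw [this, Matrix.det_one]
  have hcc : MvPolynomial.eval (c • minors fun a ↦ b.equivFun (u a)) (pluckerForm b F) = c' := by
    rw [h'', eval_pluckerForm_smul, eval_pluckerForm_minors, hdet, mul_one]
  refine ⟨w, hspan, hFw, by rw [hcc]; exact h'', fun a q ↦ ?_⟩
  rw [hcc, h'', eval_pluckerForm_smul, eval_pluckerForm_minors, mul_comm]
  congr 1
  -- Cramer's rule: replacing the functional `F a` by `q` replaces column `a` of the identity
  -- matrix, and the determinant is then `q (w a)`.
  have h3 : (Matrix.of fun a' k ↦ Function.update F a q k (w a')) =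
      (1 : Matrix (Fin i) (Fin i) K).updateCol a fun a' ↦ q (w a') := by
    ext a' k
    rw [Matrix.updateCol_apply, Matrix.of_apply]
    split_ifs with hk
    · subst hk; simp
    · rw [Function.update_of_ne hk, hFw]
  rw [h3, ← Matrix.cramer_apply, Matrix.cramer_one]
  rfl

/-- Some Plücker coordinate is nonzero, and the basis dual to the corresponding coordinate
functionals is read off from the Plücker vector alone. -/
theorem pluckerPoint_injective {U U' : Submodule K W} {hU : Module.finrank K U = i}
    {hU' : Module.finrank K U' = i} (h : pluckerPoint b U hU = pluckerPoint b U' hU') :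
    U = U' := by
  have hv := minors_ne_zero _ (coordMatrix_linearIndependent b U hU)
  obtain ⟨J, hJ⟩ := Function.ne_iff.mp hv
  have hF : MvPolynomial.eval (minors (coordMatrix b U hU))
      (pluckerForm b fun k ↦ b.coord (J k)) ≠ 0 := by
    rwa [eval_pluckerForm_coord]
  obtain ⟨w, hw, -, -, h1⟩ := exists_normalized_basis b hU (hv := hv) rfl hF
  obtain ⟨w', hw', -, -, h2⟩ := exists_normalized_basis b hU' (hv := hv) h.symm hF
  have : w = w' := by
    funext a
    refine b.ext_elem fun j ↦ mul_right_cancel₀ hF ?_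
    exact (h1 a (b.coord j)).trans (h2 a (b.coord j)).symm
  rw [← hw, ← hw', this]

theorem linearIndependent_of_minors_ne_zero {w : Fin i → Fin n → K} (h : minors w ≠ 0) :
    LinearIndependent K w := by
  obtain ⟨J, hJ⟩ := Function.ne_iff.mp h
  have h1 : LinearIndependent K (Matrix.of fun a k ↦ w a (J k)).row := by
    rw [Matrix.linearIndependent_rows_iff_isUnit, Matrix.isUnit_iff_isUnit_det]
    exact IsUnit.mk0 _ hJ
  exact LinearIndependent.of_comp (LinearMap.funLeft K K J) h1

variable [IsAlgClosed K]

/-- The Plücker points form a closed set. -/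
theorem isClosedKPoints_pluckerPoint :
    IsClosedKPoints {x | ∃ (U : Submodule K W) (hU : Module.finrank K U = i),
      x = pluckerPoint b U hU} := by
  refine isClosedKPoints_of_local fun x hx ↦ ?_
  obtain ⟨v, hv, rfl⟩ := exists_eq_projPoint x
  obtain ⟨J₀, hJ₀⟩ := Function.ne_iff.mp hv
  have hX := X_mem (K := K) J₀
  let j := projChartι hX one_pos
  have : LocallyOfFiniteType (projChart (MvPolynomial.X J₀ : MvPolynomial (Fin i → Fin n) K)).hom :=
    locallyOfFiniteType_projChart hX one_pos
  have hne (y : KPoint (projChart (MvPolynomial.X J₀ : MvPolynomial (Fin i → Fin n) K))) v hv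
      (hy : y ≫ j = projPoint v hv) : MvPolynomial.eval v (MvPolynomial.X J₀) ≠ 0 := by
    rw [← projPoint_mem_basicOpen_iff v hv hX one_pos, ← hy, KPoint.pt_comp]
    exact (range_projChartι hX one_pos).le ⟨_, rfl⟩
  choose s hs using fun J ↦ exists_section_div j one_pos hX (X_mem (K := K) J) hne
  simp only [MvPolynomial.eval_X] at hs hne
  obtain ⟨d, hd⟩ := exists_kPoint_lift j (projPoint v hv) ((range_projChartι hX one_pos).ge
    ((projPoint_mem_basicOpen_iff v hv hX one_pos).mpr (by simpa using hJ₀)))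
  have hval (y : KPoint (projChart (MvPolynomial.X J₀ : MvPolynomial (Fin i → Fin n) K))) v hv
      (hy : y ≫ j = projPoint v hv) (J) : val y (s J) = v J / v J₀ :=
    eq_div_of_mul_eq (hne y v hv hy) (hs J y v hv hy)
  -- Where `v J₀ ≠ 0`, the basis normalized at `J₀` would have to have the entries `v
  -- (Function.update J₀ a c) / v J₀`. The function `t J` compares its minor at `J` with `v J / v
  -- J₀`, so the `t J` are equations for the Plücker points.
  let t (J : Fin i → Fin n) :=
    Matrix.det (Matrix.of fun a k ↦ s (Function.update J₀ a (J k))) - s J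
  have ht (y : KPoint (projChart (MvPolynomial.X J₀ : MvPolynomial (Fin i → Fin n) K))) v hv
      (hy : y ≫ j = projPoint v hv) (J) : val y (t J) =
      minors (fun a c ↦ v (Function.update J₀ a c) / v J₀) J - v J / v J₀ := by
    simp only [t, map_sub, hval y v hv hy, RingHom.map_det, minors]
    congr 2
    ext a k
    simp [hval y v hv hy]
  by_contra hcon
  push Not at hcon
  have hvan (J) : val d (t J) = 0 := by
    by_contra hJ
    obtain ⟨d', ⟨U, hU, hd'⟩, hne'⟩ := hcon _ j inferInstance d (t J) hd hJ
    apply hne'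
    have hvU := minors_ne_zero _ (coordMatrix_linearIndependent b U hU)
    rw [ht d' _ hvU hd']
    have h0 := hne d' _ hvU hd'
    set v' := minors (coordMatrix b U hU)
    have hF : MvPolynomial.eval v' (pluckerForm b fun k ↦ b.coord (J₀ k)) ≠ 0 := by
      rwa [eval_pluckerForm_coord]
    obtain ⟨w, -, -, h1, h2⟩ := exists_normalized_basis b hU (hv := hvU) rfl hF
    rw [eval_pluckerForm_coord] at h1 h2
    have h3 (a c) : v' (Function.update J₀ a c) / v' J₀ = b.equivFun (w a) c := by
      have h4 := h2 a (b.coord c)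
      have h5 : Function.update (fun k ↦ b.coord (J₀ k)) a (b.coord c) =
          fun k ↦ b.coord (Function.update J₀ a c k) := by
        funext k
        by_cases hk : k = a
        · subst hk; simp
        · simp [Function.update_of_ne hk]
      rw [h5, eval_pluckerForm_coord] at h4
      rw [← h4, mul_div_cancel_right₀ _ h0]
      rfl
    simp only [h3]
    have h6 : v' J / v' J₀ = minors (fun a ↦ b.equivFun (w a)) J := by
      conv_lhs => rw [h1]
      rw [Pi.smul_apply, Pi.smul_apply, smul_eq_mul, smul_eq_mul]
      have h7 : minors (fun a ↦ b.equivFun (w a)) J₀ = 1 := by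
        have := congr_fun h1 J₀
        rw [Pi.smul_apply, smul_eq_mul] at this
        exact mul_left_cancel₀ h0 (this.symm.trans (mul_one _).symm)
      rw [h7, mul_one, mul_div_cancel_left₀ _ h0]
    rw [h6, sub_self]
  -- If all the equations hold, the rows of the candidate matrix span a subspace with Plücker vector
  -- proportional to `v`.
  let w : Fin i → W := fun a ↦ b.equivFun.symm fun c ↦ v (Function.update J₀ a c) / v J₀
  have hw : v = v J₀ • minors (fun a ↦ b.equivFun (w a)) := by
    funext J
    have := hvan J
    rw [ht d v hv hd, sub_eq_zero] at this
    simp only [w, LinearEquiv.apply_symm_apply, Pi.smul_apply, smul_eq_mul]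
    rw [this, mul_div_cancel₀ _ hJ₀]
  have hw0 : minors (fun a ↦ b.equivFun (w a)) ≠ 0 := fun h ↦ hv (by rw [hw, h, smul_zero])
  have hli : LinearIndependent K w :=
    LinearIndependent.of_comp b.equivFun.toLinearMap (linearIndependent_of_minors_ne_zero hw0)
  refine hx ⟨Submodule.span K (Set.range w), by rw [finrank_span_eq_card hli, Fintype.card_fin], ?_⟩
  rw [pluckerPoint_eq b _ rfl hw0]
  exact ((projPoint_eq_iff hw0 hv).mpr ⟨_, hJ₀, hw⟩).symm

end PluckerCoordinates

/-! ### Lagrangian complements and symplectic frames -/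

section Symplectic

variable {κ : Type*} [Field κ] {V : Type*} [AddCommGroup V] [Module κ V]
  {ω : LinearMap.BilinForm κ V} {m : ℕ}

theorem baseChange_neg_swap (K : Type u) [Field K] [Algebra κ K] (hω : ω.IsAlt)
    (x y : K ⊗[κ] V) :
    LinearMap.BilinForm.baseChange K ω x y = -LinearMap.BilinForm.baseChange K ω y x := by
  induction x with
  | zero => simp
  | add x₁ x₂ h₁ h₂ => rw [map_add, LinearMap.add_apply, h₁, h₂, map_add, neg_add]
  | tmul a v =>
    induction y with
    | zero => simp
    | add y₁ y₂ h₁ h₂ => rw [map_add, h₁, h₂, map_add, LinearMap.add_apply, neg_add]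
    | tmul b w =>
      rw [LinearMap.BilinForm.baseChange_tmul, LinearMap.BilinForm.baseChange_tmul, mul_comm b,
        ← hω.neg_eq v w, neg_smul, neg_neg]

theorem baseChange_isRefl (K : Type u) [Field K] [Algebra κ K] (hω : ω.IsAlt) :
    (LinearMap.BilinForm.baseChange K ω).IsRefl := fun x y h ↦ by
  rw [baseChange_neg_swap K hω, h, neg_zero]

theorem nondegenerate_baseChange (K : Type u) [Field K] [Algebra κ K] {ι : Type*} [Finite ι]
    (e : Module.Basis ι κ V) (hω' : ω.Nondegenerate) :
    (LinearMap.BilinForm.baseChange K ω).Nondegenerate := by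
  classical
  have := Fintype.ofFinite ι
  rw [LinearMap.BilinForm.nondegenerate_iff_det_ne_zero (e.baseChange K)]
  have h : LinearMap.BilinForm.toMatrix (e.baseChange K) (LinearMap.BilinForm.baseChange K ω) =
      (LinearMap.BilinForm.toMatrix e ω).map (algebraMap κ K) := by
    ext a b
    rw [LinearMap.BilinForm.toMatrix_apply, Matrix.map_apply, LinearMap.BilinForm.toMatrix_apply,
      Module.Basis.baseChange_apply, Module.Basis.baseChange_apply,
      LinearMap.BilinForm.baseChange_tmul, mul_one, Algebra.smul_def, mul_one]
  rw [h, ← RingHom.mapMatrix_apply, ← RingHom.map_det]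
  exact (map_ne_zero _).mpr ((LinearMap.BilinForm.nondegenerate_iff_det_ne_zero e).mp hω')

theorem finrank_baseChange_submodule (K : Type u) [Field K] [Algebra κ K] (p : Submodule κ V) :
    Module.finrank K (p.baseChange K) = Module.finrank κ p := by
  rw [← (Submodule.toBaseChange.toLinearEquiv K p).finrank_eq, Module.finrank_baseChange]

/-- One inclusion is checked on generators; nondegeneracy over `κ` and over `K` gives both sides the
same dimension. -/
theorem baseChange_orthogonal (K : Type u) [Field K] [Algebra κ K] [Module.Finite κ V]
    (hω' : ω.Nondegenerate) (p : Submodule κ V) :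
    (ω.orthogonal p).baseChange K =
      (LinearMap.BilinForm.baseChange K ω).orthogonal (p.baseChange K) := by
  refine Submodule.eq_of_le_of_finrank_eq ?_ ?_
  · rw [Submodule.baseChange_eq_span, Submodule.span_le]
    rintro _ ⟨v, hv, rfl⟩
    intro x hx
    rw [Submodule.baseChange_eq_span] at hx
    refine Submodule.span_induction ?_ ?_ ?_ ?_ hx
    · rintro _ ⟨w, hw, rfl⟩
      have : ω w v = 0 := hv w hw
      simp [this]
    · simp
    · intro x y _ _ h h'
      rw [map_add, LinearMap.add_apply, h, h', add_zero]
    · intro a x _ h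
      rw [map_smul, LinearMap.smul_apply, h, smul_zero]
  · rw [finrank_baseChange_submodule, LinearMap.BilinForm.finrank_orthogonal hω',
      LinearMap.BilinForm.finrank_orthogonal
        (nondegenerate_baseChange K (Module.finBasis κ V) hω'),
      finrank_baseChange_submodule, Module.finrank_baseChange]

/-- A Lagrangian subspace of `V_K` has a Lagrangian complement defined over `κ`. -/
theorem exists_rational_lagrangian_complement (K : Type u) [Field K] [Algebra κ K]
    [Module.Finite κ V] (hV : Module.finrank κ V = 2 * m) (hω : ω.IsAlt) (hω' : ω.Nondegenerate)
    {U : Submodule K (K ⊗[κ] V)} (hU : IsLagrangian K ω m U) :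
    ∃ W₀ : Submodule κ V, Module.finrank κ W₀ = m ∧ (∀ x ∈ W₀, ∀ y ∈ W₀, ω x y = 0) ∧
      W₀.baseChange K ⊓ U = ⊥ := by
  let Q (W : Submodule κ V) : Prop := (∀ x ∈ W, ∀ y ∈ W, ω x y = 0) ∧ W.baseChange K ⊓ U = ⊥
  have hbd : ∀ W, Q W → Module.finrank κ W ≤ 2 * m := fun W _ ↦ hV ▸ Submodule.finrank_le W
  classical
  have hex : ∃ d, ∃ W, Q W ∧ Module.finrank κ W = d :=
    ⟨_, ⊥, ⟨by simp +contextual, by simp⟩, rfl⟩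
  -- A rational isotropic subspace transverse to `U`, of maximal dimension; it is shown to have
  -- dimension `m`.
  obtain ⟨W, hW, hmax⟩ : ∃ W, Q W ∧ ∀ W', Q W' → Module.finrank κ W' ≤ Module.finrank κ W := by
    have hP : (∃ W, Q W ∧ Module.finrank κ W =
        Nat.findGreatest (fun d ↦ ∃ W, Q W ∧ Module.finrank κ W = d) (2 * m)) := by
      obtain ⟨d, W, hW, hd⟩ := hex
      exact Nat.findGreatest_spec (P := fun d ↦ ∃ W, Q W ∧ Module.finrank κ W = d)
        (hd ▸ hbd W hW) ⟨W, hW, hd⟩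
    obtain ⟨W, hW, hd⟩ := hP
    exact ⟨W, hW, fun W' hW' ↦ hd ▸ Nat.le_findGreatest (hbd W' hW') ⟨W', hW', rfl⟩⟩
  have hB := nondegenerate_baseChange K (Module.finBasis κ V) hω'
  have hR := baseChange_isRefl K hω
  set B := LinearMap.BilinForm.baseChange K ω
  have hVK : Module.finrank K (K ⊗[κ] V) = 2 * m := by rw [Module.finrank_baseChange, hV]
  set P := W.baseChange K with hPdef
  have hPd : Module.finrank K P = Module.finrank κ W := finrank_baseChange_submodule K W
  have hWiso : W ≤ ω.orthogonal W := fun x hx y hy ↦ hW.1 y hy x hx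
  have hle : Module.finrank κ W ≤ m := by
    have := Submodule.finrank_mono hWiso
    rw [LinearMap.BilinForm.finrank_orthogonal hω', hV] at this
    omega
  refine ⟨W, hle.antisymm ?_, hW⟩
  by_contra! hlt
  -- For `v` in the orthogonal of `W` but not in `W`, the space `W + κ v` is again isotropic, so by
  -- maximality its scalar extension meets `U` in some `z = p + a v ≠ 0`. As `P` is transverse to
  -- `U`, `a` is nonzero, and `v` lies in `U + P`. Such `v`, together with `W`, span the orthogonal
  -- of `P`.
  have hsub : B.orthogonal P ≤ U ⊔ P := by
    rw [hPdef, ← baseChange_orthogonal K hω', Submodule.baseChange_eq_span, Submodule.span_le]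
    rintro _ ⟨v, hv, rfl⟩
    by_cases hvW : v ∈ W
    · exact Submodule.mem_sup_right (Submodule.tmul_mem_baseChange_of_mem _ hvW)
    have hnQ : ¬ Q (W ⊔ Submodule.span κ {v}) := by
      intro h
      have h1 := hmax _ h
      have h2 : W < W ⊔ Submodule.span κ {v} :=
        lt_of_le_of_ne le_sup_left fun h ↦ hvW (by
          rw [h]; exact Submodule.mem_sup_right (Submodule.mem_span_singleton_self v))
      exact (Submodule.finrank_lt_finrank_of_lt h2).not_ge h1
    have hiso : ∀ x ∈ W ⊔ Submodule.span κ {v}, ∀ y ∈ W ⊔ Submodule.span κ {v}, ω x y = 0 := by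
      intro x hx y hy
      obtain ⟨x₁, hx₁, x₂, hx₂, rfl⟩ := Submodule.mem_sup.mp hx
      obtain ⟨y₁, hy₁, y₂, hy₂, rfl⟩ := Submodule.mem_sup.mp hy
      obtain ⟨s, rfl⟩ := Submodule.mem_span_singleton.mp hx₂
      obtain ⟨t, rfl⟩ := Submodule.mem_span_singleton.mp hy₂
      have h1 : ω x₁ v = 0 := hv x₁ hx₁
      have h2 : ω v y₁ = 0 := by rw [← hω.neg_eq, show ω y₁ v = 0 from hv y₁ hy₁, neg_zero]
      simp [hW.1 x₁ hx₁ y₁ hy₁, h1, h2, hω.self_eq_zero v]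
    have hne : (W ⊔ Submodule.span κ {v}).baseChange K ⊓ U ≠ ⊥ := fun h ↦ hnQ ⟨hiso, h⟩
    obtain ⟨z, hz, hz0⟩ := Submodule.exists_mem_ne_zero_of_ne_bot hne
    have hsup : (W ⊔ Submodule.span κ {v}).baseChange K ≤ P ⊔ Submodule.span K {1 ⊗ₜ v} := by
      rw [Submodule.baseChange_eq_span, Submodule.span_le]
      rintro _ ⟨x, hx, rfl⟩
      obtain ⟨x₁, hx₁, x₂, hx₂, rfl⟩ := Submodule.mem_sup.mp hx
      obtain ⟨s, rfl⟩ := Submodule.mem_span_singleton.mp hx₂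
      change (1 : K) ⊗ₜ[κ] (x₁ + s • v) ∈ _
      rw [TensorProduct.tmul_add]
      refine Submodule.add_mem_sup (Submodule.tmul_mem_baseChange_of_mem _ hx₁) ?_
      rw [← TensorProduct.smul_tmul, Algebra.smul_def, mul_one]
      exact Submodule.mem_span_singleton.mpr ⟨algebraMap κ K s, by
        rw [TensorProduct.smul_tmul', smul_eq_mul, mul_one]⟩
    obtain ⟨p, hp, t, ht, hpt⟩ := Submodule.mem_sup.mp (hsup hz.1)
    obtain ⟨a, rfl⟩ := Submodule.mem_span_singleton.mp ht
    have ha : a ≠ 0 := by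
      rintro rfl
      rw [zero_smul, add_zero] at hpt
      have : z ∈ P ⊓ U := ⟨hpt ▸ hp, hz.2⟩
      rw [hW.2] at this
      exact hz0 this
    have hv' : (1 : K) ⊗ₜ[κ] v = a⁻¹ • z + -(a⁻¹ • p) := by
      rw [← hpt, smul_add, smul_smul, inv_mul_cancel₀ ha, one_smul]
      abel
    change (1 : K) ⊗ₜ[κ] v ∈ _
    rw [hv']
    exact Submodule.add_mem_sup (U.smul_mem _ hz.2) (P.neg_mem (P.smul_mem _ hp))
  have h1 := LinearMap.BilinForm.orthogonal_le (B := B) hsub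
  rw [LinearMap.BilinForm.orthogonal_orthogonal hB hR] at h1
  -- A vector of the left side is orthogonal to `U + P`, hence to the orthogonal of `P`, hence lies
  -- in `P`. So `U` and the orthogonal of `P` meet in zero, and `m + (2m - dim W) ≤ 2m`.
  have h2 : U ⊓ B.orthogonal P ≤ P ⊓ U := fun x hx ↦ ⟨h1 fun y hy ↦ by
    obtain ⟨y₁, hy₁, y₂, hy₂, rfl⟩ := Submodule.mem_sup.mp hy
    rw [map_add, LinearMap.add_apply, hU.2 y₁ hy₁ x hx.1,
      show B y₂ x = 0 from hx.2 y₂ hy₂, add_zero], hx.1⟩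
  rw [hW.2, le_bot_iff] at h2
  have h3 := Submodule.finrank_sup_add_finrank_inf_eq U (B.orthogonal P)
  rw [h2, finrank_bot, LinearMap.BilinForm.finrank_orthogonal hB, hVK, hU.1, hPd] at h3
  have h4 := Submodule.finrank_le (U ⊔ B.orthogonal P)
  omega

/-- A symplectic basis of `V`. -/
def IsSymplecticBasis (ω : LinearMap.BilinForm κ V)
    (f : Module.Basis (Fin m ⊕ Fin m) κ V) : Prop :=
  (∀ a b, ω (f (.inl a)) (f (.inl b)) = 0) ∧ (∀ a b, ω (f (.inr a)) (f (.inr b)) = 0) ∧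
    ∀ a b, ω (f (.inl a)) (f (.inr b)) = if a = b then 1 else 0

/-- The complement result is used twice: over `K` it gives a rational Lagrangian `W₀` transverse to
`U`, and with `κ` in place of `K` it gives a Lagrangian `W₁` transverse to `W₀`. The form pairs `W₁`
with `W₀` perfectly, so dual bases of the two form a symplectic basis. -/
theorem exists_symplecticBasis (K : Type u) [Field K] [Algebra κ K]
    [Module.Finite κ V] (hV : Module.finrank κ V = 2 * m) (hω : ω.IsAlt) (hω' : ω.Nondegenerate)
    {U : Submodule K (K ⊗[κ] V)} (hU : IsLagrangian K ω m U) :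
    ∃ f : Module.Basis (Fin m ⊕ Fin m) κ V, IsSymplecticBasis ω f ∧
      Submodule.span K (Set.range fun b ↦ (1 : K) ⊗ₜ[κ] f (.inr b)) ⊓ U = ⊥ := by
  obtain ⟨W₀, hd₀, hiso₀, hW₀⟩ := exists_rational_lagrangian_complement K hV hω hω' hU
  obtain ⟨W₁, hd₁, hiso₁, hW₁⟩ := exists_rational_lagrangian_complement κ (m := m) hV hω hω'
    (U := W₀.baseChange κ) ⟨by rw [finrank_baseChange_submodule, hd₀], by
      intro x hx y hy
      rw [Submodule.baseChange_eq_span] at hx hy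
      induction hx using Submodule.span_induction with
      | zero => simp
      | add x₁ x₂ _ _ h₁ h₂ =>
        rw [map_add, LinearMap.add_apply, h₁, h₂, add_zero]
      | smul a x _ h =>
        rw [map_smul, LinearMap.smul_apply, h, smul_zero]
      | mem x hx =>
        obtain ⟨v, hv, rfl⟩ := hx
        induction hy using Submodule.span_induction with
        | zero => simp
        | add x₁ x₂ _ _ h₁ h₂ =>
          rw [map_add, h₁, h₂, add_zero]
        | smul a x _ h =>
          rw [map_smul, h, smul_zero]
        | mem y hy =>
          obtain ⟨w, hw, rfl⟩ := hy
          simp [hiso₀ v hv w hw]⟩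
  have hdisj (v : V) (h₀ : v ∈ W₀) (h₁ : v ∈ W₁) : v = 0 := by
    have h : (1 : κ) ⊗ₜ[κ] v ∈ W₁.baseChange κ ⊓ W₀.baseChange κ :=
      ⟨Submodule.tmul_mem_baseChange_of_mem _ h₁, Submodule.tmul_mem_baseChange_of_mem _ h₀⟩
    rw [hW₁, Submodule.mem_bot] at h
    simpa using congr_arg (TensorProduct.lid κ V) h
  have hperp : ω.orthogonal W₀ = W₀ := by
    have hle : W₀ ≤ ω.orthogonal W₀ := fun x hx y hy ↦ hiso₀ y hy x hx
    refine (Submodule.eq_of_le_of_finrank_eq hle ?_).symm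
    rw [LinearMap.BilinForm.finrank_orthogonal hω', hV, hd₀]
    omega
  let h := Module.finBasisOfFinrankEq κ W₀ hd₀
  have hspan : Submodule.span κ (Set.range fun b ↦ (h b : V)) = W₀ := by
    have := congr_arg (Submodule.map W₀.subtype) h.span_eq
    rwa [Submodule.map_span, Submodule.map_top, Submodule.range_subtype, ← Set.range_comp] at this
  let φ : W₁ →ₗ[κ] Fin m → κ := LinearMap.pi fun b ↦ (ω.flip (h b)).comp W₁.subtype
  have hφ (w : W₁) (b) : φ w b = ω w (h b) := rfl
  -- A vector of `W₁` which pairs to zero with `W₀` lies in `W₀`, its own orthogonal, and so is zero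
  -- by transversality.
  have hφi : Function.Injective φ := by
    rw [← LinearMap.ker_eq_bot, LinearMap.ker_eq_bot']
    intro w hw
    refine Subtype.ext (hdisj w ?_ w.2)
    rw [← hperp]
    intro y hy
    rw [← hspan] at hy
    change ω y w = 0
    rw [← hω.neg_eq, neg_eq_zero]
    induction hy using Submodule.span_induction with
    | zero => simp
    | add x y _ _ hx hy => rw [map_add, hx, hy, add_zero]
    | smul a x _ hx => rw [map_smul, hx, smul_zero]
    | mem x hx =>
      obtain ⟨b, rfl⟩ := hx
      exact congr_fun hw b
  have hφs : Function.Surjective φ :=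
    (LinearMap.injective_iff_surjective_of_finrank_eq_finrank (by simp [hd₁])).mp hφi
  choose g hg using fun a ↦ hφs (Pi.single a 1)
  have hgh (a b) : ω (g a) (h b) = if a = b then 1 else 0 := by
    rw [← hφ, hg, Pi.single_apply]
    simp [eq_comm]
  have hhg (a b) : ω (h b) (g a) = if a = b then -1 else 0 := by
    rw [← hω.neg_eq, hgh]
    split_ifs <;> simp
  let F : Fin m ⊕ Fin m → V := Sum.elim (fun a ↦ (g a : V)) fun b ↦ (h b : V)
  have hli : LinearIndependent κ F := by
    rw [Fintype.linearIndependent_iff]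
    intro c hc
    rw [Fintype.sum_sum_type] at hc
    simp only [F, Sum.elim_inl, Sum.elim_inr] at hc
    rintro (a | a)
    · have h1 := congr_arg (fun v ↦ ω v (h a)) hc
      simpa [hgh, fun b ↦ hiso₀ _ (h b).2 _ (h a).2] using h1
    · have h1 := congr_arg (fun v ↦ ω (g a) v) hc
      simpa [hgh, fun b ↦ hiso₁ _ (g a).2 _ (g b).2] using h1
  let f : Module.Basis (Fin m ⊕ Fin m) κ V :=
    basisOfLinearIndependentOfCardEqFinrank' F hli (by simp [hV]; ring)
  have hf : ⇑f = F := coe_basisOfLinearIndependentOfCardEqFinrank' _ _ _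
  refine ⟨f, ⟨fun a b ↦ ?_, fun a b ↦ ?_, fun a b ↦ ?_⟩, ?_⟩
  · simpa [hf, F] using hiso₁ _ (g a).2 _ (g b).2
  · simpa [hf, F] using hiso₀ _ (h a).2 _ (h b).2
  · simpa [hf, F] using hgh a b
  · rw [← le_bot_iff, ← hW₀]
    refine inf_le_inf_right _ (Submodule.span_le.mpr ?_)
    rintro _ ⟨b, rfl⟩
    refine Submodule.tmul_mem_baseChange_of_mem _ ?_
    simp [hf, F]

end Symplectic

/-! ### Graphs of matrices -/

/-- `w` is a basis of `U` which is dual to the functionals `F`. -/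
def IsDualBasis {K : Type u} [Field K] {W : Type*} [AddCommGroup W] [Module K W] {i : ℕ}
    (F : Fin i → Module.Dual K W) (w : Fin i → W) (U : Submodule K W) : Prop :=
  Submodule.span K (Set.range w) = U ∧ ∀ a k, F k (w a) = (1 : Matrix (Fin i) (Fin i) K) a k

/-! ### Bases of subspaces dual to given functionals -/

section DualBasis

variable {K : Type u} [Field K] {W : Type*} [AddCommGroup W] [Module K W] {i : ℕ}
  {F : Fin i → Module.Dual K W} {w : Fin i → W} {U : Submodule K W}

theorem IsDualBasis.linearIndependent (h : IsDualBasis F w U) : LinearIndependent K w := by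
  rw [Fintype.linearIndependent_iff]
  intro g hg k
  have := congr_arg (F k) hg
  simpa [h.2, Matrix.one_apply] using this

theorem IsDualBasis.finrank_eq (h : IsDualBasis F w U) : Module.finrank K U = i := by
  rw [← h.1, finrank_span_eq_card h.linearIndependent, Fintype.card_fin]

theorem IsDualBasis.mem (h : IsDualBasis F w U) (a : Fin i) : w a ∈ U :=
  h.1 ▸ Submodule.subset_span ⟨a, rfl⟩

theorem IsDualBasis.eq_sum (h : IsDualBasis F w U) {v : W} (hv : v ∈ U) :
    v = ∑ a, F a v • w a := by
  rw [← h.1] at hv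
  induction hv using Submodule.span_induction with
  | zero => simp
  | add x y _ _ hx hy =>
    simp only [map_add, add_smul, Finset.sum_add_distrib]
    rw [← hx, ← hy]
  | smul c x _ hx =>
    simp only [map_smul, smul_assoc]
    rw [← Finset.smul_sum, ← hx]
  | mem x hx =>
    obtain ⟨a, rfl⟩ := hx
    simp [h.2, Matrix.one_apply]

theorem IsDualBasis.unique (h : IsDualBasis F w U) {w' : Fin i → W} (h' : IsDualBasis F w' U) :
    w' = w := by
  funext a
  rw [h.eq_sum (h'.mem a)]
  simp [h'.2, Matrix.one_apply]

theorem exists_isDualBasis [Module.Finite K W] (hU : Module.finrank K U = i)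
    (h : ∀ v ∈ U, (∀ k, F k v = 0) → v = 0) : ∃ w, IsDualBasis F w U := by
  let φ : U →ₗ[K] Fin i → K := LinearMap.pi fun k ↦ (F k).comp U.subtype
  have hφi : Function.Injective φ := by
    rw [← LinearMap.ker_eq_bot, LinearMap.ker_eq_bot']
    exact fun v hv ↦ Subtype.ext (h v v.2 fun k ↦ congr_fun hv k)
  have hφs : Function.Surjective φ :=
    (LinearMap.injective_iff_surjective_of_finrank_eq_finrank (by simp [hU])).mp hφi
  choose g hg using fun a ↦ hφs (Pi.single a 1)
  have hd (a k) : F k (g a : W) = (1 : Matrix (Fin i) (Fin i) K) a k := by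
    have : F k (g a : W) = φ (g a) k := rfl
    rw [this, hg, Matrix.one_apply, Pi.single_apply]
    simp [eq_comm]
  have h1 : IsDualBasis F (fun a ↦ (g a : W)) (Submodule.span K (Set.range fun a ↦ (g a : W))) :=
    ⟨rfl, hd⟩
  refine ⟨fun a ↦ g a, Submodule.eq_of_le_of_finrank_eq (Submodule.span_le.mpr ?_) ?_, hd⟩
  · rintro _ ⟨a, rfl⟩
    exact (g a).2
  · rw [h1.finrank_eq, hU]

theorem IsDualBasis.eq_zero (h : IsDualBasis F w U) {v : W} (hv : v ∈ U) (h0 : ∀ k, F k v = 0) :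
    v = 0 := by
  rw [h.eq_sum hv]
  simp [h0]

/-- The functionals, written on a basis of `U`, form a matrix of full row rank; a nonzero maximal
minor selects `i` functionals which already separate the points of `U`. -/
theorem exists_forall_eq_zero [Module.Finite K W] (hd : Module.finrank K U = i) {n : ℕ}
    {x : Fin n → Module.Dual K W} (hx : ∀ v ∈ U, (∀ k, x k v = 0) → v = 0) :
    ∃ J : Fin i → Fin n, ∀ v ∈ U, (∀ k, x (J k) v = 0) → v = 0 := by
  let u := Module.finBasisOfFinrankEq K U hd
  have hli : LinearIndependent K fun (a : Fin i) (k : Fin n) ↦ x k (u a) := by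
    rw [Fintype.linearIndependent_iff]
    intro g hg
    have h0 : ∑ a, g a • (u a : W) = 0 := by
      refine hx _ (Submodule.sum_mem _ fun a _ ↦ Submodule.smul_mem _ _ (u a).2) fun k ↦ ?_
      simpa using congr_fun hg k
    refine Fintype.linearIndependent_iff.mp u.linearIndependent g (Subtype.ext ?_)
    rw [AddSubmonoidClass.coe_finsetSum]
    exact h0
  obtain ⟨J, hJ⟩ := Function.ne_iff.mp (minors_ne_zero _ hli)
  refine ⟨J, fun v hv h0 ↦ ?_⟩
  have h2 : Matrix.vecMul (u.repr ⟨v, hv⟩) (Matrix.of fun a k ↦ x (J k) (u a)) = 0 := by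
    funext k
    rw [Pi.zero_apply, ← h0 k]
    have := congr_arg (fun v : U ↦ x (J k) v) (u.sum_repr ⟨v, hv⟩)
    simp only [AddSubmonoidClass.coe_finsetSum, map_sum, Submodule.coe_smul, map_smul] at this
    exact this
  have h3 := Matrix.eq_zero_of_vecMul_eq_zero hJ h2
  have h4 : u.repr ⟨v, hv⟩ = 0 := DFunLike.coe_injective h3
  simpa using h4

end DualBasis

section Graph

variable {κ : Type*} [Field κ] {K : Type u} [Field K] [Algebra κ K]
  {V : Type*} [AddCommGroup V] [Module κ V] {m : ℕ} (f : Module.Basis (Fin m ⊕ Fin m) κ V)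

variable (K) in
/-- The first half of the coordinates. -/
def xCoord (a : Fin m) : Module.Dual K (K ⊗[κ] V) := (f.baseChange K).coord (.inl a)

variable (K) in
/-- The second half of the coordinates. -/
def yCoord (b : Fin m) : Module.Dual K (K ⊗[κ] V) := (f.baseChange K).coord (.inr b)

/-- The point of the graph of `S` over a basis vector. -/
def graphVec (S : Matrix (Fin m) (Fin m) K) (a : Fin m) : K ⊗[κ] V :=
  (1 : K) ⊗ₜ[κ] f (.inl a) + ∑ b, S a b • (1 : K) ⊗ₜ[κ] f (.inr b)

/-- The graph of `S`. -/
def graph (S : Matrix (Fin m) (Fin m) K) : Submodule K (K ⊗[κ] V) :=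
  Submodule.span K (Set.range (graphVec f S))

theorem ext_xyCoord {v w : K ⊗[κ] V} (hx : ∀ a, xCoord K f a v = xCoord K f a w)
    (hy : ∀ b, yCoord K f b v = yCoord K f b w) : v = w :=
  (f.baseChange K).ext_elem (Sum.rec hx hy)

@[simp] theorem xCoord_inl (a k : Fin m) :
    xCoord K f k ((1 : K) ⊗ₜ[κ] f (.inl a)) = (1 : Matrix (Fin m) (Fin m) K) a k := by
  rw [xCoord, ← Module.Basis.baseChange_apply, Module.Basis.coord_apply, Module.Basis.repr_self,
    Matrix.one_apply, Finsupp.single_apply]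
  simp

@[simp] theorem xCoord_inr (a k : Fin m) : xCoord K f k ((1 : K) ⊗ₜ[κ] f (.inr a)) = 0 := by
  rw [xCoord, ← Module.Basis.baseChange_apply, Module.Basis.coord_apply, Module.Basis.repr_self,
    Finsupp.single_apply]
  simp

@[simp] theorem yCoord_inl (a k : Fin m) : yCoord K f k ((1 : K) ⊗ₜ[κ] f (.inl a)) = 0 := by
  rw [yCoord, ← Module.Basis.baseChange_apply, Module.Basis.coord_apply, Module.Basis.repr_self,
    Finsupp.single_apply]
  simp

@[simp] theorem yCoord_inr (a k : Fin m) :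
    yCoord K f k ((1 : K) ⊗ₜ[κ] f (.inr a)) = (1 : Matrix (Fin m) (Fin m) K) a k := by
  rw [yCoord, ← Module.Basis.baseChange_apply, Module.Basis.coord_apply, Module.Basis.repr_self,
    Matrix.one_apply, Finsupp.single_apply]
  simp

variable (S : Matrix (Fin m) (Fin m) K)

@[simp] theorem xCoord_graphVec (a k : Fin m) :
    xCoord K f k (graphVec f S a) = (1 : Matrix (Fin m) (Fin m) K) a k := by
  simp [graphVec]

@[simp] theorem yCoord_graphVec (a b : Fin m) : yCoord K f b (graphVec f S a) = S a b := by
  simp [graphVec, Matrix.one_apply]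

theorem isDualBasis_graphVec : IsDualBasis (xCoord K f) (graphVec f S) (graph f S) :=
  ⟨rfl, xCoord_graphVec f S⟩

theorem finrank_graph : Module.finrank K (graph f S) = m := (isDualBasis_graphVec f S).finrank_eq

variable {S}

theorem mem_graph_iff {v : K ⊗[κ] V} :
    v ∈ graph f S ↔ ∀ b, yCoord K f b v = ∑ a, xCoord K f a v * S a b := by
  constructor
  · intro h b
    conv_lhs => rw [(isDualBasis_graphVec f S).eq_sum h]
    simp
  · intro h
    have : v = ∑ a, xCoord K f a v • graphVec f S a := by
      refine ext_xyCoord f (fun k ↦ ?_) fun b ↦ ?_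
      · simp [Matrix.one_apply]
      · simp [h]
    rw [this]
    exact Submodule.sum_mem _ fun a _ ↦ Submodule.smul_mem _ _ (Submodule.subset_span ⟨a, rfl⟩)

theorem graphVec_mem (a : Fin m) : graphVec f S a ∈ graph f S := Submodule.subset_span ⟨a, rfl⟩

theorem graph_injective {S' : Matrix (Fin m) (Fin m) K} (h : graph f S = graph f S') : S = S' := by
  ext a b
  have := (mem_graph_iff f (S := S')).mp (h ▸ graphVec_mem f a) b
  simpa [Matrix.one_apply] using this

theorem IsDualBasis.eq_graph {U : Submodule K (K ⊗[κ] V)} {w : Fin m → K ⊗[κ] V}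
    (h : IsDualBasis (xCoord K f) w U) :
    U = graph f (Matrix.of fun a b ↦ yCoord K f b (w a)) := by
  have : w = graphVec f (Matrix.of fun a b ↦ yCoord K f b (w a)) := by
    funext a
    exact ext_xyCoord f (fun k ↦ by simp [h.2]) fun b ↦ by simp
  rw [← h.1, graph, ← this]

/-- Transversality to the span of the second half of the basis makes the `x`-coordinates injective
on `U`, so `U` has a basis dual to them. -/
theorem exists_eq_graph {U : Submodule K (K ⊗[κ] V)} (hU : Module.finrank K U = m)
    (h : Submodule.span K (Set.range fun b ↦ (1 : K) ⊗ₜ[κ] f (.inr b)) ⊓ U = ⊥) :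
    ∃ S, U = graph f S := by
  have : Module.Finite K (K ⊗[κ] V) := Module.Finite.of_basis (f.baseChange K)
  obtain ⟨w, hw⟩ := exists_isDualBasis (F := xCoord K f) hU fun v hv h0 ↦ by
    have hv' : v ∈ Submodule.span K (Set.range fun b ↦ (1 : K) ⊗ₜ[κ] f (.inr b)) := by
      have : v = ∑ b, yCoord K f b v • (1 : K) ⊗ₜ[κ] f (.inr b) := by
        refine ext_xyCoord f (fun k ↦ ?_) fun b ↦ ?_
        · simp [h0]
        · simp [Matrix.one_apply]
      rw [this]
      exact Submodule.sum_mem _ fun a _ ↦ Submodule.smul_mem _ _ (Submodule.subset_span ⟨a, rfl⟩)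
    have hmem : v ∈ Submodule.span K (Set.range fun b ↦ (1 : K) ⊗ₜ[κ] f (.inr b)) ⊓ U := ⟨hv', hv⟩
    rwa [h, Submodule.mem_bot] at hmem
  exact ⟨_, hw.eq_graph f⟩

/-- Only the two mixed pairings survive, with opposite signs; isotropy of the graph therefore
amounts to symmetry of `S`. -/
theorem baseChange_graphVec {ω : LinearMap.BilinForm κ V} (hω : ω.IsAlt)
    (hf : IsSymplecticBasis ω f) (a b : Fin m) :
    LinearMap.BilinForm.baseChange K ω (graphVec f S a) (graphVec f S b) = S b a - S a b := by
  have h (a b) : ω (f (.inr b)) (f (.inl a)) = if a = b then -1 else 0 := by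
    rw [← hω.neg_eq, hf.2.2]
    split_ifs <;> simp
  simp [graphVec, LinearMap.BilinForm.baseChange_tmul, hf.1, hf.2.1, hf.2.2, h,
    LinearMap.add_apply, LinearMap.sum_apply, ite_smul, sub_eq_add_neg]

theorem isLagrangian_graph_iff {ω : LinearMap.BilinForm κ V} (hω : ω.IsAlt)
    (hf : IsSymplecticBasis ω f) : IsLagrangian K ω m (graph f S) ↔ S.IsSymm := by
  constructor
  · intro h
    ext a b
    have := h.2 _ (graphVec_mem f a) _ (graphVec_mem f b)
    rw [baseChange_graphVec f hω hf, sub_eq_zero] at this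
    exact this
  · intro h
    refine ⟨finrank_graph f S, fun x hx y hy ↦ ?_⟩
    rw [(isDualBasis_graphVec f S).eq_sum hx, (isDualBasis_graphVec f S).eq_sum hy]
    simp only [map_sum, LinearMap.sum_apply, map_smul, LinearMap.smul_apply,
      baseChange_graphVec f hω hf, h.apply, sub_self, smul_zero, Finset.sum_const_zero]

/-! ### Frobenius -/

variable [Fintype κ]

/-- The polynomial `X ^ q - X` splits over `κ` with all elements of `κ` as roots, so its roots in
`K` are their images. -/
theorem exists_algebraMap_eq_of_pow_card_eq {a : K} (h : a ^ Fintype.card κ = a) :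
    ∃ s : κ, algebraMap κ K s = a := by
  have hsp : (Polynomial.X ^ Fintype.card κ - Polynomial.X : Polynomial κ).Splits := by
    rw [Polynomial.splits_iff_card_roots, FiniteField.roots_X_pow_card_sub_X,
      FiniteField.X_pow_card_sub_X_natDegree_eq κ Fintype.one_lt_card]
    rfl
  have hr := hsp.roots_map (algebraMap κ K)
  rw [FiniteField.roots_X_pow_card_sub_X, Polynomial.map_sub, Polynomial.map_pow,
    Polynomial.map_X] at hr
  have ha : a ∈ (Polynomial.X ^ Fintype.card κ - Polynomial.X : Polynomial K).roots := by
    rw [Polynomial.mem_roots (FiniteField.X_pow_card_sub_X_ne_zero K Fintype.one_lt_card)]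
    simp [h]
  rw [hr, Multiset.mem_map] at ha
  obtain ⟨s, -, hs⟩ := ha
  exact ⟨s, hs⟩

/-- The Frobenius on the tensor product is semilinear for the `q`-th power map, so its values on
generators suffice. -/
theorem frob_span (s : Set (K ⊗[κ] V)) : frob κ K (Submodule.span K s) =
    Submodule.span K
      (LinearMap.rTensor V (FiniteField.frobeniusAlgHom κ K).toLinearMap '' s) := by
  refine le_antisymm (Submodule.span_le.mpr ?_)
    (Submodule.span_mono (Set.image_mono Submodule.subset_span))
  rintro _ ⟨x, hx, rfl⟩
  have h3 (a : K) (x : K ⊗[κ] V) :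
      LinearMap.rTensor V (FiniteField.frobeniusAlgHom κ K).toLinearMap (a • x) =
        a ^ Fintype.card κ •
          LinearMap.rTensor V (FiniteField.frobeniusAlgHom κ K).toLinearMap x := by
    induction x with
    | zero => simp
    | add x y h₁ h₂ => rw [smul_add, map_add, h₁, h₂, map_add, smul_add]
    | tmul b v => simp [TensorProduct.smul_tmul', mul_pow]
  rw [SetLike.mem_coe] at hx ⊢
  induction hx using Submodule.span_induction with
  | zero => simp
  | add x y _ _ h₁ h₂ => rw [map_add]; exact Submodule.add_mem _ h₁ h₂
  | mem x hx => exact Submodule.subset_span ⟨x, hx, rfl⟩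
  | smul a x _ h => rw [h3]; exact Submodule.smul_mem _ _ h

/-- The basis `f` is defined over `κ` and fixed by Frobenius, which acts on the matrix entries
alone. -/
theorem frob_graph : frob κ K (graph f S) = graph f (S.map (· ^ Fintype.card κ)) := by
  rw [graph, frob_span, graph, ← Set.range_comp]
  congr 2
  funext a
  simp [graphVec, TensorProduct.smul_tmul']

theorem frob_baseChange (U₀ : Submodule κ V) : frob κ K (U₀.baseChange K) = U₀.baseChange K := by
  rw [Submodule.baseChange_eq_span, frob_span]
  congr 1
  ext x
  simp

theorem exists_baseChange_eq_graph (h : S.map (· ^ Fintype.card κ) = S) :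
    ∃ U₀ : Submodule κ V, U₀.baseChange K = graph f S := by
  have h1 (a b) : ∃ s : κ, algebraMap κ K s = S a b :=
    exists_algebraMap_eq_of_pow_card_eq (congr_fun₂ h a b)
  choose s hs using h1
  refine ⟨Submodule.span κ (Set.range fun a ↦ f (.inl a) + ∑ b, s a b • f (.inr b)), ?_⟩
  rw [Submodule.baseChange_span, graph, ← Set.range_comp]
  congr 2
  funext a
  simp [graphVec, TensorProduct.tmul_add, TensorProduct.tmul_sum, ← hs, TensorProduct.smul_tmul',
    Algebra.smul_def]

/-! ### Hyperplanes in a graph -/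

end Graph

section Hyper

variable {κ : Type*} [Field κ] {K : Type u} [Field K] [Algebra κ K]
  {V : Type*} [AddCommGroup V] [Module κ V] {r : ℕ}
  (f : Module.Basis (Fin (r + 1) ⊕ Fin (r + 1)) κ V)

variable (K) in
/-- The first half of the coordinates, without the `i`-th one. -/
def xCoordNe (i : Fin (r + 1)) (k : Fin r) : Module.Dual K (K ⊗[κ] V) := xCoord K f (i.succAbove k)

/-- A basis of `hyper f S i l`. -/
def hyperVec (S : Matrix (Fin (r + 1)) (Fin (r + 1)) K) (i : Fin (r + 1)) (l : Fin (r + 1) → K)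
    (k : Fin r) : K ⊗[κ] V :=
  graphVec f S (i.succAbove k) - l (i.succAbove k) • graphVec f S i

/-- The hyperplane in `graph f S` on which the linear form with coefficients `l` vanishes, if
`l i = 1`. -/
def hyper (S : Matrix (Fin (r + 1)) (Fin (r + 1)) K) (i : Fin (r + 1)) (l : Fin (r + 1) → K) :
    Submodule K (K ⊗[κ] V) :=
  Submodule.span K (Set.range (hyperVec f S i l))

variable (S : Matrix (Fin (r + 1)) (Fin (r + 1)) K) (i : Fin (r + 1)) (l : Fin (r + 1) → K)

theorem isDualBasis_hyperVec : IsDualBasis (xCoordNe K f i) (hyperVec f S i l) (hyper f S i l) := by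
  refine ⟨rfl, fun a k ↦ ?_⟩
  rw [xCoordNe, hyperVec, map_sub, map_smul, xCoord_graphVec, xCoord_graphVec, Matrix.one_apply,
    Matrix.one_apply_ne (Fin.succAbove_ne i k).symm, smul_zero, sub_zero, Matrix.one_apply]
  simp

theorem xCoord_hyperVec (k : Fin r) :
    xCoord K f i (hyperVec f S i l k) = -l (i.succAbove k) := by
  rw [hyperVec, map_sub, map_smul, xCoord_graphVec, xCoord_graphVec, Matrix.one_apply_eq,
    Matrix.one_apply_ne (Fin.succAbove_ne i k)]
  simp

theorem hyper_le_graph : hyper f S i l ≤ graph f S := by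
  refine Submodule.span_le.mpr ?_
  rintro _ ⟨k, rfl⟩
  exact Submodule.sub_mem _ (graphVec_mem f _) (Submodule.smul_mem _ _ (graphVec_mem f _))

variable {S i l}

/-- In row vectors the graph of `S'` is `y = x S'`. A spanning vector `hyperVec f S i l k` satisfies
this exactly when the row of `S' - S` with index `i.succAbove k` is the corresponding multiple of
row `i`; the condition for row `i` itself is empty since `l i = 1`. -/
theorem hyper_le_graph_iff {S' : Matrix (Fin (r + 1)) (Fin (r + 1)) K} (hl : l i = 1) :
    hyper f S i l ≤ graph f S' ↔ ∀ k j, (S' - S) k j = l k * (S' - S) i j := by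
  have h (k : Fin r) : hyperVec f S i l k ∈ graph f S' ↔
      ∀ j, (S' - S) (i.succAbove k) j = l (i.succAbove k) * (S' - S) i j := by
    rw [mem_graph_iff]
    refine forall_congr' fun j ↦ ?_
    simp only [hyperVec, map_sub, map_smul, xCoord_graphVec, yCoord_graphVec, Matrix.sub_apply,
      smul_eq_mul, sub_mul, mul_assoc, Finset.sum_sub_distrib, ← Finset.mul_sum,
      Matrix.one_apply, ite_mul, one_mul, zero_mul, Finset.sum_ite_eq, Finset.mem_univ, if_true]
    constructor <;> intro h <;> linear_combination -h
  rw [hyper, Submodule.span_le, Set.range_subset_iff]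
  constructor
  · intro h' k j
    induction k using Fin.succAboveCases i with
    | x => rw [hl, one_mul]
    | p k => exact (h k).mp (h' k) j
  · exact fun h' k ↦ (h k).mpr fun j ↦ h' _ j

theorem IsDualBasis.eq_hyper {U' : Submodule K (K ⊗[κ] V)} {w : Fin r → K ⊗[κ] V}
    (h : IsDualBasis (xCoordNe K f i) w U') (hU' : U' ≤ graph f S)
    (hl : ∀ k, l (i.succAbove k) = -xCoord K f i (w k)) : U' = hyper f S i l := by
  have : w = hyperVec f S i l := by
    funext k
    rw [← sub_eq_zero]
    refine (isDualBasis_graphVec f S).eq_zero (Submodule.sub_mem _ (hU' (h.mem k))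
      (hyper_le_graph f S i l ((isDualBasis_hyperVec f S i l).mem k))) fun j ↦ ?_
    rw [map_sub, sub_eq_zero]
    induction j using Fin.succAboveCases i with
    | x => rw [xCoord_hyperVec, hl, neg_neg]
    | p j => exact (h.2 k j).trans ((isDualBasis_hyperVec f S i l).2 k j).symm
  rw [← h.1, this, hyper]

/-- Among the `r + 1` coordinates, `r` suffice to separate the points of `U'`; an index which they
miss is the `i` of the chart. -/
theorem exists_isDualBasis_xCoordNe {U' : Submodule K (K ⊗[κ] V)} (hU' : U' ≤ graph f S)
    (hd : Module.finrank K U' = r) : ∃ i w, IsDualBasis (xCoordNe K f i) w U' := by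
  have : Module.Finite K (K ⊗[κ] V) := Module.Finite.of_basis (f.baseChange K)
  obtain ⟨J, hJ⟩ := exists_forall_eq_zero hd (x := xCoord K f) fun v hv h0 ↦
    (isDualBasis_graphVec f S).eq_zero (hU' hv) h0
  obtain ⟨i, hi⟩ : ∃ i, ∀ k, J k ≠ i := by
    by_contra! h
    simpa using Fintype.card_le_of_surjective J h
  refine ⟨i, exists_isDualBasis hd fun v hv h0 ↦ hJ v hv fun k ↦ ?_⟩
  obtain ⟨k', hk'⟩ := Fin.exists_succAbove_eq (hi k)
  rw [← hk']
  exact h0 k'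

/-- The matrices `S` and the linear forms `l` for which `hyper f S i l` is contained in the graphs
of `S` and `S'`. -/
theorem hyper_le_graph_iff_of_isSymm {S' : Matrix (Fin (r + 1)) (Fin (r + 1)) K}
    (hS : S.IsSymm) (hS' : S'.IsSymm) (hl : l i = 1) :
    hyper f S i l ≤ graph f S' ↔
      ∀ k j, (S' - S) k j = (S' - S) i i * (l k * l j) := by
  rw [hyper_le_graph_iff f hl]
  have hT : (S' - S).IsSymm := hS'.sub hS
  constructor
  · intro h k j
    rw [h k j, ← hT.apply, h j i]
    ring
  · intro h k j
    rw [h k j, h i j, hl]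
    ring

end Hyper

/-! ### Properness of projective space and regular functions on `K`-points -/

section RegularFunctions

variable {K : Type u} [Field K]

theorem algebraMap_zero_surjective (σ : Type) : Function.Surjective
    (algebraMap K (MvPolynomial.homogeneousSubmodule σ K 0)) := by
  rintro ⟨p, hp⟩
  obtain ⟨a, ha⟩ : ∃ a, p = MvPolynomial.C a :=
    ⟨_, MvPolynomial.totalDegree_eq_zero_iff_eq_C.mp (Nat.le_zero.mp
      ((MvPolynomial.mem_homogeneousSubmodule _ _).mp hp).totalDegree_le)⟩
  exact ⟨a, Subtype.ext ha.symm⟩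

instance (σ : Type) [Finite σ] : IsProper (projSpace K σ).hom := by
  have : IsScalarTower K (MvPolynomial.homogeneousSubmodule σ K 0) (MvPolynomial σ K) :=
    ⟨fun a b c ↦ smul_mul_assoc a (b : MvPolynomial σ K) c⟩
  have : Algebra.FiniteType (MvPolynomial.homogeneousSubmodule σ K 0) (MvPolynomial σ K) :=
    Algebra.FiniteType.of_restrictScalars_finiteType K _ _
  have : IsClosedImmersion (Spec.map (CommRingCat.ofHom
      (algebraMap K (MvPolynomial.homogeneousSubmodule σ K 0)))) :=
    IsClosedImmersion.spec_of_surjective _ (algebraMap_zero_surjective σ)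
  exact inferInstanceAs (IsProper (Proj.toSpecZero _ ≫ Spec.map _))

instance {X : SchOver K} (T : Set (KPoint X)) [IsProper X.hom] :
    IsProper (subvariety X T).hom :=
  inferInstanceAs (IsProper (Scheme.IdealSheafData.subschemeι _ ≫ X.hom))

instance {X Y : SchOver K} [IsProper Y.hom] : IsProper (prodFst X Y).left :=
  inferInstanceAs (IsProper (pullback.fst X.hom Y.hom))

/-- The functions on the `K`-points of `X` which are given by global sections. -/
def regularFun (X : SchOver K) : Subring (KPoint X → K) :=
  RingHom.range (RingHom.pi fun x : KPoint X ↦ val x)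

variable {X Y : SchOver K}

theorem mem_regularFun {φ : KPoint X → K} :
    φ ∈ regularFun X ↔ ∃ s : Γ(X.left, ⊤), ∀ x, val x s = φ x :=
  ⟨fun ⟨s, hs⟩ ↦ ⟨s, fun x ↦ congr_fun hs x⟩, fun ⟨s, hs⟩ ↦ ⟨s, funext hs⟩⟩

theorem const_mem_regularFun (a : K) : (fun _ ↦ a) ∈ regularFun X :=
  mem_regularFun.mpr ⟨scalarHom X a, fun x ↦ val_scalarHom x a⟩

theorem val_mem_regularFun (s : Γ(X.left, ⊤)) : (fun x ↦ val x s) ∈ regularFun X :=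
  mem_regularFun.mpr ⟨s, fun _ ↦ rfl⟩

theorem comp_mem_regularFun {φ : KPoint Y → K} (hφ : φ ∈ regularFun Y) (f : X ⟶ Y) :
    (fun x : KPoint X ↦ φ (x ≫ f)) ∈ regularFun X := by
  obtain ⟨s, hs⟩ := mem_regularFun.mp hφ
  exact mem_regularFun.mpr ⟨f.left.appTop s, fun x ↦ by rw [← val_comp, hs]⟩

theorem add_mem_regularFun {φ ψ : KPoint X → K} (hφ : φ ∈ regularFun X) (hψ : ψ ∈ regularFun X) :
    (fun x ↦ φ x + ψ x) ∈ regularFun X := add_mem hφ hψ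

theorem sub_mem_regularFun {φ ψ : KPoint X → K} (hφ : φ ∈ regularFun X) (hψ : ψ ∈ regularFun X) :
    (fun x ↦ φ x - ψ x) ∈ regularFun X := sub_mem hφ hψ

theorem neg_mem_regularFun {φ : KPoint X → K} (hφ : φ ∈ regularFun X) :
    (fun x ↦ -φ x) ∈ regularFun X := neg_mem hφ

theorem mul_mem_regularFun {φ ψ : KPoint X → K} (hφ : φ ∈ regularFun X) (hψ : ψ ∈ regularFun X) :
    (fun x ↦ φ x * ψ x) ∈ regularFun X := mul_mem hφ hψ

theorem pow_mem_regularFun {φ : KPoint X → K} (hφ : φ ∈ regularFun X) (n : ℕ) :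
    (fun x ↦ φ x ^ n) ∈ regularFun X := pow_mem hφ n

theorem sum_mem_regularFun {ι : Type*} {s : Finset ι} {φ : ι → KPoint X → K}
    (hφ : ∀ i, φ i ∈ regularFun X) : (fun x ↦ ∑ i ∈ s, φ i x) ∈ regularFun X := by
  have := sum_mem (S := regularFun X) (t := s) fun i _ ↦ hφ i
  convert this
  rw [Finset.sum_apply]

theorem det_mem_regularFun {n : Type*} [Fintype n] [DecidableEq n] {φ : n → n → KPoint X → K}
    (hφ : ∀ a b, φ a b ∈ regularFun X) :
    (fun x ↦ Matrix.det (Matrix.of fun a b ↦ φ a b x)) ∈ regularFun X := by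
  choose s hs using fun a b ↦ mem_regularFun.mp (hφ a b)
  refine mem_regularFun.mpr ⟨Matrix.det (Matrix.of s), fun x ↦ ?_⟩
  rw [RingHom.map_det]
  congr 1
  ext a b
  exact hs a b x

/-- The open subset on which a regular function does not vanish. -/
theorem exists_opens_of_regularFun {φ : KPoint X → K} (hφ : φ ∈ regularFun X) :
    ∃ U : X.left.Opens, ∀ x : KPoint X, x.pt ∈ U ↔ φ x ≠ 0 := by
  obtain ⟨s, hs⟩ := mem_regularFun.mp hφ
  exact ⟨X.left.basicOpen s, fun x ↦ by rw [pt_mem_basicOpen_iff, hs]⟩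

theorem isClosedKPoints_of_regularFun [LocallyOfFiniteType X.hom] {T : Set (KPoint X)}
    (h : ∀ x : KPoint X, x ∉ T → ∃ (U : X.left.Opens) (φ : KPoint (openSub X U) → K),
      x.pt ∈ U ∧ φ ∈ regularFun (openSub X U) ∧
      (∀ d, d ≫ openSubι X U = x → φ d ≠ 0) ∧
      ∀ d : KPoint (openSub X U), (d ≫ openSubι X U : KPoint X) ∈ T → φ d = 0) :
    IsClosedKPoints T := by
  refine isClosedKPoints_of_local fun x hx ↦ ?_
  obtain ⟨U, φ, hxU, hφ, h1, h2⟩ := h x hx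
  obtain ⟨s, hs⟩ := mem_regularFun.mp hφ
  obtain ⟨d, hd⟩ := exists_kPoint_lift (openSubι X U) x ((range_openSubι U).ge hxU)
  exact ⟨_, openSubι X U, inferInstance, d, s, hd, by rw [hs]; exact h1 d hd,
    fun d' hd' ↦ by rw [hs]; exact h2 d' hd'⟩

theorem pt_mem_of_openSub {U : X.left.Opens} (d : KPoint (openSub X U)) :
    KPoint.pt (d ≫ openSubι X U : KPoint X) ∈ U := by
  rw [KPoint.pt_comp]
  exact (range_openSubι U).le ⟨_, rfl⟩

variable [IsAlgClosed K]

/-- A nowhere vanishing function has a regular inverse. -/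
theorem inv_mem_regularFun [LocallyOfFiniteType X.hom] {φ : KPoint X → K}
    (hφ : φ ∈ regularFun X) (h0 : ∀ x, φ x ≠ 0) : (fun x ↦ (φ x)⁻¹) ∈ regularFun X := by
  obtain ⟨s, hs⟩ := mem_regularFun.mp hφ
  have hu : X.left.basicOpen s = ⊤ := opens_eq_top_of_kPoint fun x ↦ by
    rw [pt_mem_basicOpen_iff, hs]
    exact h0 x
  have key (U : X.left.Opens) (hU : U ≤ ⊤) (hU' : U = ⊤)
      (h : IsUnit (X.left.presheaf.map (homOfLE hU).op s)) : IsUnit s := by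
    subst hU'
    have h1 : X.left.presheaf.map (homOfLE hU).op = 𝟙 _ := X.left.presheaf.map_id _
    rwa [h1] at h
  obtain ⟨t, ht⟩ := (key _ le_top hu
    (X.left.toRingedSpace.isUnit_res_basicOpen s)).exists_right_inv
  refine mem_regularFun.mpr ⟨t, fun x ↦ ?_⟩
  refine eq_inv_of_mul_eq_one_right ?_
  rw [← hs x, ← map_mul, ht, map_one]

/-- The image of a closed set of `K`-points under a closed morphism is closed. -/
theorem IsClosedKPoints.image [LocallyOfFiniteType X.hom] [LocallyOfFiniteType Y.hom]
    {T : Set (KPoint X)} (hT : IsClosedKPoints T) (f : X ⟶ Y) [IsProper f.left] :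
    IsClosedKPoints ((fun x : KPoint X ↦ (x ≫ f : KPoint Y)) '' T) := by
  intro y hy
  have hcl : IsClosed (f.left '' closure (KPoint.pt '' T)) :=
    f.left.isClosedMap _ isClosed_closure
  have h1 : y.pt ∈ f.left '' closure (KPoint.pt '' T) := by
    refine closure_minimal ?_ hcl hy
    rintro _ ⟨_, ⟨x, hx, rfl⟩, rfl⟩
    exact ⟨x.pt, subset_closure ⟨x, hx, rfl⟩, rfl⟩
  obtain ⟨p, hp, hpy⟩ := h1
  have h2 : IsClosed (closure (KPoint.pt '' T) ∩ f.left ⁻¹' {y.pt}) :=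
    isClosed_closure.inter (y.isClosed_pt.preimage f.left.continuous)
  obtain ⟨x, hx, hx'⟩ := exists_kPoint_of_isLocallyClosed h2.isLocallyClosed ⟨p, hp, hpy⟩
  exact ⟨x, hT x hx, KPoint.ext_of_pt hx'⟩

end RegularFunctions

/-! ### Points, charts and morphisms of Grassmannians -/

section Grassmannian

variable {κ : Type*} [Field κ] {K : Type u} [Field K] [Algebra κ K]
  {V : Type*} [AddCommGroup V] [Module κ V] {n : ℕ} (e : Module.Basis (Fin n) κ V) {i : ℕ}

instance : LocallyOfFiniteType (Gr K e i).hom :=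
  inferInstanceAs (LocallyOfFiniteType (subvariety _ _).hom)

instance : IsSeparated (Gr K e i).hom := inferInstanceAs (IsSeparated (subvariety _ _).hom)

instance : IsProper (Gr K e i).hom := inferInstanceAs (IsProper (subvariety _ _).hom)

instance : Mono (Gr.ι K e i) := inferInstanceAs (Mono (subvarietyι _ _))

variable {e} {x : KPoint (Gr K e i)} {U : Submodule K (K ⊗[κ] V)}

theorem Gr.IsPoint.eq {U' : Submodule K (K ⊗[κ] V)} (h : Gr.IsPoint K e x U)
    (h' : Gr.IsPoint K e x U') : U = U' := by
  obtain ⟨hU, h⟩ := h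
  obtain ⟨hU', h'⟩ := h'
  exact pluckerPoint_injective _ (h.symm.trans h')

theorem Gr.IsPoint.point_eq {x' : KPoint (Gr K e i)} (h : Gr.IsPoint K e x U)
    (h' : Gr.IsPoint K e x' U) : x = x' := by
  obtain ⟨hU, h⟩ := h
  obtain ⟨hU', h'⟩ := h'
  exact (cancel_mono (Gr.ι K e i)).mp (h.trans h'.symm)

/-- The open subset of the Grassmannian of all subspaces on which the functionals `F` are
a basis of the dual space. -/
def Gr.dualOpen (e : Module.Basis (Fin n) κ V) (F : Fin i → Module.Dual K (K ⊗[κ] V)) :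
    (Gr K e i).left.Opens :=
  (Gr.ι K e i).left ⁻¹ᵁ Proj.basicOpen (MvPolynomial.homogeneousSubmodule (Fin i → Fin n) K)
    (pluckerForm (e.baseChange K) F)

/-- Up to a nonzero scalar, the form evaluates to the determinant of `F` on a basis of `U`. Its
nonvanishing locus is the chart of subspaces with a basis dual to `F`. -/
theorem eval_pluckerForm_ne_zero_iff {F : Fin i → Module.Dual K (K ⊗[κ] V)}
    (hU : Module.finrank K U = i) {v : (Fin i → Fin n) → K} {hv : v ≠ 0}
    (h : pluckerPoint (e.baseChange K) U hU = projPoint v hv) :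
    MvPolynomial.eval v (pluckerForm (e.baseChange K) F) ≠ 0 ↔ ∃ w, IsDualBasis F w U := by
  constructor
  · intro hF
    obtain ⟨w, hw, hw', -⟩ := exists_normalized_basis (e.baseChange K) hU h hF
    exact ⟨w, hw, hw'⟩
  · rintro ⟨w, hw⟩
    have h0 := minors_ne_zero _ (equivFun_linearIndependent (e.baseChange K) hw.linearIndependent)
    rw [pluckerPoint_eq (e.baseChange K) hU hw.1 h0] at h
    obtain ⟨c, hc, rfl⟩ := (projPoint_eq_iff _ _).mp h
    rw [eval_pluckerForm_smul, eval_pluckerForm_minors]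
    have : (Matrix.of fun a k ↦ F k (w a)) = 1 := by ext a k; exact hw.2 a k
    rw [this, Matrix.det_one, mul_one]
    exact hc

theorem Gr.pt_mem_dualOpen_iff {F : Fin i → Module.Dual K (K ⊗[κ] V)} (h : Gr.IsPoint K e x U) :
    x.pt ∈ Gr.dualOpen e F ↔ ∃ w, IsDualBasis F w U := by
  obtain ⟨hU, h⟩ := h
  have h0 := minors_ne_zero _ (coordMatrix_linearIndependent (e.baseChange K) U hU)
  rw [← eval_pluckerForm_ne_zero_iff (hv := h0) hU rfl,
    ← projPoint_mem_basicOpen_iff _ h0 (pluckerForm_mem _ _) one_pos]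
  exact iff_of_eq (congr_arg (fun y : KPoint (projSpace K (Fin i → Fin n)) ↦ y.pt ∈
    Proj.basicOpen (MvPolynomial.homogeneousSubmodule (Fin i → Fin n) K)
      (pluckerForm (e.baseChange K) F)) h)

theorem exists_isDualBasis_coord (e : Module.Basis (Fin n) κ V) (hU : Module.finrank K U = i) :
    ∃ (F : Fin i → Module.Dual K (K ⊗[κ] V)) (w : _), IsDualBasis F w U := by
  have : Module.Finite K (K ⊗[κ] V) := Module.Finite.of_basis (e.baseChange K)
  obtain ⟨J, hJ⟩ := exists_forall_eq_zero hU (x := fun c ↦ (e.baseChange K).coord c)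
    fun v _ h0 ↦ (e.baseChange K).ext_elem fun c ↦ (h0 c).trans (by simp)
  exact ⟨_, exists_isDualBasis hU hJ⟩

variable [IsAlgClosed K]

theorem Gr.exists_isPoint (x : KPoint (Gr K e i)) : ∃ U, Gr.IsPoint K e x U :=
  (isClosedKPoints_pluckerPoint (e.baseChange K)).mem x

theorem Gr.exists_point (e : Module.Basis (Fin n) κ V) (hU : Module.finrank K U = i) :
    ∃ x : KPoint (Gr K e i), Gr.IsPoint K e x U := by
  obtain ⟨y, hy⟩ := exists_kPoint_subvariety (X := projSpace K (Fin i → Fin n))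
    (T := {x | ∃ (U : Submodule K (K ⊗[κ] V)) (hU : Module.finrank K U = i),
      x = pluckerPoint (e.baseChange K) U hU}) ⟨U, hU, rfl⟩
  exact ⟨y, hU, hy⟩

variable {X : SchOver K} [LocallyOfFiniteType X.hom]

/-- Coordinates of normalized bases are regular functions. -/
theorem Gr.coord_mem_regularFun (f : X ⟶ Gr K e i) {F : Fin i → Module.Dual K (K ⊗[κ] V)}
    {w : KPoint X → Fin i → K ⊗[κ] V} {U : KPoint X → Submodule K (K ⊗[κ] V)}
    (hU : ∀ x : KPoint X, Gr.IsPoint K e (x ≫ f) (U x)) (hw : ∀ x, IsDualBasis F (w x) (U x))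
    (a : Fin i) (q : Module.Dual K (K ⊗[κ] V)) : (fun x ↦ q (w x a)) ∈ regularFun X := by
  have hne (x : KPoint X) v hv (h : x ≫ f ≫ Gr.ι K e i = projPoint v hv) :
      MvPolynomial.eval v (pluckerForm (e.baseChange K) F) ≠ 0 := by
    obtain ⟨hd, h'⟩ := hU x
    refine (eval_pluckerForm_ne_zero_iff (hv := hv) hd ?_).mpr ⟨_, hw x⟩
    rw [← h', ← h, Category.assoc]
  obtain ⟨s, hs⟩ := exists_section_div (f ≫ Gr.ι K e i) one_pos (pluckerForm_mem _ F)
    (pluckerForm_mem _ (Function.update F a q)) hne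
  refine mem_regularFun.mpr ⟨s, fun x ↦ ?_⟩
  obtain ⟨hd, h'⟩ := hU x
  obtain ⟨v, hv, hvx⟩ := exists_eq_projPoint (x ≫ f ≫ Gr.ι K e i)
  have h0 := hne x v hv hvx
  have h1 : pluckerPoint (e.baseChange K) (U x) hd = projPoint v hv := by
    rw [← h', ← hvx, Category.assoc]
  obtain ⟨w', hw', hw'', -, h2⟩ := exists_normalized_basis (e.baseChange K) hd h1 h0
  have h3 : w' = w x := (hw x).unique ⟨hw', hw''⟩
  refine mul_right_cancel₀ h0 ((hs x v hv hvx).trans ?_)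
  rw [← h2, h3]

/-- A morphism to the Grassmannian from a family of vectors whose coordinates are regular. -/
theorem Gr.exists_hom [IsAffine X.left] [IsReduced X.left] (e : Module.Basis (Fin n) κ V)
    (w : KPoint X → Fin i → K ⊗[κ] V)
    (hw : ∀ a c, (fun x ↦ (e.baseChange K).coord c (w x a)) ∈ regularFun X)
    (hli : ∀ x, LinearIndependent K (w x)) :
    ∃ f : X ⟶ Gr K e i, ∀ x : KPoint X,
      Gr.IsPoint K e (x ≫ f) (Submodule.span K (Set.range (w x))) := by
  have hm (J : Fin i → Fin n) :
      (fun x ↦ minors (fun a ↦ (e.baseChange K).equivFun (w x a)) J) ∈ regularFun X :=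
    det_mem_regularFun fun a b ↦ hw a (J b)
  choose s hs using fun J ↦ mem_regularFun.mp (hm J)
  have hs' (x : KPoint X) : (fun J ↦ val x (s J)) =
      minors (fun a ↦ (e.baseChange K).equivFun (w x a)) := funext fun J ↦ hs J x
  have h0 (x : KPoint X) : (fun J ↦ val x (s J)) ≠ 0 := by
    rw [hs']
    exact minors_ne_zero _ (equivFun_linearIndependent (e.baseChange K) (hli x))
  obtain ⟨g, hg⟩ := exists_hom_projSpace s fun x ↦ Function.ne_iff.mp (h0 x)
  have hd (x : KPoint X) : Module.finrank K (Submodule.span K (Set.range (w x))) = i := by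
    rw [finrank_span_eq_card (hli x), Fintype.card_fin]
  have hgx (x : KPoint X) : x ≫ g = pluckerPoint (e.baseChange K) _ (hd x) := by
    rw [hg x (h0 x), pluckerPoint_eq (e.baseChange K) (hd x) rfl (hs' x ▸ h0 x)]
    congr 1
    exact hs' x
  obtain ⟨f, hf⟩ := exists_lift_subvariety {x | ∃ (U : Submodule K (K ⊗[κ] V))
    (hU : Module.finrank K U = i), x = pluckerPoint (e.baseChange K) U hU} g
    fun x ↦ ⟨_, hd x, hgx x⟩
  refine ⟨f, fun x ↦ ⟨hd x, ?_⟩⟩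
  rw [← hgx, ← hf]
  exact Category.assoc x f (subvarietyι _ _)

end Grassmannian

/-! ### The Lagrangian Grassmannian -/

section LV

variable {κ : Type*} [Field κ] {K : Type u} [Field K] [Algebra κ K]
  {V : Type*} [AddCommGroup V] [Module κ V] {n : ℕ} {e : Module.Basis (Fin n) κ V}
  {ω : LinearMap.BilinForm κ V} {m : ℕ}

instance : LocallyOfFiniteType (LV K e ω m).hom :=
  inferInstanceAs (LocallyOfFiniteType (subvariety _ _).hom)

instance : IsSeparated (LV K e ω m).hom := inferInstanceAs (IsSeparated (subvariety _ _).hom)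

instance : IsProper (LV K e ω m).hom := inferInstanceAs (IsProper (subvariety _ _).hom)

instance : Mono (LV.ι K e ω m) := inferInstanceAs (Mono (subvarietyι _ _))

theorem LV.IsPoint.eq {x : KPoint (LV K e ω m)} {U U' : Submodule K (K ⊗[κ] V)}
    (h : LV.IsPoint K e x U) (h' : LV.IsPoint K e x U') : U = U' :=
  Gr.IsPoint.eq h h'

theorem LV.IsPoint.point_eq {x x' : KPoint (LV K e ω m)} {U : Submodule K (K ⊗[κ] V)}
    (h : LV.IsPoint K e x U) (h' : LV.IsPoint K e x' U) : x = x' :=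
  (cancel_mono (LV.ι K e ω m)).mp (Gr.IsPoint.point_eq h h')

theorem IsDualBasis.isLagrangian_iff {F : Fin m → Module.Dual K (K ⊗[κ] V)}
    {w : Fin m → K ⊗[κ] V} {U : Submodule K (K ⊗[κ] V)} (h : IsDualBasis F w U) :
    IsLagrangian K ω m U ↔
      ∀ a b, LinearMap.BilinForm.baseChange K ω (w a) (w b) = 0 := by
  refine ⟨fun hU a b ↦ hU.2 _ (h.mem a) _ (h.mem b), fun hw ↦ ⟨h.finrank_eq, fun x hx y hy ↦ ?_⟩⟩
  rw [h.eq_sum hx, h.eq_sum hy]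
  simp [hw]

variable [IsAlgClosed K]

/-- On the chart of subspaces with a basis dual to `F`, isotropy means that the pairings of the
basis vectors vanish, and these are polynomials in regular coordinates. -/
theorem isClosedKPoints_isLagrangian (e : Module.Basis (Fin n) κ V) (ω : LinearMap.BilinForm κ V)
    (m : ℕ) : IsClosedKPoints {x : KPoint (Gr K e m) |
      ∃ U : Submodule K (K ⊗[κ] V), IsLagrangian K ω m U ∧ Gr.IsPoint K e x U} := by
  refine isClosedKPoints_of_regularFun fun x hx ↦ ?_
  obtain ⟨U, hU⟩ := Gr.exists_isPoint x
  obtain ⟨F, w₀, hw₀⟩ := exists_isDualBasis_coord e hU.1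
  have hnot : ¬ IsLagrangian K ω m U := fun h ↦ hx ⟨U, h, hU⟩
  rw [hw₀.isLagrangian_iff] at hnot
  push Not at hnot
  obtain ⟨a, b, hab⟩ := hnot
  let j := openSubι (Gr K e m) (Gr.dualOpen e F)
  choose U' hU' using fun d : KPoint (openSub (Gr K e m) (Gr.dualOpen e F)) ↦
    Gr.exists_isPoint (d ≫ j)
  choose w hw using fun d ↦ (Gr.pt_mem_dualOpen_iff (hU' d)).mp (pt_mem_of_openSub d)
  refine ⟨Gr.dualOpen e F, fun d ↦ LinearMap.BilinForm.baseChange K ω (w d a) (w d b),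
    (Gr.pt_mem_dualOpen_iff hU).mpr ⟨w₀, hw₀⟩, ?_, fun d hd ↦ ?_, fun d ⟨U₁, hL, hU₁⟩ ↦ ?_⟩
  · have h (d) : LinearMap.BilinForm.baseChange K ω (w d a) (w d b) =
        ∑ c, (e.baseChange K).coord c (w d a) *
          LinearMap.BilinForm.baseChange K ω (e.baseChange K c) (w d b) := by
      conv_lhs => rw [← (e.baseChange K).sum_repr (w d a)]
      simp
    simp only [h]
    exact sum_mem_regularFun fun c ↦ mul_mem_regularFun
      (Gr.coord_mem_regularFun j hU' hw a _) (Gr.coord_mem_regularFun j hU' hw b _)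
  · have h1 : U' d = U := (hU' d).eq (by rw [hd]; exact hU)
    have h2 : w d = w₀ := hw₀.unique (h1 ▸ hw d)
    simpa only [h2] using hab
  · have h1 : U' d = U₁ := (hU' d).eq hU₁
    exact (hw d).isLagrangian_iff.mp (h1 ▸ hL) a b

theorem LV.exists_isPoint (x : KPoint (LV K e ω m)) :
    ∃ U, IsLagrangian K ω m U ∧ LV.IsPoint K e x U :=
  (isClosedKPoints_isLagrangian e ω m).mem x

theorem LV.exists_lift {X : SchOver K} [LocallyOfFiniteType X.hom] [IsReduced X.left]
    (f : X ⟶ Gr K e m) (h : ∀ x : KPoint X, ∃ U, IsLagrangian K ω m U ∧ Gr.IsPoint K e (x ≫ f) U) :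
    ∃ g : X ⟶ LV K e ω m, g ≫ LV.ι K e ω m = f :=
  exists_lift_subvariety _ f h

theorem LV.exists_point (e : Module.Basis (Fin n) κ V) {U : Submodule K (K ⊗[κ] V)}
    (hU : IsLagrangian K ω m U) : ∃ x : KPoint (LV K e ω m), LV.IsPoint K e x U := by
  obtain ⟨x, hx⟩ := Gr.exists_point e hU.1
  obtain ⟨y, hy⟩ := exists_kPoint_subvariety (T := {x : KPoint (Gr K e m) |
    ∃ U : Submodule K (K ⊗[κ] V), IsLagrangian K ω m U ∧ Gr.IsPoint K e x U}) ⟨U, hU, hx⟩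
  exact ⟨y, by rw [← hy] at hx; exact hx⟩

end LV

/-! ### Points of `Y_V` and `S_V`, and the projection -/

section YV

variable {κ : Type*} [Field κ] [Fintype κ] {K : Type u} [Field K] [Algebra κ K]
  {V : Type*} [AddCommGroup V] [Module κ V] {n : ℕ} {e : Module.Basis (Fin n) κ V}
  {ω : LinearMap.BilinForm κ V} {m : ℕ}

instance : LocallyOfFiniteType (YV K e ω m).hom :=
  inferInstanceAs (LocallyOfFiniteType (subvariety _ _).hom)

instance : IsSeparated (YV K e ω m).hom := inferInstanceAs (IsSeparated (subvariety _ _).hom)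

instance : IsReduced (YV K e ω m).left := inferInstanceAs (IsReduced (subvariety _ _).left)

instance : Mono (YV.ι K e ω m) := inferInstanceAs (Mono (subvarietyι _ _))

instance : LocallyOfFiniteType (SV K e ω m).hom :=
  inferInstanceAs (LocallyOfFiniteType (subvariety _ _).hom)

instance : IsSeparated (SV K e ω m).hom := inferInstanceAs (IsSeparated (subvariety _ _).hom)

instance : IsReduced (SV K e ω m).left := inferInstanceAs (IsReduced (subvariety _ _).left)

instance : Mono (SV.ι K e ω m) := inferInstanceAs (Mono (subvarietyι _ _))

theorem SV.IsPoint.eq {x : KPoint (SV K e ω m)} {U U' : Submodule K (K ⊗[κ] V)}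
    (h : SV.IsPoint K e x U) (h' : SV.IsPoint K e x U') : U = U' :=
  LV.IsPoint.eq h h'

theorem SV.IsPoint.point_eq {x x' : KPoint (SV K e ω m)} {U : Submodule K (K ⊗[κ] V)}
    (h : SV.IsPoint K e x U) (h' : SV.IsPoint K e x' U) : x = x' :=
  (cancel_mono (SV.ι K e ω m)).mp (LV.IsPoint.point_eq h h')

theorem YV.IsPoint.point_eq {y y' : KPoint (YV K e ω m)} {U U' : Submodule K (K ⊗[κ] V)}
    (h : YV.IsPoint K e y U U') (h' : YV.IsPoint K e y' U U') : y = y' :=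
  (cancel_mono (YV.ι K e ω m)).mp (prod_hom_ext
    ((Category.assoc _ _ _).trans ((h.1.point_eq h'.1).trans (Category.assoc _ _ _).symm))
    ((Category.assoc _ _ _).trans ((h.2.point_eq h'.2).trans (Category.assoc _ _ _).symm)))

theorem YV.IsPoint.eq {y : KPoint (YV K e ω m)} {U U' U₁ U₁' : Submodule K (K ⊗[κ] V)}
    (h : YV.IsPoint K e y U U') (h' : YV.IsPoint K e y U₁ U₁') : U = U₁ ∧ U' = U₁' :=
  ⟨h.1.eq h'.1, h.2.eq h'.2⟩

variable (K e ω m) in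
/-- The set of points of `L_V × Gr(m - 1, V)` which defines `Y_V`. -/
abbrev flagPoints : Set (KPoint (prodOver (LV K e ω m) (Gr K e (m - 1)))) :=
  {y | ∃ U U' : Submodule K (K ⊗[κ] V), IsLagrangian K ω m U ∧
      Module.finrank K U' = m - 1 ∧ U' ≤ U ⊓ frob κ K U ∧
      LV.IsPoint K e (y ≫ prodFst _ _) U ∧ Gr.IsPoint K e (y ≫ prodSnd _ _) U'}

theorem exists_le_finrank_eq {W : Type*} [AddCommGroup W] [Module K W]
    (U : Submodule K W) [Module.Finite K U] {d : ℕ} (h : d ≤ Module.finrank K U) :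
    ∃ U' ≤ U, Module.finrank K U' = d := by
  let b := Module.finBasis K U
  let w : Fin d → W := fun a ↦ b (Fin.castLE h a)
  have hli : LinearIndependent K w :=
    (b.linearIndependent.comp _ (Fin.castLE_injective h)).map' U.subtype (Submodule.ker_subtype U)
  refine ⟨Submodule.span K (Set.range w), Submodule.span_le.mpr ?_, ?_⟩
  · rintro _ ⟨a, rfl⟩
    exact Subtype.property _
  · rw [finrank_span_eq_card hli, Fintype.card_fin]

variable [IsAlgClosed K]

/-- Near a given pair, `U` is the graph of a matrix `S` with regular entries and `U'` has a basis
with regular coordinates. The inclusions of `U'` in `U` and in `Φ(U)` are the equations `y = x S`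
and `y = x S^(q)` on that basis, so Frobenius enters only through `q`-th powers of regular
functions. -/
theorem isClosedKPoints_flag (e : Module.Basis (Fin n) κ V) (hn : n = 2 * m) (hω : ω.IsAlt)
    (hω' : ω.Nondegenerate) :
    IsClosedKPoints (flagPoints K e ω m) := by
  have : Module.Finite κ V := Module.Finite.of_basis e
  have hV : Module.finrank κ V = 2 * m := by
    rw [Module.finrank_eq_card_basis e, Fintype.card_fin, hn]
  refine isClosedKPoints_of_regularFun fun y hy ↦ ?_
  obtain ⟨U₀, hUL, hU₀⟩ := LV.exists_isPoint (y ≫ prodFst _ _)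
  obtain ⟨U₀', hU₀'⟩ := Gr.exists_isPoint (y ≫ prodSnd _ _)
  obtain ⟨f, hf, hfU⟩ := exists_symplecticBasis K hV hω hω' hUL
  obtain ⟨S₀, rfl⟩ := exists_eq_graph f hUL.1 hfU
  obtain ⟨F, w₀', hw₀'⟩ := exists_isDualBasis_coord e hU₀'.1
  have hnot : ¬ U₀' ≤ graph f S₀ ⊓ frob κ K (graph f S₀) :=
    fun h ↦ hy ⟨_, _, hUL, hU₀'.1, h, hU₀, hU₀'⟩
  rw [frob_graph, le_inf_iff, not_and_or] at hnot
  let p₁ := prodFst (LV K e ω m) (Gr K e (m - 1))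
  let p₂ := prodSnd (LV K e ω m) (Gr K e (m - 1))
  let D := (p₁ ≫ LV.ι K e ω m).left ⁻¹ᵁ Gr.dualOpen e (xCoord K f) ⊓ p₂.left ⁻¹ᵁ Gr.dualOpen e F
  let j := openSubι _ D
  choose U hUL' hU using fun d : KPoint (openSub _ D) ↦ LV.exists_isPoint ((d ≫ j) ≫ p₁)
  choose U' hU' using fun d : KPoint (openSub _ D) ↦ Gr.exists_isPoint ((d ≫ j) ≫ p₂)
  have hw (d) : ∃ w, IsDualBasis (xCoord K f) w (U d) :=
    (Gr.pt_mem_dualOpen_iff (hU d)).mp (pt_mem_of_openSub d).1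
  choose w hw using hw
  have hw' (d) : ∃ w, IsDualBasis F w (U' d) :=
    (Gr.pt_mem_dualOpen_iff (hU' d)).mp (pt_mem_of_openSub d).2
  choose w' hw' using hw'
  have hyD : y.pt ∈ D := ⟨(Gr.pt_mem_dualOpen_iff hU₀).mpr ⟨_, isDualBasis_graphVec f S₀⟩,
    (Gr.pt_mem_dualOpen_iff hU₀').mpr ⟨_, hw₀'⟩⟩
  have hUS (d) := (hw d).eq_graph f
  have hreg (a) (q : Module.Dual K (K ⊗[κ] V)) : (fun d ↦ q (w d a)) ∈ regularFun (openSub _ D) :=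
    Gr.coord_mem_regularFun (e := e) (j ≫ p₁ ≫ LV.ι K e ω m) (U := U)
      (fun d ↦ by simpa [LV.IsPoint, Category.assoc] using hU d) hw a q
  have hreg' (a) (q : Module.Dual K (K ⊗[κ] V)) : (fun d ↦ q (w' d a)) ∈ regularFun (openSub _ D) :=
    Gr.coord_mem_regularFun (e := e) (j ≫ p₂) (U := U')
      (fun d ↦ by simpa [Category.assoc] using hU' d) hw' a q
  have h0 (d) (hd : d ≫ j = y) : U d = graph f S₀ ∧ w d = graphVec f S₀ ∧ w' d = w₀' := by
    have h1 : U d = graph f S₀ := (hU d).eq (by rw [hd]; exact hU₀)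
    have h2 : U' d = U₀' := (hU' d).eq (by rw [hd]; exact hU₀')
    exact ⟨h1, (isDualBasis_graphVec f S₀).unique (h1 ▸ hw d), hw₀'.unique (h2 ▸ hw' d)⟩
  have h1 (d : KPoint (openSub _ D)) (hd : (d ≫ openSubι _ D) ∈ flagPoints K e ω m) :
      ∀ a, w' d a ∈ U d ∧ w' d a ∈ frob κ K (U d) := by
    obtain ⟨U₁, U₁', -, -, hle, hU₁, hU₁'⟩ := hd
    have h1 : U d = U₁ := (hU d).eq hU₁
    have h2 : U' d = U₁' := (hU' d).eq hU₁'
    intro a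
    have := hle (h2 ▸ (hw' d).mem a)
    rwa [h1]
  -- Handles both inclusions at once: `φ` is the identity for `U` and the `q`-th power map for
  -- `Φ(U)`.
  have key (φ : K → K) (hφ : ∀ a b, (fun d ↦ φ (yCoord K f b (w d a))) ∈ regularFun (openSub _ D))
      (hnot : ¬ U₀' ≤ graph f (S₀.map φ))
      (hv : ∀ d : KPoint (openSub _ D), (d ≫ openSubι _ D) ∈ flagPoints K e ω m →
        ∀ a, w' d a ∈ graph f (Matrix.of fun a b ↦ φ (yCoord K f b (w d a)))) :
      ∃ (U : (prodOver (LV K e ω m) (Gr K e (m - 1))).left.Opens)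
        (φ : KPoint (openSub _ U) → K), y.pt ∈ U ∧ φ ∈ regularFun (openSub _ U) ∧
        (∀ d, d ≫ openSubι _ U = y → φ d ≠ 0) ∧
        ∀ d : KPoint (openSub _ U), (d ≫ openSubι _ U) ∈ flagPoints K e ω m →
          φ d = 0 := by
    rw [← hw₀'.1, Submodule.span_le, Set.range_subset_iff] at hnot
    push Not at hnot
    obtain ⟨a, ha⟩ := hnot
    rw [SetLike.mem_coe, mem_graph_iff] at ha
    push Not at ha
    obtain ⟨b, hb⟩ := ha
    refine ⟨D, fun d ↦ yCoord K f b (w' d a) -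
      ∑ c, xCoord K f c (w' d a) * φ (yCoord K f b (w d c)), hyD, ?_, fun d hd ↦ ?_, fun d hd ↦ ?_⟩
    · exact sub_mem_regularFun (hreg' a _) (sum_mem_regularFun fun c ↦
        mul_mem_regularFun (hreg' a _) (hφ c b))
    · obtain ⟨-, h2, h3⟩ := h0 d hd
      simp only [h2, h3, yCoord_graphVec]
      exact sub_ne_zero.mpr hb
    · exact sub_eq_zero.mpr ((mem_graph_iff f).mp (hv d hd a) b)
  rcases hnot with hnot | hnot
  · refine key id (fun a b ↦ hreg a _) (by simpa using hnot) fun d hd a ↦ ?_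
    have := (h1 d hd a).1
    rwa [hUS d] at this
  · refine key (· ^ Fintype.card κ) (fun a b ↦ pow_mem_regularFun (hreg a _) _) hnot
      fun d hd a ↦ ?_
    have := (h1 d hd a).2
    rw [hUS d, frob_graph] at this
    exact this

/-- The points of `Y_V`. -/
theorem YV.exists_isPoint (hn : n = 2 * m) (hω : ω.IsAlt) (hω' : ω.Nondegenerate)
    (y : KPoint (YV K e ω m)) : ∃ U U' : Submodule K (K ⊗[κ] V), IsLagrangian K ω m U ∧
      Module.finrank K U' = m - 1 ∧ U' ≤ U ⊓ frob κ K U ∧ YV.IsPoint K e y U U' := by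
  obtain ⟨U, U', h1, h2, h3, h4, h5⟩ := (isClosedKPoints_flag e hn hω hω').mem y
  exact ⟨U, U', h1, h2, h3, (congr_arg (LV.IsPoint K e · U) (Category.assoc _ _ _)).mp h4,
    (congr_arg (Gr.IsPoint K e · U') (Category.assoc _ _ _)).mp h5⟩

theorem YV.exists_point (e : Module.Basis (Fin n) κ V) {U U' : Submodule K (K ⊗[κ] V)}
    (hU : IsLagrangian K ω m U) (hU' : Module.finrank K U' = m - 1) (hle : U' ≤ U ⊓ frob κ K U) :
    ∃ y : KPoint (YV K e ω m), YV.IsPoint K e y U U' := by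
  obtain ⟨x, hx⟩ := LV.exists_point e hU
  obtain ⟨x', hx'⟩ := Gr.exists_point e hU'
  have h1 : LV.IsPoint K e (prodLift x x' ≫ prodFst _ _) U := by rwa [prodLift_fst]
  have h2 : Gr.IsPoint K e (prodLift x x' ≫ prodSnd _ _) U' := by rwa [prodLift_snd]
  obtain ⟨y, hy⟩ := exists_kPoint_subvariety
    (T := (flagPoints K e ω m))
    ⟨U, U', hU, hU', hle, h1, h2⟩
  rw [← hy] at h1 h2
  exact ⟨y, (congr_arg (LV.IsPoint K e · U) (Category.assoc _ _ _)).mp h1,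
    (congr_arg (Gr.IsPoint K e · U') (Category.assoc _ _ _)).mp h2⟩

theorem YV.exists_hom {X : SchOver K} [LocallyOfFiniteType X.hom] [IsReduced X.left]
    (f : X ⟶ Gr K e m) (g : X ⟶ Gr K e (m - 1))
    (h : ∀ x : KPoint X, ∃ U U' : Submodule K (K ⊗[κ] V), IsLagrangian K ω m U ∧
      U' ≤ U ⊓ frob κ K U ∧ Gr.IsPoint K e (x ≫ f) U ∧ Gr.IsPoint K e (x ≫ g) U') :
    ∃ a : X ⟶ YV K e ω m, ∀ x : KPoint X, ∀ U U', Gr.IsPoint K e (x ≫ f) U →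
      Gr.IsPoint K e (x ≫ g) U' → YV.IsPoint K e (x ≫ a) U U' := by
  obtain ⟨f', hf'⟩ := LV.exists_lift (ω := ω) f fun x ↦ by
    obtain ⟨U, U', h1, -, h2, -⟩ := h x
    exact ⟨U, h1, h2⟩
  obtain ⟨(a : X ⟶ YV K e ω m), ha⟩ := exists_lift_subvariety
    (flagPoints K e ω m)
    (prodLift f' g) fun x ↦ by
      obtain ⟨U, U', h1, h2, h3, h4⟩ := h x
      refine ⟨U, U', h1, h4.1, h2, ?_, ?_⟩
      · rw [Category.assoc, prodLift_fst, LV.IsPoint, Category.assoc, hf']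
        exact h3
      · rw [Category.assoc, prodLift_snd]
        exact h4
  have h1 : a ≫ YV.ι K e ω m ≫ prodFst _ _ = f' := by
    refine (Category.assoc _ _ _).symm.trans ?_
    refine (congr_arg (· ≫ prodFst _ _) ha).trans ?_
    exact prodLift_fst f' g
  have h2 : a ≫ YV.ι K e ω m ≫ prodSnd _ _ = g := by
    refine (Category.assoc _ _ _).symm.trans ?_
    refine (congr_arg (· ≫ prodSnd _ _) ha).trans ?_
    exact prodLift_snd f' g
  refine ⟨a, fun x U U' hU hU' ↦ ⟨?_, ?_⟩⟩
  · rw [Category.assoc, h1, LV.IsPoint, Category.assoc, hf']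
    exact hU
  · rw [Category.assoc, h2]
    exact hU'

/-- A Lagrangian satisfies the dimension condition exactly when it carries some `U'`, so the set is
the image of the closed set of flags under the first projection, which is proper because the
Grassmannian is. -/
theorem isClosedKPoints_SV (e : Module.Basis (Fin n) κ V) (hn : n = 2 * m) (hω : ω.IsAlt)
    (hω' : ω.Nondegenerate) :
    IsClosedKPoints {x : KPoint (LV K e ω m) | ∃ U : Submodule K (K ⊗[κ] V),
      IsLagrangian K ω m U ∧ m - 1 ≤ Module.finrank K ↥(U ⊓ frob κ K U) ∧ LV.IsPoint K e x U} := by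
  have : Module.Finite K (K ⊗[κ] V) := Module.Finite.of_basis (e.baseChange K)
  have h := (isClosedKPoints_flag (K := K) e hn hω hω').image (prodFst _ _)
  convert h
  ext x
  constructor
  · rintro ⟨U, hU, hd, hx⟩
    obtain ⟨U', hle, hU'⟩ := exists_le_finrank_eq _ hd
    obtain ⟨y, hy⟩ := YV.exists_point e hU hU' hle
    refine ⟨y ≫ YV.ι K e ω m, ⟨U, U', hU, hU', hle, ?_, ?_⟩, LV.IsPoint.point_eq ?_ hx⟩
    · rw [Category.assoc]; exact hy.1
    · rw [Category.assoc]; exact hy.2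
    · exact (congr_arg (LV.IsPoint K e · U) (Category.assoc _ _ _)).mpr hy.1
  · rintro ⟨y, ⟨U, U', hU, hU', hle, h1, h2⟩, rfl⟩
    exact ⟨U, hU, hU' ▸ Submodule.finrank_mono hle, h1⟩

theorem SV.exists_isPoint (hn : n = 2 * m) (hω : ω.IsAlt) (hω' : ω.Nondegenerate)
    (x : KPoint (SV K e ω m)) : ∃ U : Submodule K (K ⊗[κ] V), IsLagrangian K ω m U ∧
      m - 1 ≤ Module.finrank K ↥(U ⊓ frob κ K U) ∧ SV.IsPoint K e x U :=
  (isClosedKPoints_SV e hn hω hω').mem x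

theorem SV.exists_point (e : Module.Basis (Fin n) κ V) {U : Submodule K (K ⊗[κ] V)}
    (hU : IsLagrangian K ω m U) (hd : m - 1 ≤ Module.finrank K ↥(U ⊓ frob κ K U)) :
    ∃ x : KPoint (SV K e ω m), SV.IsPoint K e x U := by
  obtain ⟨x, hx⟩ := LV.exists_point e hU
  obtain ⟨y, hy⟩ := exists_kPoint_subvariety
    (T := {x : KPoint (LV K e ω m) | ∃ U : Submodule K (K ⊗[κ] V), IsLagrangian K ω m U ∧
      m - 1 ≤ Module.finrank K ↥(U ⊓ frob κ K U) ∧ LV.IsPoint K e x U}) ⟨U, hU, hd, hx⟩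
  rw [← hy] at hx
  exact ⟨y, hx⟩

/-- The morphism `(U, U') ↦ U`. -/
theorem exists_projection (e : Module.Basis (Fin n) κ V) (hn : n = 2 * m) (hω : ω.IsAlt)
    (hω' : ω.Nondegenerate) : ∃ π : YV K e ω m ⟶ SV K e ω m,
      π ≫ SV.ι K e ω m = YV.ι K e ω m ≫ prodFst _ _ := by
  have : Module.Finite K (K ⊗[κ] V) := Module.Finite.of_basis (e.baseChange K)
  refine exists_lift_subvariety _ _ fun y ↦ ?_
  obtain ⟨U, U', hU, hU', hle, hy⟩ := YV.exists_isPoint hn hω hω' y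
  exact ⟨U, hU, hU' ▸ Submodule.finrank_mono hle, hy.1⟩

end YV

/-! ### Artin–Schreier algebras -/

/-- The presentation has no relations, so its Jacobian is the determinant of an empty matrix. -/
theorem isStandardSmoothOfRelativeDimension_mvPolynomial (A : Type*) [CommRing A] (m : ℕ) :
    Algebra.IsStandardSmoothOfRelativeDimension m A (MvPolynomial (Fin m) A) := by
  classical
  let v : Empty → MvPolynomial (Fin m) A := Empty.elim
  let P : Algebra.SubmersivePresentation A (MvPolynomial (Fin m) A ⧸ Ideal.span (Set.range v))
      (Fin m) Empty :=
    { Algebra.PreSubmersivePresentation.naive (v := v) Empty.elim (fun a ↦ a.elim) with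
      jacobian_isUnit := by
        rw [Algebra.PreSubmersivePresentation.jacobian_eq_jacobiMatrix_det, Matrix.det_isEmpty,
          map_one]
        exact isUnit_one }
  have h1 : Algebra.IsStandardSmoothOfRelativeDimension m A
      (MvPolynomial (Fin m) A ⧸ Ideal.span (Set.range v)) :=
    P.isStandardSmoothOfRelativeDimension (by simp [Algebra.Presentation.dimension])
  have h2 : Ideal.span (Set.range v) = ⊥ := by
    rw [Set.range_eq_empty, Ideal.span_empty]
  exact Algebra.IsStandardSmoothOfRelativeDimension.of_algEquiv m
    ((Ideal.quotientEquivAlgOfEq A h2).trans (AlgEquiv.quotientBot A _))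

section ArtinSchreier

variable {A : Type u} [CommRing A] {ι : Type} (q : ℕ) (a : ι → A)

/-- The equations `X ^ q - X = a`. -/
def artinSchreierRel (i : ι) : MvPolynomial ι A :=
  MvPolynomial.X i ^ q - MvPolynomial.X i - MvPolynomial.C (a i)

/-- The algebra obtained by adjoining solutions of the equations `X ^ q - X = a`. -/
abbrev ArtinSchreier : Type u := MvPolynomial ι A ⧸ Ideal.span (Set.range (artinSchreierRel q a))

/-- The solutions of the equations. -/
def ArtinSchreier.root (i : ι) : ArtinSchreier q a := Ideal.Quotient.mk _ (MvPolynomial.X i)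

theorem ArtinSchreier.root_pow (i : ι) :
    ArtinSchreier.root q a i ^ q - ArtinSchreier.root q a i = algebraMap A _ (a i) := by
  rw [← sub_eq_zero]
  exact Ideal.Quotient.eq_zero_iff_mem.mpr (Ideal.subset_span ⟨i, rfl⟩)

theorem ArtinSchreier.exists_ringHom {C : Type*} [CommRing C] (φ : A →+* C) (s : ι → C)
    (hs : ∀ i, s i ^ q - s i = φ (a i)) : ∃ ψ : ArtinSchreier q a →+* C,
      ψ.comp (algebraMap A _) = φ ∧ ∀ i, ψ (ArtinSchreier.root q a i) = s i := by
  refine ⟨Ideal.Quotient.lift _ (MvPolynomial.eval₂Hom φ s) ?_, ?_, fun i ↦ ?_⟩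
  · intro p hp
    have : Ideal.span (Set.range (artinSchreierRel q a)) ≤
        RingHom.ker (MvPolynomial.eval₂Hom φ s) := by
      rw [Ideal.span_le]
      rintro _ ⟨i, rfl⟩
      simp [artinSchreierRel, hs]
    exact this hp
  · ext x
    exact MvPolynomial.eval₂_C φ s x
  · exact MvPolynomial.eval₂_X φ s i

theorem ArtinSchreier.subring_eq_top (s : Subring (ArtinSchreier q a))
    (h1 : ∀ x, algebraMap A (ArtinSchreier q a) x ∈ s)
    (h2 : ∀ i, ArtinSchreier.root q a i ∈ s) : s = ⊤ := by
  rw [eq_top_iff]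
  intro x _
  obtain ⟨p, rfl⟩ := Ideal.Quotient.mk_surjective x
  induction p using MvPolynomial.induction_on with
  | C x => exact h1 x
  | add p p' hp hp' => rw [map_add]; exact add_mem (hp trivial) (hp' trivial)
  | mul_X p i hp => rw [map_mul]; exact mul_mem (hp trivial) (h2 i)

variable [Finite ι] {q}

/-- As `q = 0` in `A`, the derivative of `X ^ q - X - a` is `-1`; with as many equations as unknowns
the Jacobian matrix is `-1`. -/
theorem ArtinSchreier.isStandardSmoothOfRelativeDimension (hq : (q : A) = 0) :
    Algebra.IsStandardSmoothOfRelativeDimension 0 A (ArtinSchreier q a) := by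
  classical
  have := Fintype.ofFinite ι
  let P₀ := Algebra.PreSubmersivePresentation.naive (v := artinSchreierRel q a) id
    Function.injective_id
  have hJ : P₀.jacobiMatrix = -1 := by
    ext1 i j
    rw [Algebra.PreSubmersivePresentation.jacobiMatrix_naive]
    have : ((q : ℕ) : MvPolynomial ι A) = 0 := by
      rw [← map_natCast (MvPolynomial.C : A →+* _), hq, map_zero]
    simp [artinSchreierRel, MvPolynomial.pderiv_X, Matrix.one_apply, Pi.single_apply, this]
    exact if_congr eq_comm rfl rfl
  let P : Algebra.SubmersivePresentation A (ArtinSchreier q a) ι ι :=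
    { P₀ with
      jacobian_isUnit := by
        rw [Algebra.PreSubmersivePresentation.jacobian_eq_jacobiMatrix_det, hJ, Matrix.det_neg,
          Matrix.det_one, mul_one]
        exact (isUnit_one.neg.pow _).map _ }
  exact P.isStandardSmoothOfRelativeDimension (by simp [Algebra.Presentation.dimension])

/-- The algebra is flat over the domain `A`, so it embeds in its base change to the fraction field,
which is étale over a field and hence reduced. -/
theorem ArtinSchreier.isReduced [IsDomain A] (hq : (q : A) = 0) :
    IsReduced (ArtinSchreier q a) := by
  have h := ArtinSchreier.isStandardSmoothOfRelativeDimension a hq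
  have : Algebra.Etale A (ArtinSchreier q a) := inferInstance
  have : Module.Flat A (ArtinSchreier q a) := inferInstance
  have := Algebra.FormallyUnramified.isReduced_of_field (FractionRing A)
    (FractionRing A ⊗[A] ArtinSchreier q a)
  exact isReduced_of_injective
    (Algebra.TensorProduct.includeRight (R := A) (A := FractionRing A) (B := ArtinSchreier q a))
    (Algebra.TensorProduct.includeRight_injective (IsFractionRing.injective A _))

end ArtinSchreier

/-! ### Spectra of `K`-algebras and their points -/

section SpecOver

variable {K : Type u} [Field K]

variable (K) in
/-- The spectrum of a `K`-algebra. -/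
def specOver (B : Type u) [CommRing B] [Algebra K B] : SchOver K :=
  Over.mk (Spec.map (CommRingCat.ofHom (algebraMap K B)))

variable {B : Type u} [CommRing B] [Algebra K B]

instance : IsAffine (specOver K B).left := inferInstanceAs (IsAffine (Spec (.of B)))

theorem isReduced_specOver [_root_.IsReduced B] : IsReduced (specOver K B).left :=
  inferInstanceAs (IsReduced (Spec (.of B)))

theorem locallyOfFiniteType_specOver [Algebra.FiniteType K B] :
    LocallyOfFiniteType (specOver K B).hom := by
  refine (HasRingHomProperty.Spec_iff (P := @LocallyOfFiniteType)).mpr ?_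
  exact RingHom.finiteType_algebraMap.mpr inferInstance

theorem smoothOfRelativeDimension_specOver {n : ℕ}
    (h : Algebra.IsStandardSmoothOfRelativeDimension n K B) :
    SmoothOfRelativeDimension n (specOver K B).hom := by
  refine (HasRingHomProperty.Spec_iff (P := @SmoothOfRelativeDimension n)).mpr ?_
  refine RingHom.locally_of RingHom.isStandardSmoothOfRelativeDimension_respectsIso _ ?_
  exact (RingHom.isStandardSmoothOfRelativeDimension_algebraMap n).mpr h

/-- The functions on the spectrum of `B`. -/
def specΓ : B →+* Γ((specOver K B).left, ⊤) := (Scheme.ΓSpecIso (.of B)).inv.hom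

theorem specΓ_surjective : Function.Surjective (specΓ (K := K) (B := B)) :=
  (ConcreteCategory.bijective_of_isIso (Scheme.ΓSpecIso (.of B)).inv).2

/-- The homomorphism `B →+* K` which corresponds to a `K`-point of the spectrum of `B`. -/
def specVal (x : KPoint (specOver K B)) : B →+* K := (val x).comp specΓ

theorem specΓ_algebraMap (a : K) :
    specΓ (algebraMap K B a) = scalarHom (specOver K B) a := by
  have h := Scheme.ΓSpecIso_inv_naturality (CommRingCat.ofHom (algebraMap K B))
  exact congr($h a)

theorem specVal_algebraMap (x : KPoint (specOver K B)) (a : K) :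
    specVal x (algebraMap K B a) = a := by
  rw [specVal, RingHom.comp_apply, specΓ_algebraMap, val_scalarHom]

theorem exists_kPoint_specOver (ψ : B →+* K) (hψ : ∀ a, ψ (algebraMap K B a) = a) :
    ∃ x : KPoint (specOver K B), specVal x = ψ := by
  let x : KPoint (specOver K B) := Over.homMk (Spec.map (CommRingCat.ofHom ψ)) (by
    change Spec.map _ ≫ Spec.map _ = _
    rw [← Spec.map_comp, ← CommRingCat.ofHom_comp,
      show ψ.comp (algebraMap K B) = RingHom.id K from RingHom.ext hψ]
    exact Spec.map_id _)
  exact ⟨x, RingHom.ext fun b ↦ val_left_spec _ x (CommRingCat.ofHom ψ) rfl b⟩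

theorem specVal_mem_regularFun (b : B) :
    (fun x : KPoint (specOver K B) ↦ specVal x b) ∈ regularFun (specOver K B) :=
  val_mem_regularFun (specΓ b)

variable [IsAlgClosed K] [_root_.IsReduced B] [Algebra.FiniteType K B]

/-- A function on the spectrum of `B` is pulled back from `Z` if its values are given by a regular
function on `Z`. -/
theorem exists_appTop_eq {Z : SchOver K} (f : specOver K B ⟶ Z) (b : B) {φ : KPoint Z → K}
    (hφ : φ ∈ regularFun Z) (h : ∀ x : KPoint (specOver K B), φ (x ≫ f) = specVal x b) :
    specΓ b ∈ RingHom.range f.left.appTop.hom := by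
  have := isReduced_specOver (K := K) (B := B)
  have := locallyOfFiniteType_specOver (K := K) (B := B)
  obtain ⟨s, hs⟩ := mem_regularFun.mp hφ
  refine ⟨s, section_ext_of_val fun x ↦ ?_⟩
  rw [← val_comp, hs, h]
  rfl

end SpecOver

/-! ### The coordinate ring of a chart of `Y_V` -/

section ChartRing

variable (q : ℕ) (K : Type u) [Field K] {r : ℕ} (i : Fin (r + 1))

/-- The linear form `l`, normalized by `l i = 1`. -/
def chartForm (k : Fin (r + 1)) : MvPolynomial (Fin (r + 1)) K :=
  Function.update MvPolynomial.X i 1 k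

/-- The coordinate ring of a chart of `Y_V`: the entries of a symmetric matrix `S` with
`S ^ (q) - S = c l l ^ t`, where `c` is the `i`-th variable and the other variables are the
coefficients of `l`. -/
abbrev ChartRing : Type u :=
  ArtinSchreier q fun p : Sym2 (Fin (r + 1)) ↦
    (MvPolynomial.X i : MvPolynomial (Fin (r + 1)) K) *
      Sym2.lift ⟨fun k j ↦ chartForm K i k * chartForm K i j, fun _ _ ↦ mul_comm _ _⟩ p

/-- The entries of the symmetric matrix `S`. -/
def ChartRing.S (k j : Fin (r + 1)) : ChartRing q K i := ArtinSchreier.root q _ s(k, j)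

/-- The coefficients of the linear form `l`. -/
def ChartRing.l (k : Fin (r + 1)) : ChartRing q K i := algebraMap _ _ (chartForm K i k)

/-- The scalar `c`. -/
def ChartRing.c : ChartRing q K i :=
  algebraMap (MvPolynomial (Fin (r + 1)) K) _ (MvPolynomial.X i)

theorem ChartRing.S_symm (k j) : ChartRing.S q K i k j = ChartRing.S q K i j k := by
  rw [ChartRing.S, Sym2.eq_swap]
  rfl

theorem ChartRing.l_self : ChartRing.l q K i i = 1 := by simp [ChartRing.l, chartForm]

theorem ChartRing.S_pow (k j) : ChartRing.S q K i k j ^ q - ChartRing.S q K i k j =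
    ChartRing.c q K i * (ChartRing.l q K i k * ChartRing.l q K i j) := by
  rw [ChartRing.S, ArtinSchreier.root_pow, ChartRing.c, ChartRing.l, ChartRing.l, Sym2.lift_mk,
    map_mul, map_mul]

/-- Because `l i = 1`, the diagonal equation at `i` expresses `c` through `S`. Thus `S` and `l`
generate the ring, which is what both the chart and the fibre arguments need. -/
theorem ChartRing.c_eq : ChartRing.c q K i = ChartRing.S q K i i i ^ q - ChartRing.S q K i i i := by
  rw [ChartRing.S_pow, ChartRing.l_self, mul_one, mul_one]

variable {q K i}

theorem ChartRing.subring_eq_top (s : Subring (ChartRing q K i))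
    (h1 : ∀ a, algebraMap K (ChartRing q K i) a ∈ s) (h2 : ∀ k j, ChartRing.S q K i k j ∈ s)
    (h3 : ∀ k, ChartRing.l q K i k ∈ s) : s = ⊤ := by
  refine ArtinSchreier.subring_eq_top _ _ s (fun p ↦ ?_) fun p ↦ ?_
  · induction p using MvPolynomial.induction_on with
    | C a => exact h1 a
    | add p p' hp hp' => rw [map_add]; exact add_mem hp hp'
    | mul_X p k hp =>
      rw [map_mul]
      refine mul_mem hp ?_
      by_cases hk : k = i
      · subst hk
        change ChartRing.c q K k ∈ s
        rw [ChartRing.c_eq]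
        exact sub_mem (pow_mem (h2 _ _) _) (h2 _ _)
      · have := h3 k
        rwa [ChartRing.l, chartForm, Function.update_of_ne hk] at this
  · induction p using Sym2.ind with
    | _ k j => exact h2 k j

theorem ChartRing.exists_ringHom {S : Matrix (Fin (r + 1)) (Fin (r + 1)) K}
    {l : Fin (r + 1) → K} (hS : S.IsSymm) (hl : l i = 1)
    (h : ∀ k j, (S.map (· ^ q) - S) k j = (S.map (· ^ q) - S) i i * (l k * l j)) :
    ∃ ψ : ChartRing q K i →+* K, (∀ a, ψ (algebraMap K _ a) = a) ∧
      (∀ k j, ψ (ChartRing.S q K i k j) = S k j) ∧ ∀ k, ψ (ChartRing.l q K i k) = l k := by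
  -- The `i`-th variable stands for `c`, since the coefficient `l i` is the constant `1`; its value
  -- is therefore forced to be `S i i ^ q - S i i`.
  let v : Fin (r + 1) → K := Function.update l i (S i i ^ q - S i i)
  have hv (k) : MvPolynomial.eval v (chartForm K i k) = l k := by
    by_cases hk : k = i
    · subst hk; simp [chartForm, hl]
    · simp [chartForm, Function.update_of_ne hk, v]
  obtain ⟨ψ, h1, h2⟩ := ArtinSchreier.exists_ringHom q
    (fun p : Sym2 (Fin (r + 1)) ↦ (MvPolynomial.X i : MvPolynomial (Fin (r + 1)) K) *
      Sym2.lift ⟨fun k j ↦ chartForm K i k * chartForm K i j, fun _ _ ↦ mul_comm _ _⟩ p)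
    (MvPolynomial.eval v)
    (fun p ↦ Sym2.lift ⟨fun k j ↦ S k j, fun k j ↦ hS.apply j k⟩ p) fun p ↦ by
      induction p using Sym2.ind with
      | _ k j =>
        simp only [Sym2.lift_mk, map_mul, MvPolynomial.eval_X, hv]
        simpa [v] using h k j
  refine ⟨ψ, fun a ↦ ?_, fun k j ↦ (h2 _).trans (Sym2.lift_mk _ _ _), fun k ↦ ?_⟩
  · exact (congr($h1 (MvPolynomial.C a))).trans (MvPolynomial.eval_C a)
  · exact (congr($h1 _)).trans (hv k)

instance : Algebra.FiniteType K (ChartRing q K i) :=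
  have : IsScalarTower K (MvPolynomial (Fin (r + 1)) K) (ChartRing q K i) := inferInstance
  Algebra.FiniteType.trans (S := MvPolynomial (Fin (r + 1)) K) inferInstance inferInstance

theorem ChartRing.natCast_eq_zero (hq : (q : K) = 0) :
    (q : MvPolynomial (Fin (r + 1)) K) = 0 := by
  rw [← map_natCast (MvPolynomial.C : K →+* _), hq, map_zero]

theorem ChartRing.isReduced (hq : (q : K) = 0) : IsReduced (ChartRing q K i) :=
  ArtinSchreier.isReduced _ (ChartRing.natCast_eq_zero hq)

/-- The ring is étale over the polynomial ring in `c` and the `r` free coefficients of `l`, so the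
dimension is `r + 1`. -/
theorem ChartRing.isStandardSmoothOfRelativeDimension (hq : (q : K) = 0) :
    Algebra.IsStandardSmoothOfRelativeDimension (r + 1) K (ChartRing q K i) := by
  have h1 := isStandardSmoothOfRelativeDimension_mvPolynomial K (r + 1)
  have h2 := ArtinSchreier.isStandardSmoothOfRelativeDimension
    (fun p : Sym2 (Fin (r + 1)) ↦ (MvPolynomial.X i : MvPolynomial (Fin (r + 1)) K) *
      Sym2.lift ⟨fun k j ↦ chartForm K i k * chartForm K i j, fun _ _ ↦ mul_comm _ _⟩ p)
    (ChartRing.natCast_eq_zero hq)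
  have h3 : IsScalarTower K (MvPolynomial (Fin (r + 1)) K) (ChartRing q K i) := inferInstance
  have := Algebra.IsStandardSmoothOfRelativeDimension.trans (n := r + 1) (m := 0) K
    (MvPolynomial (Fin (r + 1)) K) (ChartRing q K i)
  simpa using this

end ChartRing

/-! ### Charts of `Y_V` -/

section Chart

variable {κ : Type*} [Field κ] {K : Type u} [Field K] [Algebra κ K]
  {V : Type*} [AddCommGroup V] [Module κ V] {n r : ℕ} {e : Module.Basis (Fin n) κ V}
  {ω : LinearMap.BilinForm κ V} {f : Module.Basis (Fin (r + 1) ⊕ Fin (r + 1)) κ V}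
  {i : Fin (r + 1)}

theorem graphVec_mem_regularFun {X : SchOver K} {S : KPoint X → Matrix (Fin (r + 1)) (Fin (r + 1)) K}
    (hS : ∀ k j, (fun x ↦ S x k j) ∈ regularFun X) (k : Fin (r + 1))
    (φ : Module.Dual K (K ⊗[κ] V)) : (fun x ↦ φ (graphVec f (S x) k)) ∈ regularFun X := by
  simp only [graphVec, map_add, map_sum, map_smul, smul_eq_mul]
  exact add_mem_regularFun (const_mem_regularFun _) (sum_mem_regularFun fun j ↦
    mul_mem_regularFun (hS k j) (const_mem_regularFun _))

variable [Fintype κ]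

variable (K e ω f i) in
/-- The open subset of all `(U, U')` for which `U` is a graph and the coordinates without the
`i`-th one are a basis of the dual space of `U'`. -/
def chartOpen : (YV K e ω (r + 1)).left.Opens :=
  (YV.ι K e ω (r + 1) ≫ prodFst _ _ ≫ LV.ι K e ω (r + 1)).left ⁻¹ᵁ Gr.dualOpen e (xCoord K f) ⊓
    (YV.ι K e ω (r + 1) ≫ prodSnd _ _).left ⁻¹ᵁ Gr.dualOpen e (i := r) (xCoordNe K f i)

theorem pt_mem_chartOpen_iff {y : KPoint (YV K e ω (r + 1))} {U U' : Submodule K (K ⊗[κ] V)}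
    (h : YV.IsPoint K e y U U') : y.pt ∈ chartOpen K e ω f i ↔
      (∃ w, IsDualBasis (xCoord K f) w U) ∧ ∃ w', IsDualBasis (xCoordNe K f i) w' U' := by
  have h1 : Gr.IsPoint K e (y ≫ YV.ι K e ω (r + 1) ≫ prodFst _ _ ≫ LV.ι K e ω (r + 1)) U := by
    have := h.1
    rwa [LV.IsPoint, Category.assoc, Category.assoc] at this
  rw [← Gr.pt_mem_dualOpen_iff h1, ← Gr.pt_mem_dualOpen_iff (i := r) h.2]
  rfl

theorem natCast_card_eq_zero (κ : Type*) [Field κ] [Fintype κ] (K : Type*) [Field K]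
    [Algebra κ K] : ((Fintype.card κ : ℕ) : K) = 0 := by
  rw [← map_natCast (algebraMap κ K), Nat.cast_card_eq_zero, map_zero]

/-- The parameters of a point in a chart. -/
structure IsChartPoint (ω : LinearMap.BilinForm κ V)
    (f : Module.Basis (Fin (r + 1) ⊕ Fin (r + 1)) κ V)
    (i : Fin (r + 1)) (e : Module.Basis (Fin n) κ V) (y : KPoint (YV K e ω (r + 1)))
    (S : Matrix (Fin (r + 1)) (Fin (r + 1)) K) (l : Fin (r + 1) → K) : Prop where
  isSymm : S.IsSymm
  l_self : l i = 1
  eq : ∀ k j, (S.map (· ^ Fintype.card κ) - S) k j =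
    (S.map (· ^ Fintype.card κ) - S) i i * (l k * l j)
  isPoint : YV.IsPoint K e y (graph f S) (hyper f S i l)

theorem IsChartPoint.pt_mem {y : KPoint (YV K e ω (r + 1))} {S l}
    (h : IsChartPoint ω f i e y S l) : y.pt ∈ chartOpen K e ω f i :=
  (pt_mem_chartOpen_iff h.isPoint).mpr
    ⟨⟨_, isDualBasis_graphVec f S⟩, _, isDualBasis_hyperVec f S i l⟩

theorem IsChartPoint.unique {y : KPoint (YV K e ω (r + 1))}
    {S S' : Matrix (Fin (r + 1)) (Fin (r + 1)) K} {l l' : Fin (r + 1) → K}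
    (h : IsChartPoint ω f i e y S l) (h' : IsChartPoint ω f i e y S' l') : S = S' ∧ l = l' := by
  obtain ⟨h1, h2⟩ := h.isPoint.eq h'.isPoint
  obtain rfl := graph_injective f h1
  refine ⟨rfl, funext fun k ↦ ?_⟩
  have h3 : hyperVec f S i l' = hyperVec f S i l :=
    (isDualBasis_hyperVec f S i l).unique (h2 ▸ isDualBasis_hyperVec f S i l')
  induction k using Fin.succAboveCases i with
  | x => rw [h.l_self, h'.l_self]
  | p k =>
    have := congr_arg (xCoord K f i) (congr_fun h3 k)
    rw [xCoord_hyperVec, xCoord_hyperVec, neg_inj] at this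
    exact this.symm

variable [IsAlgClosed K]

/-- The bases dual to the coordinates exhibit `U` as a graph and `U'` as the kernel of a form. The
coefficients of the form are minus the `x_i`-coordinates of the basis of `U'`, with `1` inserted at
place `i`; the Lagrangian condition makes `S` symmetric. -/
theorem exists_isChartPoint (hn : n = 2 * (r + 1)) (hω : ω.IsAlt) (hω' : ω.Nondegenerate)
    (hf : IsSymplecticBasis ω f) {y : KPoint (YV K e ω (r + 1))}
    (hy : y.pt ∈ chartOpen K e ω f i) : ∃ S l, IsChartPoint ω f i e y S l := by
  obtain ⟨U, U', hU, hU', hle, h⟩ := YV.exists_isPoint hn hω hω' y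
  obtain ⟨⟨w, hw⟩, w', hw'⟩ := (pt_mem_chartOpen_iff h).mp hy
  obtain rfl := hw.eq_graph f
  set S := Matrix.of fun a b ↦ yCoord K f b (w a)
  let l : Fin (r + 1) → K := Fin.insertNth i 1 fun k ↦ -xCoord K f i (w' k)
  have hl : l i = 1 := Fin.insertNth_apply_same _ _ _
  obtain rfl := hw'.eq_hyper f (l := l) (hle.trans inf_le_left) fun k ↦
    Fin.insertNth_apply_succAbove _ _ _ _
  rw [frob_graph] at hle
  have hS := (isLagrangian_graph_iff f hω hf).mp hU
  have hS' : (S.map (· ^ Fintype.card κ)).IsSymm := hS.map _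
  exact ⟨S, l, hS, hl,
    (hyper_le_graph_iff_of_isSymm f hS hS' hl).mp (hle.trans inf_le_right), h⟩

variable {X : SchOver K} [LocallyOfFiniteType X.hom]

theorem IsChartPoint.regular {a : X ⟶ YV K e ω (r + 1)}
    {S : KPoint X → Matrix (Fin (r + 1)) (Fin (r + 1)) K} {l : KPoint X → Fin (r + 1) → K}
    (h : ∀ x : KPoint X, IsChartPoint ω f i e (x ≫ a) (S x) (l x)) :
    (∀ k j, (fun x ↦ S x k j) ∈ regularFun X) ∧ ∀ k, (fun x ↦ l x k) ∈ regularFun X := by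
  constructor
  · intro k j
    have h1 (x : KPoint X) : Gr.IsPoint K e
        (x ≫ a ≫ YV.ι K e ω (r + 1) ≫ prodFst _ _ ≫ LV.ι K e ω (r + 1)) (graph f (S x)) := by
      have := (h x).isPoint.1
      rwa [LV.IsPoint, Category.assoc, Category.assoc, Category.assoc] at this
    simpa using Gr.coord_mem_regularFun _ h1 (fun x ↦ isDualBasis_graphVec f (S x)) k
      (yCoord K f j)
  · intro k
    have h2 (x : KPoint X) : Gr.IsPoint K e (i := r)
        (x ≫ a ≫ YV.ι K e ω (r + 1) ≫ prodSnd _ _) (hyper f (S x) i (l x)) := by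
      have := (h x).isPoint.2
      rwa [Category.assoc] at this
    induction k using Fin.succAboveCases i with
    | x =>
      simp only [fun x ↦ (h x).l_self]
      exact const_mem_regularFun 1
    | p k =>
      have := neg_mem_regularFun (Gr.coord_mem_regularFun (i := r) _ h2
        (fun x ↦ isDualBasis_hyperVec f (S x) i (l x)) k (xCoord K f i))
      simpa [xCoord_hyperVec] using this

/-- Common source of all morphisms into `Y_V`: it is applied to the chart ring, to affine pieces of
`S_V` away from the rational points, and to the standard charts of projective space. -/
theorem exists_hom_of_chart [IsAffine X.left] [IsReduced X.left] (hω : ω.IsAlt)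
    (hf : IsSymplecticBasis ω f) (e : Module.Basis (Fin n) κ V)
    {S : KPoint X → Matrix (Fin (r + 1)) (Fin (r + 1)) K} {l : KPoint X → Fin (r + 1) → K}
    (hS : ∀ k j, (fun x ↦ S x k j) ∈ regularFun X) (hl : ∀ k, (fun x ↦ l x k) ∈ regularFun X)
    (hS' : ∀ x, (S x).IsSymm) (hl' : ∀ x, l x i = 1)
    (h : ∀ x k j, ((S x).map (· ^ Fintype.card κ) - S x) k j =
      ((S x).map (· ^ Fintype.card κ) - S x) i i * (l x k * l x j)) :
    ∃ a : X ⟶ YV K e ω (r + 1), ∀ x : KPoint X, IsChartPoint ω f i e (x ≫ a) (S x) (l x) := by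
  obtain ⟨g, hg⟩ := Gr.exists_hom e (fun x : KPoint X ↦ graphVec f (S x))
    (fun a c ↦ graphVec_mem_regularFun hS a _)
    fun x ↦ (isDualBasis_graphVec f (S x)).linearIndependent
  obtain ⟨g', hg'⟩ := Gr.exists_hom e (fun x : KPoint X ↦ hyperVec f (S x) i (l x))
    (fun a c ↦ by
      simp only [hyperVec, map_sub, map_smul, smul_eq_mul]
      exact sub_mem_regularFun (graphVec_mem_regularFun hS _ _)
        (mul_mem_regularFun (hl _) (graphVec_mem_regularFun hS _ _)))
    fun x ↦ (isDualBasis_hyperVec f (S x) i (l x)).linearIndependent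
  obtain ⟨a, ha⟩ := YV.exists_hom (ω := ω) g (m := r + 1) g' fun x ↦
    ⟨graph f (S x), hyper f (S x) i (l x), (isLagrangian_graph_iff f hω hf).mpr (hS' x),
      le_inf (hyper_le_graph f _ _ _) (by
        rw [frob_graph]
        exact (hyper_le_graph_iff_of_isSymm f (hS' x) ((hS' x).map _) (hl' x)).mpr (h x)),
      hg x, hg' x⟩
  exact ⟨a, fun x ↦ ⟨hS' x, hl' x, h x, ha x _ _ (hg x) (hg' x)⟩⟩

/-- The parametrization of a chart of `Y_V`. -/
theorem exists_chart (hn : n = 2 * (r + 1)) (hω : ω.IsAlt) (hω' : ω.Nondegenerate)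
    (hf : IsSymplecticBasis ω f) (e : Module.Basis (Fin n) κ V) (i : Fin (r + 1)) :
    ∃ a : specOver K (ChartRing (Fintype.card κ) K i) ⟶
        openSub (YV K e ω (r + 1)) (chartOpen K e ω f i), IsIso a.left ∧
      ∀ x : KPoint (specOver K (ChartRing (Fintype.card κ) K i)),
        IsChartPoint ω f i e (x ≫ a ≫ openSubι _ _)
          (Matrix.of fun k j ↦ specVal x (ChartRing.S _ K i k j))
          fun k ↦ specVal x (ChartRing.l _ K i k) := by
  have hq := natCast_card_eq_zero κ K
  have := ChartRing.isReduced (i := i) hq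
  have := isReduced_specOver (K := K) (B := ChartRing (Fintype.card κ) K i)
  have := locallyOfFiniteType_specOver (K := K) (B := ChartRing (Fintype.card κ) K i)
  obtain ⟨b, hb⟩ := exists_hom_of_chart (f := f) (i := i) hω hf e
    (X := specOver K (ChartRing (Fintype.card κ) K i))
    (S := fun x ↦ Matrix.of fun k j ↦ specVal x (ChartRing.S _ K i k j))
    (l := fun x k ↦ specVal x (ChartRing.l _ K i k))
    (fun k j ↦ specVal_mem_regularFun _) (fun k ↦ specVal_mem_regularFun _)
    (fun x ↦ Matrix.IsSymm.ext fun k j ↦ congr_arg (specVal x)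
      (ChartRing.S_symm (Fintype.card κ) K i j k))
    (fun x ↦ by rw [ChartRing.l_self, map_one])
    (fun x k j ↦ by
      have h (k j) := congr_arg (specVal x) (ChartRing.S_pow (Fintype.card κ) K i k j)
      simp only [map_sub, map_pow, map_mul] at h
      simp only [Matrix.sub_apply, Matrix.map_apply, Matrix.of_apply]
      rw [h, h, ChartRing.l_self, map_one, mul_one, mul_one])
  obtain ⟨a, ha⟩ := exists_lift_of_kPoint (openSubι _ (chartOpen K e ω f i)) b fun x ↦ by
    rw [range_openSubι]
    exact (hb x).pt_mem
  have hpt (x) : IsChartPoint ω f i e (x ≫ a ≫ openSubι _ _)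
      (Matrix.of fun k j ↦ specVal x (ChartRing.S _ K i k j))
      fun k ↦ specVal x (ChartRing.l _ K i k) := by
    rw [ha]
    exact hb x
  -- The open piece of `Y_V` is reduced and the source is affine, so it suffices that `a` is
  -- surjective on `K`-points and on global functions.
  refine ⟨a, isIso_of_kPoint_of_appTop a (fun y ↦ ?_) ?_, hpt⟩
  · obtain ⟨S, l, h⟩ := exists_isChartPoint hn hω hω' hf (pt_mem_of_openSub y)
    obtain ⟨ψ, h1, h2, h3⟩ := ChartRing.exists_ringHom h.isSymm h.l_self h.eq
    obtain ⟨x, rfl⟩ := exists_kPoint_specOver ψ h1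
    have hS : (Matrix.of fun k j ↦ specVal x (ChartRing.S _ K i k j)) = S := by
      ext k j
      exact h2 k j
    have := mono_of_isOpenImmersion (openSubι (YV K e ω (r + 1)) (chartOpen K e ω f i))
    refine ⟨x, (cancel_mono (openSubι _ _)).mp ?_⟩
    rw [Category.assoc]
    refine YV.IsPoint.point_eq (hpt x).isPoint ?_
    rw [hS, funext h3]
    exact h.isPoint
  · choose S l h using fun y : KPoint (openSub _ (chartOpen K e ω f i)) ↦
      exists_isChartPoint hn hω hω' hf (pt_mem_of_openSub y)
    obtain ⟨hS, hl⟩ := IsChartPoint.regular h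
    have huniq (x) : (∀ k j, S (x ≫ a) k j = specVal x (ChartRing.S _ K i k j)) ∧
        ∀ k, l (x ≫ a) k = specVal x (ChartRing.l _ K i k) := by
      have h1 := h (x ≫ a)
      rw [Category.assoc] at h1
      obtain ⟨h2, h3⟩ := h1.unique (hpt x)
      exact ⟨fun k j ↦ congr_fun₂ h2 k j, fun k ↦ congr_fun h3 k⟩
    -- The functions pulled back from `Y_V` form a subring which contains the generators, since the
    -- entries of `S` and `l` are regular on the open subset of `Y_V`.
    have htop : (RingHom.range a.left.appTop.hom).comap specΓ = ⊤ :=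
      ChartRing.subring_eq_top _
        (fun c ↦ exists_appTop_eq a _ (const_mem_regularFun c) fun x ↦
          (specVal_algebraMap x c).symm)
        (fun k j ↦ exists_appTop_eq a _ (hS k j) fun x ↦ (huniq x).1 k j)
        fun k ↦ exists_appTop_eq a _ (hl k) fun x ↦ (huniq x).2 k
    intro s
    obtain ⟨b, rfl⟩ := specΓ_surjective s
    exact htop.ge (Subring.mem_top b)

end Chart

/-! ### Smoothness of `Y_V` -/

section Smooth

variable {κ : Type*} [Field κ] {K : Type u} [Field K] [Algebra κ K]
  {V : Type*} [AddCommGroup V] [Module κ V] {n r : ℕ} {e : Module.Basis (Fin n) κ V}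
  {ω : LinearMap.BilinForm κ V}

theorem exists_symplecticBasis_graph (e : Module.Basis (Fin n) κ V) (hn : n = 2 * (r + 1))
    (hω : ω.IsAlt) (hω' : ω.Nondegenerate) {U : Submodule K (K ⊗[κ] V)}
    (hU : IsLagrangian K ω (r + 1) U) :
    ∃ (f : Module.Basis (Fin (r + 1) ⊕ Fin (r + 1)) κ V) (S : _),
      IsSymplecticBasis ω f ∧ U = graph f S := by
  have : Module.Finite κ V := Module.Finite.of_basis e
  have hV : Module.finrank κ V = 2 * (r + 1) := by
    rw [Module.finrank_eq_card_basis e, Fintype.card_fin, hn]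
  obtain ⟨f, hf, hfU⟩ := exists_symplecticBasis K hV hω hω' hU
  obtain ⟨S, rfl⟩ := exists_eq_graph f hU.1 hfU
  exact ⟨f, S, hf, rfl⟩

variable [Fintype κ]

theorem exists_pt_mem_chartOpen {y : KPoint (YV K e ω (r + 1))} {U' : Submodule K (K ⊗[κ] V)}
    {f : Module.Basis (Fin (r + 1) ⊕ Fin (r + 1)) κ V} {S : _} (hU' : U' ≤ graph f S)
    (h : YV.IsPoint K e y (graph f S) U') : ∃ i, y.pt ∈ chartOpen K e ω f i := by
  obtain ⟨i, hi⟩ := exists_isDualBasis_xCoordNe f hU' h.2.1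
  exact ⟨i, (pt_mem_chartOpen_iff h).mpr ⟨⟨_, isDualBasis_graphVec f S⟩, hi⟩⟩

variable [IsAlgClosed K]

theorem exists_chartOpen (hn : n = 2 * (r + 1)) (hω : ω.IsAlt) (hω' : ω.Nondegenerate)
    (y : KPoint (YV K e ω (r + 1))) :
    ∃ (f : Module.Basis (Fin (r + 1) ⊕ Fin (r + 1)) κ V) (i : _), IsSymplecticBasis ω f ∧
      y.pt ∈ chartOpen K e ω f i := by
  obtain ⟨U, U', hU, -, hle, h⟩ := YV.exists_isPoint hn hω hω' y
  obtain ⟨f, S, hf, rfl⟩ := exists_symplecticBasis_graph e hn hω hω' hU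
  obtain ⟨i, hi⟩ := exists_pt_mem_chartOpen (hle.trans inf_le_left) h
  exact ⟨f, i, hf, hi⟩

theorem smoothOfRelativeDimension_YV (e : Module.Basis (Fin n) κ V) (hn : n = 2 * (r + 1))
    (hω : ω.IsAlt) (hω' : ω.Nondegenerate) :
    SmoothOfRelativeDimension (r + 1) (YV K e ω (r + 1)).hom := by
  choose f i hf hy using exists_chartOpen (K := K) (e := e) hn hω hω'
  let 𝒰 := kPointCover (fun y ↦ openSub (YV K e ω (r + 1)) (chartOpen K e ω (f y) (i y)))
    (fun y ↦ openSubι _ _) fun y ↦ ⟨y, (range_openSubι _).ge (hy y)⟩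
  have : IsZariskiLocalAtSource (@SmoothOfRelativeDimension.{u} (r + 1)) :=
    HasRingHomProperty.instIsZariskiLocalAtSource
      (Q := RingHom.Locally (RingHom.IsStandardSmoothOfRelativeDimension (r + 1)))
  refine (IsZariskiLocalAtSource.iff_of_openCover
    (P := @SmoothOfRelativeDimension.{u} (r + 1)) 𝒰).mpr fun y ↦ ?_
  obtain ⟨a, ha, -⟩ := exists_chart hn hω hω' (hf y) e (i y) (K := K)
  have h1 := smoothOfRelativeDimension_specOver
    (ChartRing.isStandardSmoothOfRelativeDimension (i := i y) (natCast_card_eq_zero κ K))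
  have h2 : (openSub (YV K e ω (r + 1)) (chartOpen K e ω (f y) (i y))).hom =
      inv a.left ≫ (specOver K (ChartRing (Fintype.card κ) K (i y))).hom := by
    rw [← Over.w a, IsIso.inv_hom_id_assoc]
  change SmoothOfRelativeDimension (r + 1)
    (openSub (YV K e ω (r + 1)) (chartOpen K e ω (f y) (i y))).hom
  rw [h2]
  exact IsZariskiLocalAtSource.comp (P := @SmoothOfRelativeDimension.{u} (r + 1)) h1 (inv a.left)

end Smooth

/-! ### The isomorphism away from the rational points -/

section Isomorphism

/-- A morphism is an isomorphism over an open subset over which it has a section and is injective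
on points. -/
theorem isIso_morphismRestrict_of_section {K : Type u} [Field K] [IsAlgClosed K] {X Y : SchOver K}
    [LocallyOfFiniteType X.hom] [IsReduced X.left] [IsSeparated X.hom] (p : X ⟶ Y)
    (W : Y.left.Opens) (s : openSub Y W ⟶ X) (hs : s ≫ p = openSubι Y W)
    (h : ∀ x x' : KPoint X, KPoint.pt (x ≫ p : KPoint Y) ∈ W → x ≫ p = x' ≫ p → x = x') :
    IsIso (p.left ∣_ W) := by
  let W' := p.left ⁻¹ᵁ W
  let t : openSub X W' ⟶ openSub Y W := Over.homMk (p.left ∣_ W) (by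
    change p.left ∣_ W ≫ W.ι ≫ Y.hom = W'.ι ≫ X.hom
    rw [← Category.assoc, morphismRestrict_ι, Category.assoc, Over.w p])
  have ht : t ≫ openSubι Y W = openSubι X W' ≫ p :=
    Over.OverMorphism.ext (morphismRestrict_ι p.left W)
  obtain ⟨s', hs'⟩ := exists_lift_of_isOpenImmersion (openSubι X W') s (by
    rw [range_openSubι]
    rintro _ ⟨z, rfl⟩
    change p.left (s.left z) ∈ W
    have h1 : p.left (s.left z) = (openSubι Y W).left z :=
      congr($(congr_arg Over.Hom.left hs) z)
    rw [h1]
    exact (range_openSubι W).le ⟨z, rfl⟩)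
  have := mono_of_isOpenImmersion (openSubι Y W)
  have := mono_of_isOpenImmersion (openSubι X W')
  have h1 : s' ≫ t = 𝟙 _ := by
    rw [← cancel_mono (openSubι Y W), Category.assoc, ht, ← Category.assoc, hs', hs,
      Category.id_comp]
  -- Both sides have the same composite with `p`, so injectivity on points over `W` and reducedness
  -- of `X` give equality.
  have h2 : t ≫ s' = 𝟙 _ := by
    rw [← cancel_mono (openSubι X W'), Category.assoc, hs', Category.id_comp]
    refine hom_ext_of_kPoint fun x ↦ h _ _ ?_ ?_
    · rw [Category.assoc, Category.assoc, hs]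
      exact pt_mem_of_openSub (x ≫ t)
    · rw [Category.assoc, Category.assoc, Category.assoc, hs, ht]
  exact ⟨s'.left, congr_arg Over.Hom.left h2, congr_arg Over.Hom.left h1⟩

variable {κ : Type*} [Field κ] {K : Type u} [Field K] [Algebra κ K]
  {V : Type*} [AddCommGroup V] [Module κ V] {n r : ℕ} {e : Module.Basis (Fin n) κ V}
  {ω : LinearMap.BilinForm κ V}

/-- If the intersection had dimension above `r`, both graphs would coincide. So off the rational
points `U'` must be `U ∩ Φ(U)`. -/
theorem eq_graph_inf_graph {f : Module.Basis (Fin (r + 1) ⊕ Fin (r + 1)) κ V}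
    {S S' : Matrix (Fin (r + 1)) (Fin (r + 1)) K} (hne : S' ≠ S) {U' : Submodule K (K ⊗[κ] V)}
    (hd : Module.finrank K U' = r) (hle : U' ≤ graph f S ⊓ graph f S') :
    U' = graph f S ⊓ graph f S' := by
  have : Module.Finite K (K ⊗[κ] V) := Module.Finite.of_basis (f.baseChange K)
  refine Submodule.eq_of_le_of_finrank_le hle ?_
  rw [hd]
  by_contra! hlt
  have h1 : graph f S ⊓ graph f S' = graph f S :=
    Submodule.eq_of_le_of_finrank_le inf_le_left (by rw [finrank_graph]; exact hlt)
  have h2 : graph f S = graph f S' :=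
    Submodule.eq_of_le_of_finrank_le (inf_eq_left.mp h1) (by rw [finrank_graph, finrank_graph])
  exact hne (graph_injective f h2).symm

variable [Fintype κ]

/-- A rational subspace is fixed by Frobenius; conversely, entries fixed by the `q`-th power map lie
in `κ`. -/
theorem SV.isRational_iff {x : KPoint (SV K e ω (r + 1))}
    {f : Module.Basis (Fin (r + 1) ⊕ Fin (r + 1)) κ V} {S : Matrix (Fin (r + 1)) (Fin (r + 1)) K}
    (h : SV.IsPoint K e x (graph f S)) :
    SV.IsRational K e x ↔ S.map (· ^ Fintype.card κ) = S := by
  constructor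
  · rintro ⟨U₀, hU₀⟩
    refine graph_injective f ?_
    rw [← frob_graph, h.eq hU₀, frob_baseChange]
  · intro hS
    obtain ⟨U₀, hU₀⟩ := exists_baseChange_eq_graph f hS
    exact ⟨U₀, hU₀ ▸ h⟩

/-- `V` is a finite set and has finitely many subspaces. Finiteness is what makes the set of
rational points closed. -/
theorem finite_isRational (e : Module.Basis (Fin n) κ V) :
    {x : KPoint (SV K e ω (r + 1)) | SV.IsRational K e x}.Finite := by
  have : Module.Finite κ V := Module.Finite.of_basis e
  have : Finite V := Module.finite_of_finite κ
  have : Finite (Submodule κ V) := Finite.of_injective _ SetLike.coe_injective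
  choose! U₀ hU₀ using fun (x : KPoint (SV K e ω (r + 1))) (hx : SV.IsRational K e x) ↦ hx
  refine Set.Finite.of_injOn (f := U₀) (t := Set.univ) (fun _ _ ↦ Set.mem_univ _) ?_
    Set.finite_univ
  intro x hx x' hx' h
  exact (hU₀ x hx).point_eq (by rw [h]; exact hU₀ x' hx')

variable {π : YV K e ω (r + 1) ⟶ SV K e ω (r + 1)}

theorem isPoint_projection (hπ : π ≫ SV.ι K e ω (r + 1) = YV.ι K e ω (r + 1) ≫ prodFst _ _)
    {y : KPoint (YV K e ω (r + 1))} {U U' : Submodule K (K ⊗[κ] V)} (h : YV.IsPoint K e y U U') :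
    SV.IsPoint K e (y ≫ π) U := by
  rw [SV.IsPoint, Category.assoc, hπ]
  exact h.1

variable [IsAlgClosed K]

theorem projection_injective (hn : n = 2 * (r + 1)) (hω : ω.IsAlt) (hω' : ω.Nondegenerate)
    (hπ : π ≫ SV.ι K e ω (r + 1) = YV.ι K e ω (r + 1) ≫ prodFst _ _)
    {y y' : KPoint (YV K e ω (r + 1))} (hy : ¬ SV.IsRational K e (y ≫ π)) (h : y ≫ π = y' ≫ π) :
    y = y' := by
  obtain ⟨U, U', hU, hd, hle, hp⟩ := YV.exists_isPoint hn hω hω' y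
  obtain ⟨U₁, U₁', -, hd₁, hle₁, hp₁⟩ := YV.exists_isPoint hn hω hω' y'
  have h1 := isPoint_projection hπ hp
  obtain rfl : U = U₁ := h1.eq (h ▸ isPoint_projection hπ hp₁)
  obtain ⟨f, S, hf, rfl⟩ := exists_symplecticBasis_graph e hn hω hω' hU
  rw [SV.isRational_iff h1] at hy
  rw [frob_graph] at hle hle₁
  obtain rfl : U' = U₁' :=
    (eq_graph_inf_graph hy hd hle).trans (eq_graph_inf_graph hy hd₁ hle₁).symm
  exact hp.point_eq hp₁

theorem projection_surjective (hn : n = 2 * (r + 1)) (hω : ω.IsAlt) (hω' : ω.Nondegenerate)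
    (hπ : π ≫ SV.ι K e ω (r + 1) = YV.ι K e ω (r + 1) ≫ prodFst _ _)
    (x : KPoint (SV K e ω (r + 1))) : ∃ y : KPoint (YV K e ω (r + 1)), y ≫ π = x := by
  have : Module.Finite K (K ⊗[κ] V) := Module.Finite.of_basis (e.baseChange K)
  obtain ⟨U, hU, hd, h⟩ := SV.exists_isPoint hn hω hω' x
  obtain ⟨U', hle, hU'⟩ := exists_le_finrank_eq _ hd
  obtain ⟨y, hy⟩ := YV.exists_point e hU hU' hle
  exact ⟨y, (isPoint_projection hπ hy).point_eq h⟩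

/-- The entries of `S ^ (q) - S` at a point of `S_V`. -/
theorem exists_rank_one (hn : n = 2 * (r + 1)) (hω : ω.IsAlt) (hω' : ω.Nondegenerate)
    {f : Module.Basis (Fin (r + 1) ⊕ Fin (r + 1)) κ V} (hf : IsSymplecticBasis ω f)
    {x : KPoint (SV K e ω (r + 1))} {S : Matrix (Fin (r + 1)) (Fin (r + 1)) K}
    (h : SV.IsPoint K e x (graph f S)) : S.IsSymm ∧ ∃ (c : K) (l : Fin (r + 1) → K),
      ∀ k j, (S.map (· ^ Fintype.card κ) - S) k j = c * (l k * l j) := by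
  obtain ⟨π, hπ⟩ := exists_projection (K := K) e hn hω hω'
  obtain ⟨y, rfl⟩ := projection_surjective hn hω hω' hπ x
  obtain ⟨U, U', hU, hd, hle, hp⟩ := YV.exists_isPoint hn hω hω' y
  obtain rfl := (isPoint_projection hπ hp).eq h
  obtain ⟨i, hi⟩ := exists_pt_mem_chartOpen (hle.trans inf_le_left) hp
  obtain ⟨S', l, hSl⟩ := exists_isChartPoint hn hω hω' hf hi
  obtain rfl := graph_injective f (hSl.isPoint.eq hp).1
  exact ⟨hSl.isSymm, _, l, hSl.eq⟩

/-- The complement of the rational points is open. -/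
theorem exists_opens_isRational (e : Module.Basis (Fin n) κ V) :
    ∃ W : (SV K e ω (r + 1)).left.Opens, (W : Set (SV K e ω (r + 1)).left) =
      {s | ∃ x : KPoint (SV K e ω (r + 1)), SV.IsRational K e x ∧ x.pt = s}ᶜ := by
  refine ⟨⟨{s | ∃ x : KPoint (SV K e ω (r + 1)), SV.IsRational K e x ∧ x.pt = s}ᶜ, ?_⟩, rfl⟩
  rw [isOpen_compl_iff]
  have : {s | ∃ x : KPoint (SV K e ω (r + 1)), SV.IsRational K e x ∧ x.pt = s} =
      ⋃ x ∈ {x : KPoint (SV K e ω (r + 1)) | SV.IsRational K e x}, {x.pt} := by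
    ext s
    simp [eq_comm]
  rw [this]
  exact (finite_isRational e).isClosed_biUnion fun x _ ↦ x.isClosed_pt

/-- Away from the rational points `T = S^(q) - S` is a nonzero matrix `c l lᵗ`. Where `T i i ≠ 0`,
the functions `T k i / T i i` are the normalized coefficients of `l`, and `S` with these
coefficients lifts an affine neighbourhood to `Y_V`. The local lifts agree because the projection is
injective on points there. -/
theorem exists_section_of_projection (hn : n = 2 * (r + 1)) (hω : ω.IsAlt) (hω' : ω.Nondegenerate)
    (hπ : π ≫ SV.ι K e ω (r + 1) = YV.ι K e ω (r + 1) ≫ prodFst _ _)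
    {W : (SV K e ω (r + 1)).left.Opens} (hW : (W : Set (SV K e ω (r + 1)).left) =
      {s | ∃ x : KPoint (SV K e ω (r + 1)), SV.IsRational K e x ∧ x.pt = s}ᶜ) :
    ∃ s : openSub _ W ⟶ YV K e ω (r + 1), s ≫ π = openSubι _ W := by
  have hrat (x : KPoint (openSub _ W)) : ¬ SV.IsRational K e (x ≫ openSubι _ W) := fun h ↦
    hW.le (pt_mem_of_openSub x) ⟨_, h, rfl⟩
  choose F hF using fun x : KPoint (openSub _ W) ↦
    projection_surjective hn hω hω' hπ (x ≫ openSubι _ W)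
  obtain ⟨s, hs⟩ := exists_hom_of_local F fun x ↦ by
    obtain ⟨U, hU, -, hp⟩ := SV.exists_isPoint hn hω hω' (x ≫ openSubι _ W)
    obtain ⟨f, S, hf, rfl⟩ := exists_symplecticBasis_graph e hn hω hω' hU
    obtain ⟨-, c, l, hcl⟩ := exists_rank_one hn hω hω' hf hp
    -- The diagonal entries of `T` are `c l_k ^ 2`; if all of them vanish then so does `T`, and the
    -- point is rational. This works in characteristic two as well.
    obtain ⟨i, hi⟩ : ∃ i, (S.map (· ^ Fintype.card κ) - S) i i ≠ 0 := by
      by_contra! h0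
      refine hrat x ((SV.isRational_iff hp).mpr (sub_eq_zero.mp ?_))
      ext k j
      have hk := h0 k
      rw [hcl] at hk ⊢
      rcases mul_eq_zero.mp hk with hk | hk
      · simp [hk]
      · simp [mul_self_eq_zero.mp hk]
    let g := openSubι _ W ≫ SV.ι K e ω (r + 1) ≫ LV.ι K e ω (r + 1)
    let E : (openSub _ W).left.Opens := g.left ⁻¹ᵁ Gr.dualOpen e (xCoord K f)
    let j₁ := openSubι (openSub _ W) E
    have hg {x : KPoint (openSub _ W)} {U} (h : SV.IsPoint K e (x ≫ openSubι _ W) U) :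
        Gr.IsPoint K e (x ≫ g) U := by
      rwa [SV.IsPoint, LV.IsPoint, Category.assoc, Category.assoc] at h
    have hE (d : KPoint (openSub _ E)) :
        ∃ S, SV.IsPoint K e ((d ≫ j₁) ≫ openSubι _ W) (graph f S) := by
      obtain ⟨U, -, -, h⟩ := SV.exists_isPoint hn hω hω' ((d ≫ j₁) ≫ openSubι _ W)
      obtain ⟨w, hw⟩ := (Gr.pt_mem_dualOpen_iff (hg h)).mp (pt_mem_of_openSub d)
      obtain rfl := hw.eq_graph f
      exact ⟨_, h⟩
    choose S' hS' using hE
    have hreg (k j) : (fun d ↦ S' d k j) ∈ regularFun (openSub _ E) := by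
      have := Gr.coord_mem_regularFun (j₁ ≫ g) (fun d ↦ by
        have := hg (hS' d)
        rwa [Category.assoc] at this) (fun d ↦ isDualBasis_graphVec f (S' d)) k (yCoord K f j)
      simpa using this
    obtain ⟨x₁, hx₁⟩ := exists_kPoint_lift j₁ x ((range_openSubι E).ge
      ((Gr.pt_mem_dualOpen_iff (hg hp)).mpr ⟨_, isDualBasis_graphVec f S⟩))
    have hTreg (k j) : (fun d ↦ ((S' d).map (· ^ Fintype.card κ) - S' d) k j) ∈
        regularFun (openSub _ E) :=
      sub_mem_regularFun (pow_mem_regularFun (hreg k j) _) (hreg k j)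
    obtain ⟨E', hE'⟩ := exists_opens_of_regularFun (hTreg i i)
    have hx₁E' : x₁.pt ∈ E' := by
      rw [hE']
      have : S' x₁ = S := graph_injective f ((hS' x₁).eq (by rw [hx₁]; exact hp))
      rwa [this]
    -- `exists_hom_of_chart` asks for an affine source.
    obtain ⟨D, hD, hxD, hDE⟩ := exists_isAffineOpen_mem_and_subset hx₁E'
    let j₂ := openSubι (openSub _ E) D
    have : IsAffine (openSub (openSub (openSub _ W) E) D).left := hD
    have hne (d : KPoint (openSub _ D)) :
        ((S' (d ≫ j₂)).map (· ^ Fintype.card κ) - S' (d ≫ j₂)) i i ≠ 0 :=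
      (hE' _).mp (hDE (pt_mem_of_openSub d))
    obtain ⟨a, ha⟩ := exists_hom_of_chart (f := f) (i := i) hω hf e
      (X := openSub (openSub (openSub _ W) E) D)
      (S := fun d ↦ S' (d ≫ j₂))
      (l := fun d k ↦ ((S' (d ≫ j₂)).map (· ^ Fintype.card κ) - S' (d ≫ j₂)) k i *
        (((S' (d ≫ j₂)).map (· ^ Fintype.card κ) - S' (d ≫ j₂)) i i)⁻¹)
      (fun k j ↦ comp_mem_regularFun (hreg k j) j₂)
      (fun k ↦ mul_mem_regularFun (comp_mem_regularFun (hTreg k i) j₂)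
        (inv_mem_regularFun (comp_mem_regularFun (hTreg i i) j₂) hne))
      (fun d ↦ (exists_rank_one hn hω hω' hf (hS' _)).1)
      (fun d ↦ mul_inv_cancel₀ (hne d))
      (fun d k j ↦ by
        obtain ⟨-, c, l, hcl⟩ := exists_rank_one hn hω hω' hf (hS' (d ≫ j₂))
        have h0 := hne d
        -- The vanishing of a `2 × 2` minor of a matrix of rank at most one, together with symmetry.
        have h1 : ((S' (d ≫ j₂)).map (· ^ Fintype.card κ) - S' (d ≫ j₂)) k j *
            ((S' (d ≫ j₂)).map (· ^ Fintype.card κ) - S' (d ≫ j₂)) i i =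
            ((S' (d ≫ j₂)).map (· ^ Fintype.card κ) - S' (d ≫ j₂)) k i *
            ((S' (d ≫ j₂)).map (· ^ Fintype.card κ) - S' (d ≫ j₂)) j i := by
          rw [hcl, hcl, hcl, hcl]
          ring
        field_simp
        exact h1)
    refine ⟨_, j₂ ≫ j₁, inferInstanceAs (IsOpenImmersion (j₂.left ≫ j₁.left)), a, ?_, fun d ↦ ?_⟩
    · obtain ⟨x₂, hx₂⟩ := exists_kPoint_lift j₂ x₁ ((range_openSubι D).ge hxD)
      exact ⟨x₂.pt, by rw [← hx₁, ← hx₂, Category.assoc]; rfl⟩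
    · symm
      refine projection_injective hn hω hω' hπ (by rw [hF]; exact hrat _) ?_
      rw [hF]
      refine SV.IsPoint.point_eq ?_ (isPoint_projection hπ (ha d).isPoint)
      have := hS' (d ≫ j₂)
      rwa [Category.assoc] at this
  refine ⟨s, hom_ext_of_kPoint fun x ↦ ?_⟩
  rw [← Category.assoc, hs, hF]

theorem isIso_projection (hn : n = 2 * (r + 1)) (hω : ω.IsAlt) (hω' : ω.Nondegenerate)
    (hπ : π ≫ SV.ι K e ω (r + 1) = YV.ι K e ω (r + 1) ≫ prodFst _ _)
    {W : (SV K e ω (r + 1)).left.Opens} (hW : (W : Set (SV K e ω (r + 1)).left) =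
      {s | ∃ x : KPoint (SV K e ω (r + 1)), SV.IsRational K e x ∧ x.pt = s}ᶜ) :
    IsIso (π.left ∣_ W) := by
  obtain ⟨s, hs⟩ := exists_section_of_projection hn hω hω' hπ hW
  exact isIso_morphismRestrict_of_section π W s hs fun x x' hx h ↦
    projection_injective hn hω hω' hπ (fun hr ↦ hW.le hx ⟨_, hr, rfl⟩) h

end Isomorphism

/-! ### The Segre embedding -/

section Segre

variable {K : Type u} [Field K] {σ τ ρ : Type} {X Y : SchOver K}

/-- The homogeneous coordinates of the Segre embedding. -/
def segre (c : ρ ≃ σ × τ) (v : σ → K) (w : τ → K) : ρ → K := fun k ↦ v (c k).1 * w (c k).2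

theorem segre_ne_zero (c : ρ ≃ σ × τ) {v : σ → K} {w : τ → K} (hv : v ≠ 0) (hw : w ≠ 0) :
    segre c v w ≠ 0 := by
  obtain ⟨a, ha⟩ := Function.ne_iff.mp hv
  obtain ⟨b, hb⟩ := Function.ne_iff.mp hw
  refine Function.ne_iff.mpr ⟨c.symm (a, b), ?_⟩
  simpa [segre] using ⟨ha, hb⟩

theorem ne_zero_of_comp_projChartι {j : σ}
    {d : KPoint (projChart (MvPolynomial.X j : MvPolynomial σ K))} {v : σ → K} {hv : v ≠ 0}
    (h : d ≫ projChartι (X_mem j) one_pos = projPoint v hv) : v j ≠ 0 := by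
  have h1 : (projPoint v hv).pt ∈ Proj.basicOpen (MvPolynomial.homogeneousSubmodule σ K)
      (MvPolynomial.X j) := by
    rw [← h]
    exact (range_projChartι (X_mem (K := K) j) one_pos).le ⟨_, (KPoint.pt_comp d _).symm⟩
  simpa using (projPoint_mem_basicOpen_iff v hv (X_mem j) one_pos).mp h1

theorem projPoint_eq_of_smul {v w : σ → K} {hv : v ≠ 0} {hw : w ≠ 0} {c : K} (hc : c ≠ 0)
    (h : ∀ i, v i * c = w i) : projPoint v hv = projPoint w hw :=
  (projPoint_eq_iff hv hw).mpr ⟨c, hc, funext fun i ↦ by simp [← h, mul_comm]⟩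

variable [IsAlgClosed K]

/-- Where coordinate `a` of `p` and coordinate `b` of `q` do not vanish, all coordinate ratios are
functions, and their products are the Segre coordinates up to a common nonzero factor. Other choices
of homogeneous coordinates change the result by a scalar only, so the pieces glue. -/
theorem exists_hom_segre (c : ρ ≃ σ × τ) [Finite ρ]
    [LocallyOfFiniteType X.hom] [IsReduced X.left]
    (p : X ⟶ projSpace K σ) (q : X ⟶ projSpace K τ) :
    ∃ j : X ⟶ projSpace K ρ, ∀ (x : KPoint X) v hv w hw, x ≫ p = projPoint v hv →
      x ≫ q = projPoint w hw → x ≫ j = projPoint (segre c v w) (segre_ne_zero c hv hw) := by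
  choose v hv hxv using fun x : KPoint X ↦ exists_eq_projPoint (x ≫ p)
  choose w hw hxw using fun x : KPoint X ↦ exists_eq_projPoint (x ≫ q)
  obtain ⟨j, hj⟩ := exists_hom_of_local
    (fun x ↦ projPoint (segre c (v x) (w x)) (segre_ne_zero c (hv x) (hw x))) fun x ↦ by
    obtain ⟨a, ha⟩ := Function.ne_iff.mp (hv x)
    obtain ⟨b, hb⟩ := Function.ne_iff.mp (hw x)
    let U : X.left.Opens :=
      p.left ⁻¹ᵁ Proj.basicOpen (MvPolynomial.homogeneousSubmodule σ K) (MvPolynomial.X a) ⊓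
      q.left ⁻¹ᵁ Proj.basicOpen (MvPolynomial.homogeneousSubmodule τ K) (MvPolynomial.X b)
    have hU (y : KPoint X) : y.pt ∈ U ↔ v y a ≠ 0 ∧ w y b ≠ 0 := by
      have h1 := projPoint_mem_basicOpen_iff _ (hv y) (X_mem a) one_pos
      have h2 := projPoint_mem_basicOpen_iff _ (hw y) (X_mem b) one_pos
      rw [← hxv, MvPolynomial.eval_X] at h1
      rw [← hxw, MvPolynomial.eval_X] at h2
      exact and_congr h1 h2
    obtain ⟨D, hD, hxD, hDU⟩ := exists_isAffineOpen_mem_and_subset ((hU x).mpr ⟨ha, hb⟩)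
    have : IsAffine (openSub X D).left := hD
    have hne (d : KPoint (openSub X D)) := (hU (d ≫ openSubι X D)).mp (hDU (pt_mem_of_openSub d))
    have hne₁ (d : KPoint (openSub X D)) v' hv' (h : d ≫ openSubι X D ≫ p = projPoint v' hv') :
        MvPolynomial.eval v' (MvPolynomial.X a) ≠ 0 := by
      rw [← Category.assoc, hxv, projPoint_eq_iff] at h
      obtain ⟨e, he, rfl⟩ := h
      simpa using ⟨he, (hne d).1⟩
    have hne₂ (d : KPoint (openSub X D)) v' hv' (h : d ≫ openSubι X D ≫ q = projPoint v' hv') :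
        MvPolynomial.eval v' (MvPolynomial.X b) ≠ 0 := by
      rw [← Category.assoc, hxw, projPoint_eq_iff] at h
      obtain ⟨e, he, rfl⟩ := h
      simpa using ⟨he, (hne d).2⟩
    choose s hs using fun i ↦ exists_section_div (openSubι X D ≫ p) one_pos (X_mem a) (X_mem i) hne₁
    choose t ht using fun i ↦ exists_section_div (openSubι X D ≫ q) one_pos (X_mem b) (X_mem i) hne₂
    have key (d : KPoint (openSub X D)) (k : ρ) : val d (s (c k).1 * t (c k).2) *
        (v (d ≫ openSubι X D) a * w (d ≫ openSubι X D) b) =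
        segre c (v (d ≫ openSubι X D)) (w (d ≫ openSubι X D)) k := by
      have h1 := hs (c k).1 d _ (hv (d ≫ openSubι X D)) (by rw [← hxv, Category.assoc])
      have h2 := ht (c k).2 d _ (hw (d ≫ openSubι X D)) (by rw [← hxw, Category.assoc])
      simp only [MvPolynomial.eval_X] at h1 h2
      rw [segre, ← h1, ← h2, map_mul]
      ring
    have hne' (d : KPoint (openSub X D)) :
        v (d ≫ openSubι X D) a * w (d ≫ openSubι X D) b ≠ 0 := mul_ne_zero (hne d).1 (hne d).2
    have hk (d : KPoint (openSub X D)) : ∃ k, val d (s (c k).1 * t (c k).2) ≠ 0 := by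
      by_contra! h0
      refine segre_ne_zero c (hv (d ≫ openSubι X D)) (hw (d ≫ openSubι X D)) (funext fun k ↦ ?_)
      rw [← key, h0, zero_mul]
      rfl
    obtain ⟨f, hf⟩ := exists_hom_projSpace (fun k ↦ s (c k).1 * t (c k).2) hk
    refine ⟨_, openSubι X D, inferInstance, f, (range_openSubι D).ge hxD, fun d ↦ ?_⟩
    obtain ⟨k, hk⟩ := hk d
    rw [hf d (Function.ne_iff.mpr ⟨k, hk⟩)]
    exact projPoint_eq_of_smul (hne' d) (key d)
  refine ⟨j, fun x v' hv' w' hw' hp hq ↦ ?_⟩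
  rw [hxv, projPoint_eq_iff] at hp
  rw [hxw, projPoint_eq_iff] at hq
  obtain ⟨a, ha, rfl⟩ := hp
  obtain ⟨b, hb, rfl⟩ := hq
  rw [hj]
  exact projPoint_eq_of_smul (mul_ne_zero ha hb) fun k ↦ by
    simp only [segre, Pi.smul_apply, smul_eq_mul]
    ring

/-- Coordinates on a standard chart. -/
theorem exists_hom_projChart [Finite ρ] (k : ρ) (g : σ → ρ) (a : σ) (ha : g a = k) :
    ∃ f : projChart (MvPolynomial.X k : MvPolynomial ρ K) ⟶ projSpace K σ,
      ∀ (x : KPoint (projChart (MvPolynomial.X k : MvPolynomial ρ K))) z hz hz',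
        x ≫ projChartι (X_mem k) one_pos = projPoint z hz →
          x ≫ f = projPoint (fun i ↦ z (g i)) hz' := by
  have := locallyOfFiniteType_projChart (X_mem (K := K) k) one_pos
  have : IsAffine (projChart (MvPolynomial.X k : MvPolynomial ρ K)).left :=
    inferInstanceAs (IsAffine (Spec _))
  have hne (d : KPoint (projChart (MvPolynomial.X k : MvPolynomial ρ K))) v hv
      (h : d ≫ projChartι (X_mem k) one_pos = projPoint v hv) :
      MvPolynomial.eval v (MvPolynomial.X k) ≠ 0 := by
    rw [MvPolynomial.eval_X]
    exact ne_zero_of_comp_projChartι h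
  choose s hs using fun i ↦ exists_section_div (projChartι (X_mem (K := K) k) one_pos) one_pos
    (X_mem k) (X_mem (g i)) hne
  simp only [MvPolynomial.eval_X] at hs
  have hs0 (x : KPoint (projChart (MvPolynomial.X k : MvPolynomial ρ K))) :
      ∃ i, val x (s i) ≠ 0 := by
    obtain ⟨v, hv, hx⟩ := exists_eq_projPoint (x ≫ projChartι (X_mem (K := K) k) one_pos)
    have h1 := hs a x v hv hx
    rw [ha] at h1
    exact ⟨a, fun h0 ↦ ne_zero_of_comp_projChartι hx (by rw [← h1, h0, zero_mul])⟩
  obtain ⟨f, hf⟩ := exists_hom_projSpace s hs0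
  refine ⟨f, fun x z hz hz' h ↦ ?_⟩
  obtain ⟨i, hi⟩ := hs0 x
  rw [hf x (Function.ne_iff.mpr ⟨i, hi⟩)]
  exact projPoint_eq_of_smul (ne_zero_of_comp_projChartι h) fun i ↦ hs i x z hz h

/-- A proper variety with a closed immersion into a product of projective spaces is projective. -/
theorem isProjectiveOver_of_prod {d : ℕ} (c : Fin (d + 1) ≃ σ × τ) [Finite σ] [Finite τ]
    [IsProper X.hom] [IsReduced X.left]
    (i : X ⟶ prodOver (projSpace K σ) (projSpace K τ)) [IsClosedImmersion i.left] :
    IsProjectiveOver X := by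
  obtain ⟨j, hj⟩ := exists_hom_segre c (i ≫ prodFst _ _) (i ≫ prodSnd _ _)
  refine ⟨d, j, (IsClosedImmersion.iff_isProper_and_mono _).mpr ⟨?_, ?_⟩⟩
  · have : IsProper (j.left ≫ (projSpace K (Fin (d + 1))).hom) := by rw [Over.w j]; infer_instance
    exact IsProper.of_comp j.left (projSpace K (Fin (d + 1))).hom
  have hk (x : KPoint (projSpace K (Fin (d + 1)))) :
      ∃ k, x.pt ∈ Set.range (projChartι (X_mem (K := K) k) one_pos).left := by
    obtain ⟨k, hk⟩ := TopologicalSpace.Opens.mem_iSup.mp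
      ((iSup_basicOpen_X (K := K) (σ := Fin (d + 1))).ge (Set.mem_univ x.pt))
    exact ⟨k, (range_projChartι (X_mem k) one_pos).ge hk⟩
  choose k hk using hk
  let 𝒰 := kPointCover (fun x ↦ projChart (MvPolynomial.X (k x) : MvPolynomial (Fin (d + 1)) K))
    (fun x ↦ projChartι (X_mem (k x)) one_pos) fun x ↦ ⟨x, hk x⟩
  -- A proper monomorphism is a closed immersion, and being a monomorphism may be tested over the
  -- standard charts.
  refine IsZariskiLocalAtTarget.of_openCover (P := MorphismProperty.monomorphisms Scheme.{u}) 𝒰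
    fun x ↦ ?_
  change Mono (pullback.snd j.left (projChartι (X_mem (K := K) (k x)) one_pos).left)
  generalize k x = k
  have := locallyOfFiniteType_projChart (X_mem (K := K) k) one_pos
  obtain ⟨⟨a, b⟩, rfl⟩ := c.symm.surjective k
  -- On the chart where `v a * w b ≠ 0`, the products with second index `b` recover `v` up to scalar
  -- and those with first index `a` recover `w`: a local inverse of the Segre map.
  obtain ⟨r₁, hr₁⟩ := exists_hom_projChart (K := K) (c.symm (a, b)) (fun i ↦ c.symm (i, b)) a rfl
  obtain ⟨r₂, hr₂⟩ := exists_hom_projChart (K := K) (c.symm (a, b)) (fun i ↦ c.symm (a, i)) b rfl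
  let T : SchOver K := Over.mk
    (pullback.fst j.left (projChartι (X_mem (K := K) (c.symm (a, b))) one_pos).left ≫ X.hom)
  let p₁ : T ⟶ X := Over.homMk (pullback.fst _ _) rfl
  let p₂ : T ⟶ projChart (MvPolynomial.X (c.symm (a, b))) := Over.homMk (pullback.snd _ _) (by
    change _ = pullback.fst _ _ ≫ X.hom
    rw [← Over.w j, ← Over.w (projChartι (X_mem (K := K) (c.symm (a, b))) one_pos),
      pullback.condition_assoc])
  have hp : p₁ ≫ j = p₂ ≫ projChartι (X_mem (K := K) (c.symm (a, b))) one_pos :=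
    Over.OverMorphism.ext pullback.condition
  have : IsOpenImmersion p₁.left := inferInstanceAs (IsOpenImmersion (pullback.fst _ _))
  have : IsReduced T.left := isReduced_of_isOpenImmersion p₁.left
  have : LocallyOfFiniteType T.hom := inferInstanceAs (LocallyOfFiniteType (p₁.left ≫ X.hom))
  -- The right side is a monomorphism, so `p₂` is one too.
  have key : p₂ ≫ prodLift r₁ r₂ = p₁ ≫ i := hom_ext_of_kPoint fun t ↦ by
    obtain ⟨v, hv, h1⟩ := exists_eq_projPoint ((t ≫ p₁) ≫ i ≫ prodFst _ _)
    obtain ⟨w, hw, h2⟩ := exists_eq_projPoint ((t ≫ p₁) ≫ i ≫ prodSnd _ _)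
    have h3 := hj (t ≫ p₁) v hv w hw h1 h2
    rw [Category.assoc, hp, ← Category.assoc] at h3
    have h4 := ne_zero_of_comp_projChartι h3
    simp only [segre, Equiv.apply_symm_apply, ne_eq, mul_eq_zero, not_or] at h4
    apply prod_hom_ext
    · refine Eq.trans ?_ ((hr₁ (t ≫ p₂) _ _ (Function.ne_iff.mpr ⟨a, ?_⟩) h3).trans ?_)
      · simp only [Category.assoc, prodLift_fst]
      · simpa [segre] using h4
      · refine Eq.trans ?_ (h1.symm.trans (by simp only [Category.assoc]))
        exact (projPoint_eq_of_smul h4.2 fun i ↦ by simp [segre]).symm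
    · refine Eq.trans ?_ ((hr₂ (t ≫ p₂) _ _ (Function.ne_iff.mpr ⟨b, ?_⟩) h3).trans ?_)
      · simp only [Category.assoc, prodLift_snd]
      · simpa [segre] using h4
      · refine Eq.trans ?_ (h2.symm.trans (by simp only [Category.assoc]))
        exact (projPoint_eq_of_smul h4.1 fun i ↦ by simp [segre, mul_comm]).symm
  have h1 : p₂.left ≫ (prodLift r₁ r₂).left = p₁.left ≫ i.left := congr_arg Over.Hom.left key
  have : Mono (p₂.left ≫ (prodLift r₁ r₂).left) := by
    rw [h1]
    infer_instance
  exact mono_of_mono p₂.left (prodLift r₁ r₂).left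

variable {κ : Type*} [Field κ] [Fintype κ] [Algebra κ K]
  {V : Type*} [AddCommGroup V] [Module κ V] {n : ℕ}

/-- The two Plücker maps together form a monomorphism on `Y_V`, and `Y_V` is proper, so they give a
closed immersion in a product of projective spaces. -/
theorem isProjectiveOver_YV [NeZero n] (e : Module.Basis (Fin n) κ V)
    (ω : LinearMap.BilinForm κ V) (m : ℕ) : IsProjectiveOver (YV K e ω m) := by
  let p : YV K e ω m ⟶ projSpace K (Fin m → Fin n) :=
    (YV.ι K e ω m ≫ prodFst _ _) ≫ LV.ι K e ω m ≫ Gr.ι K e m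
  let q : YV K e ω m ⟶ projSpace K (Fin (m - 1) → Fin n) :=
    (YV.ι K e ω m ≫ prodSnd _ _) ≫ Gr.ι K e (m - 1)
  have : IsProper (prodOver (LV K e ω m) (Gr K e (m - 1))).hom :=
    inferInstanceAs (IsProper (pullback.fst (LV K e ω m).hom (Gr K e (m - 1)).hom ≫ (LV K e ω m).hom))
  have : IsProper (YV K e ω m).hom := inferInstanceAs (IsProper (subvariety _ _).hom)
  have : Mono (prodLift p q) := ⟨fun f g h ↦ by
    have h1 := congr_arg (· ≫ prodFst _ _) h
    have h2 := congr_arg (· ≫ prodSnd _ _) h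
    simp only [Category.assoc, prodLift_fst, prodLift_snd] at h1 h2
    simp only [p, q, ← Category.assoc, cancel_mono] at h1 h2
    rw [← cancel_mono (YV.ι K e ω m)]
    exact prod_hom_ext h1 h2⟩
  have : Mono (prodLift p q).left := Over.mono_left_of_mono _
  have : IsProper ((prodLift p q).left ≫ (prodOver _ _).hom) := by
    rw [Over.w]
    infer_instance
  have : IsProper (prodLift p q).left := IsProper.of_comp _ (prodOver _ _).hom
  have : IsClosedImmersion (prodLift p q).left :=
    (IsClosedImmersion.iff_isProper_and_mono _).mpr ⟨inferInstance, inferInstance⟩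
  -- `n ≠ 0` makes both sets of tuples nonempty, so their product can be indexed by some `Fin (d +
  -- 1)`.
  have hpos : 0 < Fintype.card ((Fin m → Fin n) × (Fin (m - 1) → Fin n)) := Fintype.card_pos
  exact isProjectiveOver_of_prod ((finCongr (Nat.sub_add_cancel hpos)).trans
    (Fintype.equivFin _).symm) (prodLift p q)

end Segre

/-! ### Hyperplanes of a graph correspond to linear forms up to scalars -/

section Hyper

variable {κ : Type*} [Field κ] {K : Type*} [Field K] [Algebra κ K]
  {V : Type*} [AddCommGroup V] [Module κ V] {r : ℕ}
  (f : Module.Basis (Fin (r + 1) ⊕ Fin (r + 1)) κ V)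
  {S : Matrix (Fin (r + 1)) (Fin (r + 1)) K} {i j : Fin (r + 1)} {l l' : Fin (r + 1) → K}

theorem sum_mul_xCoord_graphVec (l : Fin (r + 1) → K) (a : Fin (r + 1)) :
    ∑ k, l k * xCoord K f k (graphVec f S a) = l a := by
  simp [Matrix.one_apply]

theorem mem_hyper_iff (hl : l i = 1) {v : K ⊗[κ] V} :
    v ∈ hyper f S i l ↔ v ∈ graph f S ∧ ∑ k, l k * xCoord K f k v = 0 := by
  let φ : Module.Dual K (K ⊗[κ] V) := ∑ k, l k • xCoord K f k
  have hφ (v : K ⊗[κ] V) : φ v = ∑ k, l k * xCoord K f k v := by simp [φ]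
  constructor
  · intro hv
    refine ⟨hyper_le_graph f S i l hv, ?_⟩
    rw [← hφ, ← LinearMap.mem_ker]
    refine (Submodule.span_le.mpr ?_ : hyper f S i l ≤ LinearMap.ker φ) hv
    rintro _ ⟨k, rfl⟩
    rw [SetLike.mem_coe, LinearMap.mem_ker, hyperVec, map_sub, map_smul, hφ, hφ,
      sum_mul_xCoord_graphVec, sum_mul_xCoord_graphVec, hl, smul_eq_mul, mul_one, sub_self]
  · rintro ⟨hv, h0⟩
    have hw := isDualBasis_hyperVec f S i l
    have h1 : ∑ k, xCoordNe K f i k v • hyperVec f S i l k ∈ hyper f S i l :=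
      Submodule.sum_mem _ fun k _ ↦ Submodule.smul_mem _ _ (hw.mem k)
    have h2 : v = ∑ k, xCoordNe K f i k v • hyperVec f S i l k := by
      rw [← sub_eq_zero]
      refine (isDualBasis_graphVec f S).eq_zero
        (Submodule.sub_mem _ hv (hyper_le_graph f S i l h1)) fun k ↦ ?_
      rw [map_sub, map_sum]
      simp only [map_smul, smul_eq_mul]
      induction k using Fin.succAboveCases i with
      | x =>
        rw [Fin.sum_univ_succAbove _ i, hl, one_mul] at h0
        simp only [xCoord_hyperVec, mul_neg, Finset.sum_neg_distrib, sub_neg_eq_add]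
        rw [← h0]
        simp only [xCoordNe, mul_comm]
      | p k =>
        have h3 (a : Fin r) : xCoord K f (i.succAbove k) (hyperVec f S i l a) =
          (1 : Matrix (Fin r) (Fin r) K) a k := hw.2 a k
        simp [h3, Matrix.one_apply, xCoordNe]
    rw [h2]
    exact h1

/-- Forms with the same kernel are proportional. This independence of the normalizing index lets the
charts over a rational point glue to a projective space. -/
theorem hyper_eq_hyper_iff (hl : l i = 1) (hl' : l' j = 1) :
    hyper f S i l = hyper f S j l' ↔ ∃ c : K, c ≠ 0 ∧ l' = c • l := by
  constructor
  · intro h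
    have h1 : l' = l' i • l := by
      funext k
      -- This vector lies in the kernel of `l` because `l i = 1`; that `l'` also kills it reads `l'
      -- k = l' i * l k`.
      have h2 : graphVec f S k - l k • graphVec f S i ∈ hyper f S i l := by
        refine (mem_hyper_iff f hl).mpr ⟨Submodule.sub_mem _ (graphVec_mem f k)
          (Submodule.smul_mem _ _ (graphVec_mem f i)), ?_⟩
        simp only [map_sub, map_smul, smul_eq_mul, mul_sub, Finset.sum_sub_distrib,
          sum_mul_xCoord_graphVec, mul_left_comm _ (l k), ← Finset.mul_sum, hl]
        ring
      rw [h, mem_hyper_iff f hl'] at h2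
      have h3 := h2.2
      simp only [map_sub, map_smul, smul_eq_mul, mul_sub, Finset.sum_sub_distrib,
          sum_mul_xCoord_graphVec, mul_left_comm _ (l k), ← Finset.mul_sum] at h3
      rw [Pi.smul_apply, smul_eq_mul]
      linear_combination h3
    refine ⟨l' i, fun h0 ↦ ?_, h1⟩
    rw [h1, h0] at hl'
    simp at hl'
  · rintro ⟨c, hc, rfl⟩
    ext v
    simp only [mem_hyper_iff f hl, mem_hyper_iff f hl', Pi.smul_apply, smul_eq_mul, mul_assoc,
      ← Finset.mul_sum, mul_eq_zero, hc, false_or]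

end Hyper

/-! ### Fibres over `K`-points -/

section Fibre

variable {K : Type u} [Field K] {X Y T : SchOver K}

/-- The structure morphism, as a morphism over the base. -/
def toPt (T : SchOver K) : T ⟶ Over.mk (𝟙 (Spec (CommRingCat.of K))) :=
  Over.homMk T.hom (Category.comp_id _)

theorem comp_toPt (f : X ⟶ Y) : f ≫ toPt Y = toPt X :=
  Over.OverMorphism.ext (Over.w f)

theorem kPoint_comp_toPt (x : KPoint X) : x ≫ toPt X = 𝟙 _ :=
  Over.OverMorphism.ext (Over.w x)

theorem appTop_toPt_comp (x : KPoint X) (s : Γ(X.left, ⊤)) :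
    (toPt T ≫ x).left.appTop s = scalarHom T (val x s) := by
  have h : x.left.appTop s = (Scheme.ΓSpecIso (CommRingCat.of K)).inv (val x s) :=
    congr($((Scheme.ΓSpecIso (CommRingCat.of K)).hom_inv_id) (x.left.appTop s)).symm
  change T.hom.appTop (x.left.appTop s) = _
  rw [h]
  rfl

/-- The inclusion of a fibre. -/
def fibreι (f : X ⟶ Y) (y : KPoint Y) : fibreOver f y ⟶ X :=
  Over.homMk (pullback.fst f.left y.left) (by
    have h : pullback.fst f.left y.left ≫ X.hom = pullback.snd f.left y.left ≫ y.left ≫ Y.hom := by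
      rw [← Over.w f, pullback.condition_assoc]
    exact h.trans ((congr_arg (_ ≫ ·) (Over.w y)).trans (Category.comp_id _)))

theorem fibreι_comp (f : X ⟶ Y) (y : KPoint Y) : fibreι f y ≫ f = toPt _ ≫ y :=
  Over.OverMorphism.ext pullback.condition

theorem exists_lift_fibre (f : X ⟶ Y) (y : KPoint Y) (g : T ⟶ X) (h : g ≫ f = toPt T ≫ y) :
    ∃ k : T ⟶ fibreOver f y, k ≫ fibreι f y = g :=
  ⟨Over.homMk (pullback.lift g.left T.hom (congr_arg Over.Hom.left h)) (pullback.lift_snd _ _ _),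
    Over.OverMorphism.ext (pullback.lift_fst _ _ _)⟩

instance (f : X ⟶ Y) (y : KPoint Y) : Mono (fibreι f y) := by
  have h : y.left ≫ Y.hom = 𝟙 _ := Over.w y
  have : Mono (y.left ≫ Y.hom) := by rw [h]; infer_instance
  have : Mono y.left := mono_of_mono y.left Y.hom
  have : Mono (fibreι f y).left := inferInstanceAs (Mono (pullback.fst f.left y.left))
  exact Over.mono_of_mono_left _

instance (f : X ⟶ Y) (y : KPoint Y) [LocallyOfFiniteType X.hom] :
    LocallyOfFiniteType (fibreOver f y).hom := by
  have : LocallyOfFiniteType (f.left ≫ Y.hom) := by rw [Over.w f]; infer_instance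
  have : LocallyOfFiniteType f.left := locallyOfFiniteType_of_comp f.left Y.hom
  exact inferInstanceAs (LocallyOfFiniteType (pullback.snd f.left y.left))

variable [IsAlgClosed K]

/-- A morphism from a variety is an isomorphism if it has local sections and is injective on
points. -/
theorem isIso_of_local_section [LocallyOfFiniteType X.hom] [IsReduced X.left] [IsSeparated X.hom]
    [LocallyOfFiniteType Y.hom] (p : X ⟶ Y)
    (h : ∀ y : KPoint Y, ∃ (D : SchOver K) (j : D ⟶ Y) (_ : IsOpenImmersion j.left) (s : D ⟶ X),
      y.pt ∈ Set.range j.left ∧ s ≫ p = j)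
    (hinj : ∀ x x' : KPoint X, x ≫ p = x' ≫ p → x = x') : IsIso p.left := by
  choose D j hj s hy hs using h
  let 𝒰 := kPointCover D j fun y ↦ ⟨y, hy y⟩
  refine IsZariskiLocalAtTarget.of_openCover (P := MorphismProperty.isomorphisms Scheme.{u}) 𝒰
    fun (y : KPoint Y) ↦ ?_
  change IsIso (pullback.snd p.left (j y).left)
  let T : SchOver K := Over.mk (pullback.fst p.left (j y).left ≫ X.hom)
  let p₁ : T ⟶ X := Over.homMk (pullback.fst _ _) rfl
  let p₂ : T ⟶ D y := Over.homMk (pullback.snd _ _) (by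
    change _ = pullback.fst _ _ ≫ X.hom
    rw [← Over.w p, ← Over.w (j y), pullback.condition_assoc])
  have hp : p₁ ≫ p = p₂ ≫ j y := Over.OverMorphism.ext pullback.condition
  have : IsOpenImmersion p₁.left := inferInstanceAs (IsOpenImmersion (pullback.fst _ _))
  have : IsReduced T.left := isReduced_of_isOpenImmersion p₁.left
  have : LocallyOfFiniteType T.hom := inferInstanceAs (LocallyOfFiniteType (p₁.left ≫ X.hom))
  -- `T` is open in the reduced scheme `X`, so injectivity of `p` on points suffices. No reducedness
  -- of `Y` is used.
  have key : p₂ ≫ s y = p₁ := hom_ext_of_kPoint fun t ↦ hinj _ _ (by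
    rw [Category.assoc, Category.assoc, Category.assoc, hs, hp])
  have hlift : (s y).left ≫ p.left = 𝟙 _ ≫ (j y).left := by
    rw [Category.id_comp]
    exact congr_arg Over.Hom.left (hs y)
  refine ⟨pullback.lift (s y).left (𝟙 _) hlift, ?_, pullback.lift_snd _ _ _⟩
  apply pullback.hom_ext
  · rw [Category.assoc, pullback.lift_fst, Category.id_comp]
    exact congr_arg Over.Hom.left key
  · rw [Category.assoc, pullback.lift_snd, Category.id_comp, Category.comp_id]

end Fibre

/-! ### The scheme-theoretic fibre over a rational point -/

section RationalFibre

variable {κ : Type*} [Field κ] [Fintype κ] {K : Type u} [Field K] [Algebra κ K] [IsAlgClosed K]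
  {V : Type*} [AddCommGroup V] [Module κ V] {n r : ℕ} {e : Module.Basis (Fin n) κ V}
  {ω : LinearMap.BilinForm κ V} {f : Module.Basis (Fin (r + 1) ⊕ Fin (r + 1)) κ V}
  {S₀ : Matrix (Fin (r + 1)) (Fin (r + 1)) K}

/-- The points over a rational point, on a standard chart of projective space. -/
theorem exists_hom_projChart_YV (hω : ω.IsAlt) (hf : IsSymplecticBasis ω f)
    (e : Module.Basis (Fin n) κ V) (hS : S₀.IsSymm) (hS' : S₀.map (· ^ Fintype.card κ) = S₀)
    (i : Fin (r + 1)) :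
    ∃ β : projChart (MvPolynomial.X i : MvPolynomial (Fin (r + 1)) K) ⟶ YV K e ω (r + 1),
      ∀ (d : KPoint (projChart (MvPolynomial.X i : MvPolynomial (Fin (r + 1)) K))) v hv,
        d ≫ projChartι (X_mem i) one_pos = projPoint v hv → v i = 1 →
          IsChartPoint ω f i e (d ≫ β) S₀ v := by
  have := locallyOfFiniteType_projChart (X_mem (K := K) i) one_pos
  have : IsAffine (projChart (MvPolynomial.X i : MvPolynomial (Fin (r + 1)) K)).left :=
    inferInstanceAs (IsAffine (Spec _))
  choose s hs using fun k ↦ exists_section_div (projChartι (X_mem (K := K) i) one_pos) one_pos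
    (X_mem i) (X_mem k) fun d v hv h ↦ by
      rw [MvPolynomial.eval_X]
      exact ne_zero_of_comp_projChartι h
  simp only [MvPolynomial.eval_X] at hs
  obtain ⟨β, hβ⟩ := exists_hom_of_chart (f := f) (i := i) hω hf e
    (X := projChart (MvPolynomial.X i : MvPolynomial (Fin (r + 1)) K))
    (S := fun _ ↦ S₀) (l := fun d k ↦ val d (s k)) (fun k j ↦ const_mem_regularFun _)
    (fun k ↦ val_mem_regularFun _) (fun _ ↦ hS) (fun d ↦ by
      obtain ⟨v, hv, h⟩ := exists_eq_projPoint (d ≫ projChartι (X_mem (K := K) i) one_pos)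
      exact (mul_eq_right₀ (ne_zero_of_comp_projChartι h)).mp (hs i d v hv h))
    (fun d k j ↦ by rw [hS', sub_self]; simp)
  refine ⟨β, fun d v hv h hi ↦ ?_⟩
  have h1 : (fun k ↦ val d (s k)) = v := funext fun k ↦ by
    have := hs k d v hv h
    rwa [hi, mul_one] at this
  exact h1 ▸ hβ d

/-- The points over a rational point form a projective space. -/
theorem exists_hom_projSpace_YV (hω : ω.IsAlt) (hf : IsSymplecticBasis ω f)
    (e : Module.Basis (Fin n) κ V) (hS : S₀.IsSymm) (hS' : S₀.map (· ^ Fintype.card κ) = S₀) :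
    ∃ h : projSpace K (Fin (r + 1)) ⟶ YV K e ω (r + 1),
      ∀ i v hv, v i = 1 → IsChartPoint ω f i e (projPoint v hv ≫ h) S₀ v := by
  choose β hβ using exists_hom_projChart_YV (K := K) hω hf e hS hS'
  have hex (p : KPoint (projSpace K (Fin (r + 1)))) : ∃ i v hv, v i = 1 ∧ p = projPoint v hv := by
    obtain ⟨v, hv, rfl⟩ := exists_eq_projPoint p
    obtain ⟨i, hi⟩ := Function.ne_iff.mp hv
    exact ⟨i, (v i)⁻¹ • v, smul_ne_zero (inv_ne_zero hi) hv, inv_mul_cancel₀ hi,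
      (projPoint_eq_iff _ _).mpr ⟨_, inv_ne_zero hi, rfl⟩⟩
  have hlift (i) (v : Fin (r + 1) → K) hv (hi : v i = 1) :
      ∃ d, d ≫ projChartι (X_mem i) one_pos = projPoint v hv :=
    exists_kPoint_lift _ _ ((range_projChartι (X_mem i) one_pos).ge
      ((projPoint_mem_basicOpen_iff v hv (X_mem i) one_pos).mpr (by simp [hi])))
  have hF (p : KPoint (projSpace K (Fin (r + 1)))) : ∃ y : KPoint (YV K e ω (r + 1)),
      ∀ i v hv, p = projPoint v hv → v i = 1 → IsChartPoint ω f i e y S₀ v := by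
    obtain ⟨j, w, hw, hj, rfl⟩ := hex p
    obtain ⟨d, hd⟩ := hlift j w hw hj
    have h1 := hβ j d w hw hd hj
    -- The point built from the normalization at `j` also serves every other normalization, because
    -- proportional forms define the same hyperplane.
    refine ⟨d ≫ β j, fun i v hv h hi ↦ ⟨hS, hi, fun k j ↦ by rw [hS', sub_self]; simp, ?_⟩⟩
    have h2 := (hyper_eq_hyper_iff f (S := S₀) hj hi).mpr ((projPoint_eq_iff _ _).mp h)
    exact h2 ▸ h1.isPoint
  choose F hF using hF
  obtain ⟨h, hh⟩ := exists_hom_of_local F fun p ↦ by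
    obtain ⟨i, v, hv, hi, rfl⟩ := hex p
    refine ⟨_, projChartι (X_mem i) one_pos, inferInstance, β i, ?_, fun d ↦ ?_⟩
    · obtain ⟨d, hd⟩ := hlift i v hv hi
      exact ⟨KPoint.pt d, by rw [← hd]; rfl⟩
    · obtain ⟨w, hw, hd⟩ := exists_eq_projPoint (d ≫ projChartι (X_mem i) one_pos)
      have hne := ne_zero_of_comp_projChartι hd
      rw [show projPoint w hw = projPoint ((w i)⁻¹ • w) (smul_ne_zero (inv_ne_zero hne) hw) from
        (projPoint_eq_iff _ _).mpr ⟨_, inv_ne_zero hne, rfl⟩] at hd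
      have h1 : ((w i)⁻¹ • w) i = 1 := inv_mul_cancel₀ hne
      exact (hβ i d _ _ hd h1).isPoint.point_eq (hF _ i _ _ hd h1).isPoint
  exact ⟨h, fun i v hv hi ↦ by rw [hh]; exact hF _ i v hv rfl hi⟩

variable {π : YV K e ω (r + 1) ⟶ SV K e ω (r + 1)} {x : KPoint (SV K e ω (r + 1))}
  {B : Type u} [CommRing B] [Algebra K B] [_root_.IsReduced B] [Algebra.FiniteType K B]
  {M : Fin (r + 1) → Fin (r + 1) → B} {L : Fin (r + 1) → B}

/-- On the scheme-theoretic fibre over a point, the entries of the matrix `S` are constant. -/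
theorem appTop_S_eq (hn : n = 2 * (r + 1)) (hω : ω.IsAlt) (hω' : ω.Nondegenerate)
    (hπ : π ≫ SV.ι K e ω (r + 1) = YV.ι K e ω (r + 1) ≫ prodFst _ _)
    (hx : SV.IsPoint K e x (graph f S₀)) {i : Fin (r + 1)}
    {a : specOver K B ⟶ YV K e ω (r + 1)}
    (ha : ∀ c : KPoint (specOver K B), IsChartPoint ω f i e (c ≫ a)
      (Matrix.of fun k j ↦ specVal c (M k j)) fun k ↦ specVal c (L k))
    {T : SchOver K} {b : T ⟶ specOver K B}
    (hb : b ≫ a ≫ π = toPt T ≫ x) (k j : Fin (r + 1)) :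
    b.left.appTop (specΓ (K := K) (M k j)) =
      scalarHom T (S₀ k j) := by
  have := isReduced_specOver (K := K) (B := B)
  have := locallyOfFiniteType_specOver (K := K) (B := B)
  let g := SV.ι K e ω (r + 1) ≫ LV.ι K e ω (r + 1)
  let E : (SV K e ω (r + 1)).left.Opens := g.left ⁻¹ᵁ Gr.dualOpen e (xCoord K f)
  let j₁ := openSubι (SV K e ω (r + 1)) E
  have hg {x : KPoint (SV K e ω (r + 1))} {U} (h : SV.IsPoint K e x U) :
      Gr.IsPoint K e (x ≫ g) U := by
    rwa [SV.IsPoint, LV.IsPoint, Category.assoc] at h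
  have hE (d : KPoint (openSub _ E)) : ∃ S, SV.IsPoint K e (d ≫ j₁) (graph f S) := by
    obtain ⟨U, -, -, h⟩ := SV.exists_isPoint hn hω hω' (d ≫ j₁)
    obtain ⟨w, hw⟩ := (Gr.pt_mem_dualOpen_iff (hg h)).mp (pt_mem_of_openSub d)
    obtain rfl := hw.eq_graph f
    exact ⟨_, h⟩
  have hE' {x : KPoint (SV K e ω (r + 1))} {S} (h : SV.IsPoint K e x (graph f S)) :
      x.pt ∈ Set.range j₁.left := (range_openSubι E).ge
    ((Gr.pt_mem_dualOpen_iff (hg h)).mpr ⟨_, isDualBasis_graphVec f S⟩)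
  choose S hS using hE
  have hreg : (fun d ↦ S d k j) ∈ regularFun (openSub _ E) := by
    have := Gr.coord_mem_regularFun (j₁ ≫ g) (fun d ↦ by
      have := hg (hS d)
      rwa [Category.assoc] at this) (fun d ↦ isDualBasis_graphVec f (S d)) k (yCoord K f j)
    simpa using this
  obtain ⟨s, hs⟩ := mem_regularFun.mp hreg
  have hap (c : KPoint (specOver K B)) :
      SV.IsPoint K e (c ≫ a ≫ π) (graph f
        (Matrix.of fun k j ↦ specVal c (M k j))) := by
    have := isPoint_projection hπ (ha c).isPoint
    rwa [Category.assoc] at this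
  obtain ⟨c, hc⟩ := exists_lift_of_kPoint j₁ (a ≫ π) fun y ↦ hE' (hap y)
  obtain ⟨x₁, hx₁⟩ := exists_kPoint_lift j₁ x (hE' hx)
  -- The entry `M k j` is pulled back from a function `s` on an open part of `S_V`. Since `b`
  -- followed by the projection is the constant map to `x`, the entry becomes the value of `s` at
  -- `x`, even when `T` is not reduced.
  have h1 : c.left.appTop s = specΓ (K := K) (M k j) :=
    section_ext_of_val fun y ↦ by
      rw [← val_comp, hs]
      have h2 := hS (y ≫ c)
      rw [Category.assoc, hc] at h2
      exact congr_fun₂ (graph_injective f (h2.eq (hap y))) k j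
  have := mono_of_isOpenImmersion j₁
  have h2 : b ≫ c = toPt T ≫ x₁ := by
    rw [← cancel_mono j₁, Category.assoc, Category.assoc, hc, hx₁, hb]
  have h3 : S x₁ = S₀ := graph_injective f ((hS x₁).eq (by rw [hx₁]; exact hx))
  rw [← h1]
  have h4 : (b ≫ c).left.appTop s = b.left.appTop (c.left.appTop s) := by
    rw [Over.comp_left, Scheme.Hom.comp_appTop]
    rfl
  rw [← h4, h2, appTop_toPt_comp, hs, h3]

/-- Over a rational point, a chart is determined by the linear form `l`. -/
theorem exists_hom_of_specOver (hn : n = 2 * (r + 1)) (hω : ω.IsAlt) (hω' : ω.Nondegenerate)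
    (hπ : π ≫ SV.ι K e ω (r + 1) = YV.ι K e ω (r + 1) ≫ prodFst _ _)
    (hx : SV.IsPoint K e x (graph f S₀)) {h : projSpace K (Fin (r + 1)) ⟶ YV K e ω (r + 1)}
    (hh : ∀ i v hv, v i = 1 → IsChartPoint ω f i e (projPoint v hv ≫ h) S₀ v)
    {i : Fin (r + 1)} {a : specOver K B ⟶ YV K e ω (r + 1)}
    (hL : L i = 1)
    (hgen : ∀ s : Subring B, (∀ c, algebraMap K B c ∈ s) → (∀ k j, M k j ∈ s) → (∀ k, L k ∈ s) →
      s = ⊤) [IsOpenImmersion a.left] (har : Set.range a.left = chartOpen K e ω f i)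
    (ha : ∀ c : KPoint (specOver K B), IsChartPoint ω f i e (c ≫ a)
      (Matrix.of fun k j ↦ specVal c (M k j)) fun k ↦ specVal c (L k)) :
    ∃ t : specOver K B ⟶ projSpace K (Fin (r + 1)),
      ∀ (T : SchOver K) (b : T ⟶ specOver K B),
        b ≫ a ≫ π = toPt T ≫ x → b ≫ t ≫ h = b ≫ a := by
  have := isReduced_specOver (K := K) (B := B)
  have := locallyOfFiniteType_specOver (K := K) (B := B)
  have hl (c : KPoint (specOver K B)) :
    specVal c (L i) = 1 := by rw [hL, map_one]
  obtain ⟨t, ht⟩ := exists_hom_projSpace (X := specOver K B)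
    (fun k ↦ specΓ (L k)) fun c ↦ ⟨i, by
      change specVal c (L i) ≠ 0
      rw [hl]
      exact one_ne_zero⟩
  have hth (c : KPoint (specOver K B)) :
      IsChartPoint ω f i e (c ≫ t ≫ h) S₀
        fun k ↦ specVal c (L k) := by
    have hv : (fun k ↦ specVal c (L k)) ≠ 0 :=
      Function.ne_iff.mpr ⟨i, by simp [hl]⟩
    have := hh i _ hv (hl c)
    have h1 := ht c hv
    rw [← Category.assoc, h1]
    exact this
  -- On points `ε` is the endomorphism `(S, l) ↦ (S₀, l)` of the chart.
  obtain ⟨ε, hε⟩ := exists_lift_of_kPoint a (t ≫ h) fun c ↦ har.ge (hth c).pt_mem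
  have huniq (c : KPoint (specOver K B)) := by
    have h1 := ha (c ≫ ε)
    rw [Category.assoc, hε] at h1
    exact h1.unique (hth c)
  refine ⟨t, fun T b hb ↦ ?_⟩
  suffices h1 : b ≫ ε = b by rw [← hε, ← Category.assoc, h1]
  -- `T` may be nonreduced, so points do not suffice. The two ring maps are compared on generators:
  -- `ε` fixes `l` and sends `S` to the constant `S₀`, and `b` already sends `S` to that constant.
  have htop : ((((b ≫ ε).left.appTop.hom).eqLocus b.left.appTop.hom).comap specΓ :
      Subring B) = ⊤ := by
    refine hgen _ (fun c ↦ ?_) (fun k j ↦ ?_) fun k ↦ ?_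
    · change (b ≫ ε).left.appTop (specΓ _) = b.left.appTop (specΓ _)
      rw [specΓ_algebraMap, appTop_scalarHom, appTop_scalarHom]
    · change (b ≫ ε).left.appTop (specΓ _) = b.left.appTop (specΓ _)
      rw [appTop_S_eq hn hω hω' hπ hx ha hb, Over.comp_left, Scheme.Hom.comp_appTop]
      have h2 : ε.left.appTop (specΓ (K := K) (M k j)) =
          scalarHom _ (S₀ k j) := section_ext_of_val fun c ↦ by
        rw [← val_comp, val_scalarHom]
        exact congr_fun₂ (huniq c).1 k j
      exact (congr_arg b.left.appTop h2).trans (appTop_scalarHom b _)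
    · change (b ≫ ε).left.appTop (specΓ _) = b.left.appTop (specΓ _)
      rw [Over.comp_left, Scheme.Hom.comp_appTop]
      have h2 : ε.left.appTop (specΓ (K := K) (L k)) =
          specΓ (L k) := section_ext_of_val fun c ↦ by
        rw [← val_comp]
        exact congr_fun (huniq c).2 k
      exact congr_arg b.left.appTop h2
  refine Over.OverMorphism.ext (ext_of_isAffine ?_)
  ext s
  obtain ⟨c, rfl⟩ := specΓ_surjective s
  exact htop.ge (Subring.mem_top c)

/-- Projective space maps to the fibre by letting `l` vary over the fixed matrix `S₀`. The map is
injective on points because hyperplanes determine forms up to scalars, and it has local sections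
because `l` is a function on each chart. The sections are valid on the fibre as a scheme, whose
reducedness comes out as a consequence. -/
theorem nonempty_fibreOver_iso (hn : n = 2 * (r + 1)) (hω : ω.IsAlt) (hω' : ω.Nondegenerate)
    (hπ : π ≫ SV.ι K e ω (r + 1) = YV.ι K e ω (r + 1) ≫ prodFst _ _)
    (hx : SV.IsRational K e x) :
    Nonempty (fibreOver π x ≅ projSpace K (Fin (r + 1))) := by
  obtain ⟨U, hU, -, hxU⟩ := SV.exists_isPoint hn hω hω' x
  obtain ⟨f, S₀, hf, rfl⟩ := exists_symplecticBasis_graph e hn hω hω' hU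
  have hS := (isLagrangian_graph_iff f hω hf).mp hU
  have hS' := (SV.isRational_iff hxU).mp hx
  obtain ⟨h, hh⟩ := exists_hom_projSpace_YV (K := K) hω hf e hS hS'
  have hhp (p : KPoint (projSpace K (Fin (r + 1)))) : ∃ i v hv, v i = 1 ∧ p = projPoint v hv ∧
      IsChartPoint ω f i e (p ≫ h) S₀ v := by
    obtain ⟨v, hv, rfl⟩ := exists_eq_projPoint p
    obtain ⟨i, hi⟩ := Function.ne_iff.mp hv
    have h1 : projPoint v hv = projPoint ((v i)⁻¹ • v) (smul_ne_zero (inv_ne_zero hi) hv) :=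
      (projPoint_eq_iff _ _).mpr ⟨_, inv_ne_zero hi, rfl⟩
    refine ⟨i, _, _, inv_mul_cancel₀ hi, h1, ?_⟩
    rw [h1]
    exact hh i _ _ (inv_mul_cancel₀ hi)
  obtain ⟨g, hg⟩ := exists_lift_fibre π x h (hom_ext_of_kPoint fun p ↦ by
    obtain ⟨i, v, -, -, -, hp⟩ := hhp p
    have h1 := isPoint_projection hπ hp.isPoint
    rw [← Category.assoc, h1.point_eq hxU, ← Category.assoc, kPoint_comp_toPt, Category.id_comp])
  have hinj (p p' : KPoint (projSpace K (Fin (r + 1)))) (hp : p ≫ g = p' ≫ g) : p = p' := by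
    obtain ⟨i, v, hv, hi, rfl, h1⟩ := hhp p
    obtain ⟨j, w, hw, hj, rfl, h2⟩ := hhp p'
    have h3 := congr_arg (· ≫ fibreι π x) hp
    simp only [Category.assoc, hg] at h3
    rw [← h3] at h2
    exact (projPoint_eq_iff hv hw).mpr
      ((hyper_eq_hyper_iff f hi hj).mp (h1.isPoint.eq h2.isPoint).2)
  have : IsIso g.left := isIso_of_local_section g (fun z ↦ by
    obtain ⟨U, U', -, -, hle, hp⟩ := YV.exists_isPoint hn hω hω' (z ≫ fibreι π x)
    have h1 := isPoint_projection hπ hp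
    rw [Category.assoc, fibreι_comp, ← Category.assoc, kPoint_comp_toPt, Category.id_comp] at h1
    obtain rfl := h1.eq hxU
    obtain ⟨i, hi⟩ := exists_pt_mem_chartOpen (hle.trans inf_le_left) hp
    obtain ⟨a', ha', ha⟩ := exists_chart (K := K) hn hω hω' hf e i
    let a := a' ≫ openSubι (YV K e ω (r + 1)) (chartOpen K e ω f i)
    have : IsOpenImmersion a.left :=
      inferInstanceAs (IsOpenImmersion (a'.left ≫ (openSubι _ _).left))
    have har : Set.range a.left = chartOpen K e ω f i := by
      rw [← range_openSubι (chartOpen K e ω f i)]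
      change Set.range ((openSubι _ _).left ∘ a'.left) = _
      rw [Set.range_comp, Set.range_eq_univ.mpr a'.left.surjective, Set.image_univ]
    have := ChartRing.isReduced (i := i) (natCast_card_eq_zero κ K)
    obtain ⟨t, ht⟩ := exists_hom_of_specOver hn hω hω' hπ hxU hh (ChartRing.l_self _ K i)
      (fun _ h1 h2 h3 ↦ ChartRing.subring_eq_top _ h1 h2 h3) har ha
    let D : SchOver K := Over.mk (pullback.fst (fibreι π x).left a.left ≫ (fibreOver π x).hom)
    let p₁ : D ⟶ fibreOver π x := Over.homMk (pullback.fst _ _) rfl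
    let p₂ : D ⟶ specOver K (ChartRing (Fintype.card κ) K i) := Over.homMk (pullback.snd _ _) (by
      change _ = pullback.fst _ _ ≫ (fibreOver π x).hom
      rw [← Over.w (fibreι π x), ← Over.w a, pullback.condition_assoc])
    have hp : p₁ ≫ fibreι π x = p₂ ≫ a := Over.OverMorphism.ext pullback.condition
    -- The local section over the part of the fibre in a chart sends a point to the class of its
    -- form `l`.
    refine ⟨D, p₁, inferInstanceAs (IsOpenImmersion (pullback.fst _ _)), p₂ ≫ t, ?_, ?_⟩
    · change _ ∈ Set.range (pullback.fst (fibreι π x).left a.left)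
      rw [Scheme.Pullback.range_fst]
      exact har.ge hi
    · rw [← cancel_mono (fibreι π x), Category.assoc, Category.assoc, hg, hp]
      refine ht _ _ ?_
      rw [← Category.assoc, ← hp, Category.assoc, fibreι_comp, ← Category.assoc, comp_toPt]) hinj
  exact ⟨(Over.isoMk (asIso g.left) (Over.w g)).symm⟩

end RationalFibre

/-! ### `K`-points as subspaces and flags -/

section KPoints

variable {κ : Type*} [Field κ] [Fintype κ] {K : Type u} [Field K] [Algebra κ K] [IsAlgClosed K]
  {V : Type*} [AddCommGroup V] [Module κ V] {n m : ℕ} {ω : LinearMap.BilinForm κ V}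

/-- The `K`-points of `Y_V`. -/
theorem YV.exists_equiv (e : Module.Basis (Fin n) κ V) (hn : n = 2 * m) (hω : ω.IsAlt)
    (hω' : ω.Nondegenerate) :
    ∃ φ : KPoint (YV K e ω m) ≃ {p : Submodule K (K ⊗[κ] V) × Submodule K (K ⊗[κ] V) //
        IsLagrangian K ω m p.1 ∧ Module.finrank K p.2 = m - 1 ∧ p.2 ≤ p.1 ⊓ frob κ K p.1},
      ∀ y, YV.IsPoint K e y (φ y).1.1 (φ y).1.2 := by
  choose U U' hU hU' hle h using YV.exists_isPoint (K := K) (e := e) hn hω hω'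
  refine ⟨Equiv.ofBijective (fun y ↦ ⟨(U y, U' y), hU y, hU' y, hle y⟩) ⟨fun y y' hy ↦ ?_, ?_⟩, h⟩
  · have h1 := congr_arg Subtype.val hy
    have h2 : U y = U y' := congr_arg Prod.fst h1
    have h3 : U' y = U' y' := congr_arg Prod.snd h1
    exact (h y).point_eq (by rw [h2, h3]; exact h y')
  · rintro ⟨⟨W, W'⟩, hW, hW', hle'⟩
    obtain ⟨y, hy⟩ := YV.exists_point e hW hW' hle'
    obtain ⟨h1, h2⟩ := (h y).eq hy
    exact ⟨y, Subtype.ext (Prod.ext h1 h2)⟩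

/-- The `K`-points of `S_V`. -/
theorem SV.exists_equiv (e : Module.Basis (Fin n) κ V) (hn : n = 2 * m) (hω : ω.IsAlt)
    (hω' : ω.Nondegenerate) :
    ∃ ψ : KPoint (SV K e ω m) ≃ {U : Submodule K (K ⊗[κ] V) //
        IsLagrangian K ω m U ∧ m - 1 ≤ Module.finrank K ↥(U ⊓ frob κ K U)},
      ∀ x, SV.IsPoint K e x (ψ x).1 := by
  choose U hU hd h using SV.exists_isPoint (K := K) (e := e) hn hω hω'
  refine ⟨Equiv.ofBijective (fun y ↦ ⟨U y, hU y, hd y⟩) ⟨fun y y' hy ↦ ?_, ?_⟩, h⟩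
  · have h1 : U y = U y' := congr_arg Subtype.val hy
    exact (h y).point_eq (by rw [h1]; exact h y')
  · rintro ⟨W, hW, hd'⟩
    obtain ⟨y, hy⟩ := SV.exists_point e hW hd'
    exact ⟨y, Subtype.ext ((h y).eq hy)⟩

end KPoints

end

end DeligneLusztig

theorem mainTheorem12 {κ : Type*} [Field κ] [Fintype κ]
    (K : Type u) [Field K] [Algebra κ K] [IsAlgClosure κ K]
    {V : Type*} [AddCommGroup V] [Module κ V]
    (m : ℕ) (hm : 1 ≤ m) (e : Module.Basis (Fin (2 * m)) κ V)
    (ω : LinearMap.BilinForm κ V) (hω : ω.IsAlt) (hω' : ω.Nondegenerate) :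
    -- `Y_V` is smooth of dimension `m` and projective over `K`
    SmoothOfRelativeDimension m (DeligneLusztig.YV K e ω m).hom ∧
    DeligneLusztig.IsProjectiveOver (DeligneLusztig.YV K e ω m) ∧
    -- the `K`-points of `Y_V`
    (∃ φ : DeligneLusztig.KPoint (DeligneLusztig.YV K e ω m) ≃
        {p : Submodule K (K ⊗[κ] V) × Submodule K (K ⊗[κ] V) //
          DeligneLusztig.IsLagrangian K ω m p.1 ∧ Module.finrank K p.2 = m - 1 ∧
            p.2 ≤ p.1 ⊓ DeligneLusztig.frob κ K p.1},
      ∀ y, DeligneLusztig.YV.IsPoint K e y (φ y).1.1 (φ y).1.2) ∧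
    -- the `K`-points of `S_V`
    (∃ ψ : DeligneLusztig.KPoint (DeligneLusztig.SV K e ω m) ≃
        {U : Submodule K (K ⊗[κ] V) //
          DeligneLusztig.IsLagrangian K ω m U ∧
            m - 1 ≤ Module.finrank K ↥(U ⊓ DeligneLusztig.frob κ K U)},
      ∀ x, DeligneLusztig.SV.IsPoint K e x (ψ x).1) ∧
    -- the forgetful map `(U, U') ↦ U`
    (∃ π : DeligneLusztig.YV K e ω m ⟶ DeligneLusztig.SV K e ω m,
      π ≫ DeligneLusztig.SV.ι K e ω m =
        DeligneLusztig.YV.ι K e ω m ≫ DeligneLusztig.prodFst _ _ ∧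
      -- it is an isomorphism over the complement of the `κ`-points
      (∃ W : (DeligneLusztig.SV K e ω m).left.Opens,
        (W : Set (DeligneLusztig.SV K e ω m).left) =
          {s | ∃ x : DeligneLusztig.KPoint (DeligneLusztig.SV K e ω m),
            DeligneLusztig.SV.IsRational K e x ∧ x.pt = s}ᶜ ∧
        IsIso (π.left ∣_ W)) ∧
      -- its fibres over the `κ`-points are projective spaces of dimension `m - 1`
      ∀ x : DeligneLusztig.KPoint (DeligneLusztig.SV K e ω m),
        DeligneLusztig.SV.IsRational K e x →
          Nonempty (DeligneLusztig.fibreOver π x ≅ DeligneLusztig.projSpace K (Fin m))) := by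
  have : IsAlgClosed K := IsAlgClosure.isAlgClosed κ
  -- With `m = r + 1` the subspaces `U'` have dimension `r` and the truncated subtraction in `m - 1`
  -- is harmless.
  obtain ⟨r, rfl⟩ : ∃ r, m = r + 1 := ⟨m - 1, by omega⟩
  obtain ⟨π, hπ⟩ := DeligneLusztig.exists_projection (K := K) e rfl hω hω'
  obtain ⟨W, hW⟩ := DeligneLusztig.exists_opens_isRational (K := K) (ω := ω) (r := r) e
  have : NeZero (2 * (r + 1)) := ⟨by omega⟩
  exact ⟨DeligneLusztig.smoothOfRelativeDimension_YV e rfl hω hω',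
    DeligneLusztig.isProjectiveOver_YV e ω _, DeligneLusztig.YV.exists_equiv e rfl hω hω',
    DeligneLusztig.SV.exists_equiv e rfl hω hω', π, hπ,
    ⟨W, hW, DeligneLusztig.isIso_projection rfl hω hω' hπ hW⟩,
    fun x hx ↦ DeligneLusztig.nonempty_fibreOver_iso rfl hω hω' hπ hx⟩
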